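/- **Theorem 5.2.** Let the dimension be $d=2$ and let $m_0>0$. Let $\psi:\mathbb R\to\mathbb C$ be a Lévy characteristic (continuous, $\psi(0)=0$, hermitian and conditionally positive definite) that is infinitely often differentiable at $0$, and put $c_n=(-i)^n\psi^{(n)}(0)$. Let $\eta$ and $\tilde\eta$ be independent random fields with values in the real tempered distributions $\mathcal S'(\mathbb R^2)$ and with characteristic functionals $$\mathbb E\,e^{i\eta(h)}=\exp\Big\{\int_{\mathbb R^2}\psi(h(x))\,dx\Big\},\qquad \mathbb E\,e^{i\tilde\eta(h)}=\exp\Big\{-\frac{c_2}{2m_0^2}\int_{\mathbb R^2}|\nabla h|^2\,dx\Big\},\qquad h\in\mathcal S(\mathbb R^2).$$ Let $\phi$ be a random tempered distribution that almost surely solves $(-\Delta+m_0^2)\phi=\eta+\tilde\eta$, and let $\nu_0$ be its law (so that the truncated two-point function of $\nu_0$ is $\frac{c_2}{m_0^2}g(x-y)$, with $g$ the Green's function of $-\Delta+m_0^2$). Let $\chi_\varepsilon\in\mathcal S(\mathbb R^2)$, $\varepsilon>0$, be an approximation of the Dirac measure at $0$: as $\varepsilon\searrow0$, $\chi_\varepsilon\to\delta_0$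 in $\mathcal S'$, the norms $\|\chi_\varepsilon\|_{L^1}$ stay bounded, and for each $\delta>0$ one has $\chi_\varepsilon\to0$ uniformly and in $L^1$ on $\{|x|\ge\delta\}$; for instance $\chi_\varepsilon(x)=\varepsilon^{-2}\chi(x/\varepsilon)$ with $\chi\in\mathcal S(\mathbb R^2)$, $\int\chi=1$. Let $\nu_0^\varepsilon$, a measure on continuous functions, be the image of $\nu_0$ under $\phi\mapsto\phi*\chi_\varepsilon$. For a probability measure $\nu$ on continuous functions with finite moments, write $\langle\cdot\rangle_\nu$ for its expectation. For a finite set $J$ of indices with points $x_j$, let $\langle J\rangle_\nu=\langle\prod_{j\in J}\phi(x_j)\rangle_\nu$, and define the truncated moments $\langle J\rangle^T_\nu$ recursively by $\langle J\rangle_\nu=\sum_{I}\prod_{B\in I}\langle B\rangle^T_\nu$ (sum over all partitions $I$ of $J\neq\emptyset$), and the Wick products by $:\emptyset:\,=1$ and, for $J\ne\emptyset$, $$:J:\;=\prod_{j\in J}\phi(x_j)-\langle J\rangle_\nu-\sum_{I,\,|I|>1}\ \sum_{B\in I}:B:\prod_{B'\in I,\,B'\neq B}\langle B'\rangle^T_\nu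 .$$ The Wick power $:\phi^p:_\nu(y)$ is the Wick product of $p$ field values at the same point $y$. Let $\bar p\in\mathbb N_0$, $\lambda_0,\dots,\lambda_{\bar p}\in\mathbb R$, let $\Lambda\subset\mathbb R^2$ be bounded and measurable, and put $$V^\varepsilon_\Lambda(\phi)=\int_\Lambda\sum_{p=0}^{\bar p}\lambda_p:\phi^p:_{\nu_0^\varepsilon}(y)\,dy .$$ Then the perturbation series of the ultraviolet-regularized measures converges term by term as $\varepsilon\searrow0$. That is, for all $n,m\in\mathbb N_0$ and all pairwise distinct $x_1,\dots,x_n\in\mathbb R^2$: 1. for every $\varepsilon>0$ the function $\phi(x_1)\cdots\phi(x_n)(V_\Lambda^\varepsilon)^m$ is $\nu_0^\varepsilon$-integrable, and the $m$-th order term $$\frac{(-1)^m}{m!}\big\langle\phi(x_1)\cdots\phi(x_n)\,(V_\Lambda^\varepsilon)^m\big\rangle_{\nu_0^\varepsilon}$$ has a finite limit as $\varepsilon\searrow0$; 2. the same holds graph by graph. Let $p_1,\dots,p_m\le\bar p$ and let $G$ be a generalized Feynman graph with $n$ outer full vertices (one leg each) and $m$ inner full vertices with $p_1,\dots,p_m$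 legs, i.e. a partition of the set of all these legs, the blocks being the inner empty vertices. Suppose that $G$ has no self-contraction, i.e. no block consists of legs of one and the same inner full vertex. Place the outer vertices at $x_1,\dots,x_n$ and the inner full ones at $y_1,\dots,y_m$. Then for every $\varepsilon>0$ the product over the blocks of $G$ of the truncated moments of $\nu_0^\varepsilon$ at the points of their legs is integrable in $(y_1,\dots,y_m)$ over $\Lambda^m$, and the value $$\mathcal V^\varepsilon_\Lambda[G](x_1,\dots,x_n)=\lambda_{p_1}\cdots\lambda_{p_m}\int_{\Lambda^m}\ \prod_{B\in G}\langle B\rangle^T_{\nu_0^\varepsilon}\,dy_1\cdots dy_m$$ has a finite limit as $\varepsilon\searrow0$. -/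

import Mathlib

open MeasureTheory ProbabilityTheory Filter Topology
open scoped SchwartzMap ContDiff Laplacian

noncomputable section

/-- The underlying space `ℝ²` with its Euclidean norm. -/
abbrev Plane : Type := EuclideanSpace ℝ (Fin 2)

/-- Real tempered distributions on the plane, with the weak topology (pointwise convergence on
test functions). -/
abbrev RealDistribution : Type := 𝓢(Plane, ℝ) →Lₚₜ[ℝ] ℝ

/-- The Borel σ-algebra of the weak topology. -/
instance RealDistribution.measurableSpace : MeasurableSpace RealDistribution := borel _

/-- The σ-algebra on continuous fields generated by the evaluations `φ ↦ φ x` (it is also the Borel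
σ-algebra of locally uniform convergence). -/
instance ContinuousField.measurableSpace : MeasurableSpace C(Plane, ℝ) :=
  MeasurableSpace.comap (fun φ : C(Plane, ℝ) => (φ : Plane → ℝ)) MeasurableSpace.pi

section Noise

/-- Lévy characteristics: continuous, normalized, (hermitian) conditionally positive definite
functions `ψ : ℝ → ℂ`. -/
structure IsLevyCharacteristic (ψ : ℝ → ℂ) : Prop where
  continuous : Continuous ψ
  map_zero : ψ 0 = 0
  hermitian : ∀ t, ψ (-t) = starRingEnd ℂ (ψ t)
  condPosDef : ∀ (n : ℕ) (t : Fin n → ℝ) (c : Fin n → ℂ), ∑ i, c i = 0 →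
    0 ≤ (∑ i, ∑ j, ψ (t i - t j) * c i * starRingEnd ℂ (c j)).re

/-- The constants `c_n = (-i)^n ψ⁽ⁿ⁾(0)` (they are real for a smooth hermitian `ψ`). -/
def levyCumulant (ψ : ℝ → ℂ) (n : ℕ) : ℝ := ((-Complex.I) ^ n * iteratedDeriv n ψ 0).re

variable {Ω : Type*} [MeasurableSpace Ω]

/-- `η` is a Lévy noise field with characteristic `ψ`:
`𝔼[exp(i η(h))] = exp(∫ ψ(h(x)) dx)` for all test functions `h`. -/
def IsLevyNoise (P : Measure Ω) (ψ : ℝ → ℂ) (η : Ω → RealDistribution) : Prop :=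
  ∀ h : 𝓢(Plane, ℝ), ∫ w, Complex.exp (Complex.I * (η w h : ℂ)) ∂P
    = Complex.exp (∫ x, ψ (h x))

/-- `ξ` is a centred gradient Gaussian noise field of strength `κ`:
`𝔼[exp(i ξ(h))] = exp(-κ ∫ |∇h|² dx)` for all test functions `h`. -/
def IsGradientGaussianNoise (P : Measure Ω) (κ : ℝ) (ξ : Ω → RealDistribution) : Prop :=
  ∀ h : 𝓢(Plane, ℝ), ∫ w, Complex.exp (Complex.I * (ξ w h : ℂ)) ∂P
    = Complex.exp (((-κ * ∫ x, ‖gradient (fun y => h y) x‖ ^ 2 : ℝ) : ℂ))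

/-- `(-Δ + m₀²) T = S` in the sense of distributions. -/
def SolvesMassiveEquation (m₀ : ℝ) (T S : RealDistribution) : Prop :=
  ∀ h : 𝓢(Plane, ℝ), T (-(Δ h) + m₀ ^ 2 • h) = S h

end Noise

section Regularization

/-- Translations act continuously on the Schwartz space. -/
theorem tendsto_translate_zero (f : 𝓢(Plane, ℝ)) :
    Tendsto (fun a : Plane => f.compSubConstCLM ℝ a) (𝓝 0) (𝓝 f) := by
  rw [(schwartz_withSeminorms ℝ Plane ℝ).tendsto_nhds]
  rintro ⟨k, n⟩ ε hε
  set C : ℝ := 2 ^ k * ((Finset.Iic ((k, n + 1) : ℕ × ℕ)).sup fun m => SchwartzMap.seminorm ℝ m.1 m.2) f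
    with hC
  have hC0 : 0 ≤ C := mul_nonneg (by positivity) (apply_nonneg _ _)
  have hb : ∀ a : Plane, ‖a‖ ≤ 1 →
      SchwartzMap.seminorm ℝ k n (f.compSubConstCLM ℝ a - f) ≤ C * ‖a‖ := by
    intro a ha
    refine SchwartzMap.seminorm_le_bound ℝ k n _ (by positivity) fun x => ?_
    have e : iteratedFDeriv ℝ n (⇑(f.compSubConstCLM ℝ a - f)) x
        = iteratedFDeriv ℝ n f (x - a) - iteratedFDeriv ℝ n f x := by
      have h1 : (⇑(f.compSubConstCLM ℝ a - f)) = (fun y => f (y - a)) - ⇑f := by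
        ext y; simp
      rw [h1, iteratedFDeriv_sub_apply, iteratedFDeriv_comp_sub]
      · exact ((f.smooth n).comp (contDiff_id.sub contDiff_const)).contDiffAt
      · exact (f.smooth n).contDiffAt
    rw [e]
    have hd : ∀ z ∈ segment ℝ x (x - a), ‖fderiv ℝ (iteratedFDeriv ℝ n f) z‖ * ‖x‖ ^ k ≤ C := by
      intro z hz
      have hzx : ‖x - z‖ ≤ ‖a‖ := by
        obtain ⟨t, ⟨h0, h1⟩, rfl⟩ := (segment_eq_image' ℝ x (x - a)) ▸ hz
        have : x - (x + t • (x - a - x)) = t • a := by module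
        rw [this, norm_smul, Real.norm_eq_abs, abs_of_nonneg h0]
        exact mul_le_of_le_one_left (norm_nonneg _) h1
      have hx : ‖x‖ ≤ 1 + ‖z‖ := by
        have := norm_add_le (x - z) z
        rw [sub_add_cancel] at this
        linarith
      rw [norm_fderiv_iteratedFDeriv, mul_comm]
      have h2 := SchwartzMap.one_add_le_sup_seminorm_apply (𝕜 := ℝ) (m := (k, n + 1))
        (k := k) (n := n + 1) le_rfl le_rfl f z
      refine le_trans ?_ h2
      gcongr
    rcases eq_or_lt_of_le (pow_nonneg (norm_nonneg x) k) with h0 | h0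
    · rw [← h0, zero_mul]; positivity
    have := (convex_segment x (x - a)).norm_image_sub_le_of_norm_fderiv_le (𝕜 := ℝ)
      (f := iteratedFDeriv ℝ n f) (C := C / ‖x‖ ^ k)
      (fun z _ => ((f.smooth ⊤).differentiable_iteratedFDeriv
        (by exact_mod_cast ENat.natCast_lt_top n) z))
      (fun z hz => (le_div_iff₀ h0).2 (hd z hz)) (left_mem_segment ℝ _ _)
      (right_mem_segment ℝ _ _)
    have h3 : ‖x - a - x‖ = ‖a‖ := by rw [sub_sub_cancel_left, norm_neg]
    rw [h3] at this
    calc ‖x‖ ^ k * ‖iteratedFDeriv ℝ n f (x - a) - iteratedFDeriv ℝ n f x‖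
        ≤ ‖x‖ ^ k * (C / ‖x‖ ^ k * ‖a‖) := by gcongr
      _ = C * ‖a‖ := by field_simp
  have hev : ∀ᶠ a : Plane in 𝓝 0, ‖a‖ < min 1 (ε / (C + 1)) := by
    have : Tendsto (fun a : Plane => ‖a‖) (𝓝 0) (𝓝 0) := by
      simpa using (continuous_norm (E := Plane)).tendsto 0
    exact this.eventually_lt_const (lt_min one_pos (by positivity))
  filter_upwards [hev] with a ha
  have h1 : ‖a‖ ≤ 1 := (ha.trans_le (min_le_left _ _)).le
  have h2 : ‖a‖ < ε / (C + 1) := ha.trans_le (min_le_right _ _)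
  refine (hb a h1).trans_lt ?_
  rw [lt_div_iff₀ (by positivity)] at h2
  nlinarith [norm_nonneg a]

theorem continuous_translate (f : 𝓢(Plane, ℝ)) :
    Continuous fun a : Plane => f.compSubConstCLM ℝ a := by
  rw [continuous_iff_continuousAt]
  intro a
  have h : (fun b : Plane => f.compSubConstCLM ℝ b)
      = fun b => SchwartzMap.compSubConstCLM ℝ a (f.compSubConstCLM ℝ (b - a)) := by
    ext b x
    simp only [SchwartzMap.compSubConstCLM_apply]
    congr 1
    abel
  have h0 : Tendsto (fun b : Plane => b - a) (𝓝 a) (𝓝 0) := by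
    have hc : Continuous fun b : Plane => b - a := by fun_prop
    simpa using hc.tendsto a
  have h1 := ((SchwartzMap.compSubConstCLM ℝ a).continuous.tendsto f).comp
    ((tendsto_translate_zero f).comp h0)
  unfold ContinuousAt
  rw [h]
  simpa [Function.comp_def] using h1

/-- The reflected and translated test function `w ↦ χ(x - w)`. -/
def reflectTranslate (χ : 𝓢(Plane, ℝ)) (x : Plane) : 𝓢(Plane, ℝ) :=
  (SchwartzMap.compCLMOfContinuousLinearEquiv ℝ (ContinuousLinearEquiv.neg ℝ) χ).compSubConstCLM ℝ x

theorem reflectTranslate_apply (χ : 𝓢(Plane, ℝ)) (x w : Plane) :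
    reflectTranslate χ x w = χ (x - w) := by
  simp [reflectTranslate]

/-- The convolution `T * χ`, the continuous function `x ↦ T(χ(x - ·))`. -/
def convolve (χ : 𝓢(Plane, ℝ)) (T : RealDistribution) : C(Plane, ℝ) where
  toFun x := T (reflectTranslate χ x)
  continuous_toFun := T.continuous.comp (continuous_translate _)

/-- The ultraviolet regularization of a measure on distributions: its image under `φ ↦ φ * χ`. -/
def uvRegularize (ν : Measure RealDistribution) (χ : 𝓢(Plane, ℝ)) : Measure C(Plane, ℝ) :=
  ν.map (convolve χ)

/-- Schwartz functions `χ_ε` approximating the Dirac measure at `0` as `ε ↘ 0`: they converge to it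
as distributions, are bounded in `L¹`, and away from the origin they tend to `0` uniformly and in
`L¹`. (For instance `χ_ε(x) = ε⁻² χ(x / ε)` with `χ` Schwartz and `∫ χ = 1`.) -/
structure IsDiracApproximation (χ : ℝ → 𝓢(Plane, ℝ)) : Prop where
  tendsto_dirac : ∀ h : 𝓢(Plane, ℝ),
    Tendsto (fun ε => ∫ x, χ ε x * h x) (𝓝[>] 0) (𝓝 (h 0))
  bounded : ∃ C : ℝ, ∀ᶠ ε in 𝓝[>] (0 : ℝ), ∫ x, |χ ε x| ≤ C
  tail_integral : ∀ δ > 0,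
    Tendsto (fun ε => ∫ x in {x : Plane | δ ≤ ‖x‖}, |χ ε x|) (𝓝[>] 0) (𝓝 0)
  tail_uniform : ∀ δ > 0,
    TendstoUniformlyOn (fun ε x => χ ε x) (fun _ => 0) (𝓝[>] (0 : ℝ)) {x : Plane | δ ≤ ‖x‖}

end Regularization

section Truncation

variable {ι : Type*} [DecidableEq ι]

/-- Truncated moments of a moment family `M`, recursively defined by
`M J = ∑_{I ∈ 𝒫(J)} ∏_{B ∈ I} M^T B` for nonempty `J`: the term of the one-block partition is
`M^T J` and the other partitions only involve smaller sets. -/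
def truncated (M : Finset ι → ℝ) (J : Finset ι) : ℝ :=
  M J - ∑ I : {I : Finpartition J // J ∉ I.parts},
    ∏ B : {B // B ∈ I.1.parts}, truncated M B.1
  termination_by J.card
  decreasing_by
    exact Finset.card_lt_card
      ((I.1.subset B.2).ssubset_of_ne fun h =>
        I.2 (Eq.subst (motive := fun t => t ∈ I.1.parts) h B.2))

/-- The Wick ordered product `:∏_{j ∈ J} X_j:` of numbers (values of random variables) `X_j` with
respect to a moment family `M`:
`:J: = ∏_{j ∈ J} X_j - M J - ∑_{I ∈ 𝒫(J), |I| > 1} ∑_{B ∈ I} :B: ∏_{B' ∈ I, B' ≠ B} M^T B'`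
for nonempty `J`, and `:∅: = 1`. -/
def wickProduct (M : Finset ι → ℝ) (X : ι → ℝ) (J : Finset ι) : ℝ :=
  if J = ∅ then 1 else
    ∏ j ∈ J, X j - M J - ∑ I : {I : Finpartition J // J ∉ I.parts},
      ∑ B : {B // B ∈ I.1.parts}, wickProduct M X B.1 *
        ∏ B' ∈ I.1.parts.erase B.1, truncated M B'
  termination_by J.card
  decreasing_by
    exact Finset.card_lt_card
      ((I.1.subset B.2).ssubset_of_ne fun h =>
        I.2 (Eq.subst (motive := fun t => t ∈ I.1.parts) h B.2))

/-- The moment `⟨∏_{j ∈ J} φ(x_j)⟩_ν`. -/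
def moment (ν : Measure C(Plane, ℝ)) (x : ι → Plane) (J : Finset ι) : ℝ :=
  ∫ φ, ∏ j ∈ J, φ (x j) ∂ν

end Truncation

section Perturbation

/-- The Wick power `:φ^p:_ν(y)`, i.e. the Wick product of `p` field values at coinciding points. -/
def wickPower (ν : Measure C(Plane, ℝ)) (p : ℕ) (φ : C(Plane, ℝ)) (y : Plane) : ℝ :=
  wickProduct (moment ν fun _ : Fin p => y) (fun _ => φ y) Finset.univ

/-- The Wick ordered interaction `V_Λ(φ) = ∫_Λ ∑_{p=0}^{p̄} λ_p :φ^p:_ν(y) dy`. -/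
def wickInteraction (ν : Measure C(Plane, ℝ)) (pbar : ℕ) (lam : ℕ → ℝ) (Λ : Set Plane)
    (φ : C(Plane, ℝ)) : ℝ :=
  ∫ y in Λ, ∑ p ∈ Finset.range (pbar + 1), lam p * wickPower ν p φ y

/-- The integrand `φ(x_1) ⋯ φ(x_n) V_Λ(φ)^m` of the `m`-th order of perturbation theory. -/
def perturbationIntegrand (ν : Measure C(Plane, ℝ)) (pbar : ℕ) (lam : ℕ → ℝ) (Λ : Set Plane)
    {n : ℕ} (x : Fin n → Plane) (m : ℕ) (φ : C(Plane, ℝ)) : ℝ :=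
  (∏ i, φ (x i)) * wickInteraction ν pbar lam Λ φ ^ m

/-- The `m`-th order term `(-1)^m / m! ⟨φ(x_1) ⋯ φ(x_n) V_Λ^m⟩_ν` of the perturbation series of the
(non-normalized) `n`-point function. -/
def perturbationTerm (ν : Measure C(Plane, ℝ)) (pbar : ℕ) (lam : ℕ → ℝ) (Λ : Set Plane)
    {n : ℕ} (x : Fin n → Plane) (m : ℕ) : ℝ :=
  (-1) ^ m / (m.factorial : ℝ) * ∫ φ, perturbationIntegrand ν pbar lam Λ x m φ ∂ν

/-- The legs of `n` outer full vertices (one leg each) and of `m` inner full vertices, the `l`-th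
of which has `p l` legs. -/
abbrev Leg (n : ℕ) {m : ℕ} (p : Fin m → ℕ) : Type := Fin n ⊕ (Σ l : Fin m, Fin (p l))

/-- Generalized `n`-point Feynman graphs with `m` inner full vertices of types `p 0, p 1, …`.
The legs of the full vertices are distinguishable, the empty vertices are not, and every edge joins
a leg of a full vertex to an empty vertex; so a graph is the partition of the set of legs into the
sets of legs which are joined to the same empty vertex. -/
abbrev FeynmanGraph (n : ℕ) {m : ℕ} (p : Fin m → ℕ) : Type :=
  Finpartition (Finset.univ : Finset (Leg n p))

/-- No empty vertex of the graph has all its legs at one and the same inner full vertex. -/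
def FeynmanGraph.NoSelfContraction {n m : ℕ} {p : Fin m → ℕ} (G : FeynmanGraph n p) : Prop :=
  ∀ I ∈ G.parts, ∀ l : Fin m, ¬ ∀ e ∈ I, ∃ k : Fin (p l), e = Sum.inr ⟨l, k⟩

/-- The point at which a leg sits, if the outer full vertices are at the points `x` and the inner
ones at the points `y`. -/
def legPoint {n m : ℕ} {p : Fin m → ℕ} (x : Fin n → Plane) (y : Fin m → Plane) :
    Leg n p → Plane :=
  Sum.elim x fun s => y s.1

/-- The product over all empty vertices of the truncated moment functions, evaluated at the points
of the adjacent full vertices. -/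
def graphIntegrand (ν : Measure C(Plane, ℝ)) {n m : ℕ} {p : Fin m → ℕ} (x : Fin n → Plane)
    (G : FeynmanGraph n p) (y : Fin m → Plane) : ℝ :=
  ∏ I ∈ G.parts, truncated (moment ν (legPoint x y)) I

/-- The value of a generalized Feynman graph: the coupling constants of the inner full vertices
times the integral of the product of truncated moment functions over the positions in `Λ` of the
inner full vertices. -/
def graphValue (ν : Measure C(Plane, ℝ)) (lam : ℕ → ℝ) (Λ : Set Plane) {n m : ℕ}
    {p : Fin m → ℕ} (x : Fin n → Plane) (G : FeynmanGraph n p) : ℝ :=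
  (∏ l, lam (p l)) * ∫ y in Set.univ.pi fun _ : Fin m => Λ, graphIntegrand ν x G y

end Perturbation

end

/-! The truncated moments of the regularized field have a closed form, and every limit is read off
from it. If `(-Δ + m₀²) u = f`, testing the equation with `u` gives `φ f = η u + ηg u`. By
independence the joint characteristic function of variables `φ f_j` is the exponential of `∫ ψ(∑ t_j
u_j) - κ ∫ |∇ ∑ t_j u_j|²`, and the mixed derivatives of this exponent at `t = 0` are, up to powers
of `-i`, the truncated moments. For `f_j = χ(x_j - ·)` one has `u_j = (χ * g)(x_j - ·)`. A block
with `k ≠ 2` legs contributes `c_k ∫ ∏ (χ * g)(x_j - z) dz`. For a pair, `κ = c₂ / (2 m₀²)` is the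
strength for which noise and gradient noise combine to `c₂ / m₀²` times `g` smeared twice, at the
difference of the two points (`truncated_eq`, `truncated_pair_eq`).

In dimension two `g` lies in every `L^q` with `1 ≤ q < ∞` (`memLp_massiveGreen`) and is locally
Lipschitz away from the origin. Hence the smeared kernels converge to `g` in `L^q` for all finite `q
≥ 2` (`ApproximatesGreen.tendstoInLp`). By Hölder, blocks with at least three legs converge
uniformly in the positions; blocks with one leg are constants. A pair block is singular at
coinciding points, but without self-contraction the difference of its points is either a fixed
nonzero vector or a variable whose distribution over `Λ^m` has bounded density
(`map_sub_apply_restrict_pi_le`). So every block converges in every `L^q(Λ^m)`, `q ≥ 2`; finite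
products inherit this, and their integrals converge (`graphValue_converges`).

The perturbation terms reduce to graphs by Wick's theorem. Sums over partitions are exponentials for
the convolution over splittings of the index set: with `M^T` the truncated moments, moments are `exp
M^T` and Wick products are `exp (X - M^T)` (`wickProduct_eq_partitionSum`). In the expectation of a
product of fields and Wick powers the subtractions cancel exactly the self-contracted blocks
(`integral_prod_mul_prod_wickPower`). Fubini, justified because one-point moments do not depend on
the point, then writes each term as a finite sum of graph values (`perturbationTerm_eq`). -/

noncomputable section
-- Partition sums as exponentials; cumulants and Wick products
section PartitionSums

variable {ι R : Type*} [DecidableEq ι] [CommRing R]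

/-- The sum over all partitions of `J` of the product of the values of `C` on the blocks. -/
def partitionSum (C : Finset ι → R) (J : Finset ι) : R :=
  ∑ I : Finpartition J, ∏ B ∈ I.parts, C B

/-- The convolution of set functions over the splittings of a finite set into two subsets. -/
def subsetConv (F G : Finset ι → R) (J : Finset ι) : R :=
  ∑ B ∈ J.powerset, F B * G (J \ B)

theorem Finpartition.parts_avoid_of_mem {J : Finset ι} (I : Finpartition J) {B : Finset ι}
    (hB : B ∈ I.parts) : (I.avoid B).parts = I.parts.erase B := by
  ext D
  rw [Finpartition.mem_avoid, Finset.mem_erase]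
  have key : ∀ E ∈ I.parts, E ≠ B → E \ B = E := fun E hE h =>
    Finset.sdiff_eq_self_of_disjoint (I.disjoint hE hB h)
  constructor
  · rintro ⟨E, hE, h1, rfl⟩
    have hne : E ≠ B := fun h => h1 h.le
    rw [key E hE hne]
    exact ⟨hne, hE⟩
  · rintro ⟨hne, hD⟩
    refine ⟨D, hD, fun h => I.ne_bot hD ?_, key D hD hne⟩
    exact (I.disjoint hD hB hne).eq_bot_of_le h

/-- A partition with a marked block is the same as a nonempty subset together with a partition of
its complement. This turns the block sums of the Wick recursion into sums over subsets. -/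
theorem sum_finpartition_sum_parts {M : Type*} [AddCommMonoid M] (J : Finset ι)
    (f : Finset ι → Finset (Finset ι) → M) :
    ∑ I : Finpartition J, ∑ B ∈ I.parts, f B (I.parts.erase B)
      = ∑ B ∈ J.powerset with B.Nonempty, ∑ I : Finpartition (J \ B), f B I.parts := by
  rw [Finset.sum_sigma', Finset.sum_sigma']
  have hx : ∀ x : (Σ B : Finset ι, Finpartition (J \ B)),
      x ∈ (Finset.sigma (J.powerset.filter fun B => B.Nonempty) fun B => Finset.univ) →
      x.1 ≠ ⊥ ∧ Disjoint (J \ x.1) x.1 ∧ (J \ x.1) ⊔ x.1 = J := by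
    rintro ⟨B, I⟩ hB
    simp only [Finset.mem_sigma, Finset.mem_filter, Finset.mem_powerset, Finset.mem_univ,
      and_true] at hB
    exact ⟨hB.2.ne_empty, Finset.sdiff_disjoint, Finset.sdiff_union_of_subset hB.1⟩
  have hnot : ∀ (B : Finset ι) (I : Finpartition (J \ B)), B.Nonempty → B ∉ I.parts := by
    intro B I hB h
    obtain ⟨b, hb⟩ := hB
    exact (Finset.mem_sdiff.1 (I.subset h hb)).2 hb
  refine Finset.sum_bij' (fun x _ => ⟨x.2, x.1.avoid x.2⟩)
    (fun x h => ⟨x.2.extend (hx x h).1 (hx x h).2.1 (hx x h).2.2, x.1⟩) ?_ ?_ ?_ ?_ ?_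
  · rintro ⟨I, B⟩ h
    simp only [Finset.mem_sigma, Finset.mem_univ, true_and] at h
    simp [I.subset h, I.nonempty_of_mem_parts h]
  · rintro ⟨B, I⟩ h
    simp
  · rintro ⟨I, B⟩ h
    simp only [Finset.mem_sigma, Finset.mem_univ, true_and] at h
    refine Sigma.ext (Finpartition.ext ?_) HEq.rfl
    simp [I.parts_avoid_of_mem h, Finset.insert_erase h]
  · rintro ⟨B, I⟩ h
    refine Sigma.ext rfl (heq_of_eq (Finpartition.ext ?_))
    simp only [Finset.mem_sigma, Finset.mem_filter, Finset.mem_powerset, Finset.mem_univ,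
      and_true] at h
    rw [Finpartition.parts_avoid_of_mem _ (by simp)]
    simp [Finset.erase_insert (hnot B I h.2)]
  · rintro ⟨I, B⟩ h
    simp only [Finset.mem_sigma, Finset.mem_univ, true_and] at h
    simp [I.parts_avoid_of_mem h]

@[simp]
theorem partitionSum_empty (C : Finset ι → R) : partitionSum C ∅ = 1 := by
  unfold partitionSum
  have : Unique (Finpartition (∅ : Finset ι)) := inferInstanceAs (Unique (Finpartition (⊥ : Finset ι)))
  have h : ∀ I : Finpartition (∅ : Finset ι), I.parts = ∅ := fun I =>
    I.parts_eq_empty_iff.2 rfl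
  rw [Finset.sum_eq_single (default : Finpartition (∅ : Finset ι))]
  · rw [h, Finset.prod_empty]
  · intro I _ hI
    exact absurd (Finpartition.ext (by rw [h, h])) hI
  · simp

/-- Partitions are sorted by the block that contains `a`. This recursion drives the inductions on
partition sums, and it has the same shape as the Leibniz rule for derivatives of an exponential. -/
theorem partitionSum_insert (C : Finset ι → R) {a : ι} {J : Finset ι} (ha : a ∉ J) :
    partitionSum C (insert a J)
      = ∑ B ∈ J.powerset, C (insert a B) * partitionSum C (J \ B) := by
  have h1 : partitionSum C (insert a J) = ∑ I : Finpartition (insert a J), ∑ B ∈ I.parts,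
      if a ∈ B then C B * ∏ B' ∈ I.parts.erase B, C B' else 0 := by
    refine Finset.sum_congr rfl fun I _ => ?_
    obtain ⟨B, hB, haB⟩ := I.exists_mem (Finset.mem_insert_self a J)
    rw [Finset.sum_eq_single B, if_pos haB, Finset.mul_prod_erase _ _ hB]
    · intro B' hB' hne
      rw [if_neg fun h => hne (I.eq_of_mem_parts hB' hB h haB)]
    · exact fun h => absurd hB h
  rw [h1, sum_finpartition_sum_parts _ fun B P => if a ∈ B then C B * ∏ B' ∈ P, C B' else 0]
  rw [← Finset.sum_filter_add_sum_filter_not _ (fun B => a ∈ B)]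
  rw [add_comm, Finset.sum_eq_zero, zero_add]
  · refine Finset.sum_bij' (fun B _ => B.erase a) (fun B _ => insert a B) ?_ ?_ ?_ ?_ ?_
    · intro B hB
      simp only [Finset.mem_filter, Finset.mem_powerset] at hB ⊢
      exact Finset.subset_insert_iff.1 hB.1.1
    · intro B hB
      simp only [Finset.mem_filter, Finset.mem_powerset] at hB ⊢
      exact ⟨⟨Finset.insert_subset_insert _ hB, Finset.insert_nonempty _ _⟩,
        Finset.mem_insert_self _ _⟩
    · intro B hB
      exact Finset.insert_erase (Finset.mem_filter.1 hB).2
    · intro B hB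
      exact Finset.erase_insert fun h => ha (Finset.mem_powerset.1 hB h)
    · intro B hB
      simp only [Finset.mem_filter, Finset.mem_powerset] at hB
      rw [Finset.insert_erase hB.2]
      have : insert a J \ B = J \ B.erase a := by
        ext b
        simp only [Finset.mem_sdiff, Finset.mem_insert, Finset.mem_erase]
        constructor
        · rintro ⟨rfl | h, h2⟩
          · exact absurd hB.2 h2
          · exact ⟨h, fun h' => h2 h'.2⟩
        · rintro ⟨h, h2⟩
          exact ⟨Or.inr h, fun h' => h2 ⟨fun e => ha (e ▸ h), h'⟩⟩
      rw [this]
      simp only [if_pos hB.2]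
      rw [← Finset.mul_sum]
      rfl
  · intro B hB
    simp [(Finset.mem_filter.1 hB).2]

/-- Both sides run over the ordered splittings of `J` into three disjoint pieces. -/
theorem sum_powerset_sum_powerset {M : Type*} [AddCommMonoid M] (J : Finset ι)
    (f : Finset ι → Finset ι → Finset ι → M) :
    ∑ S ∈ J.powerset, ∑ B ∈ S.powerset, f B (S \ B) (J \ S)
      = ∑ B ∈ J.powerset, ∑ S ∈ (J \ B).powerset, f B S ((J \ B) \ S) := by
  rw [Finset.sum_sigma', Finset.sum_sigma']
  refine Finset.sum_bij' (fun x _ => ⟨x.2, x.1 \ x.2⟩) (fun x _ => ⟨x.1 ∪ x.2, x.1⟩) ?_ ?_ ?_ ?_ ?_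
  · rintro ⟨S, B⟩ h
    simp only [Finset.mem_sigma, Finset.mem_powerset] at h ⊢
    exact ⟨h.2.trans h.1, Finset.sdiff_subset_sdiff h.1 le_rfl⟩
  · rintro ⟨B, S⟩ h
    simp only [Finset.mem_sigma, Finset.mem_powerset] at h ⊢
    exact ⟨Finset.union_subset h.1 (h.2.trans Finset.sdiff_subset), Finset.subset_union_left⟩
  · rintro ⟨S, B⟩ h
    simp only [Finset.mem_sigma, Finset.mem_powerset] at h
    simp [Finset.union_sdiff_of_subset h.2]
  · rintro ⟨B, S⟩ h
    simp only [Finset.mem_sigma, Finset.mem_powerset] at h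
    have : Disjoint B S := (Finset.disjoint_sdiff (s := B) (t := J)).mono_right h.2
    simp [Finset.union_sdiff_cancel_left this]
  · rintro ⟨S, B⟩ h
    simp only [Finset.mem_sigma, Finset.mem_powerset] at h
    have : (J \ B) \ (S \ B) = J \ S := by
      ext b
      simp only [Finset.mem_sdiff]
      have := @h.2 b
      tauto
    simp [this]

theorem subsetConv_comm (F G : Finset ι → R) : subsetConv F G = subsetConv G F := by
  ext J
  refine Finset.sum_bij' (fun B _ => J \ B) (fun B _ => J \ B) ?_ ?_ ?_ ?_ ?_ <;>
    intro B hB <;> simp only [Finset.mem_powerset] at hB ⊢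
  · exact Finset.sdiff_subset
  · exact Finset.sdiff_subset
  · exact Finset.sdiff_sdiff_eq_self hB
  · exact Finset.sdiff_sdiff_eq_self hB
  · rw [Finset.sdiff_sdiff_eq_self hB, mul_comm]

theorem subsetConv_assoc (F G H : Finset ι → R) :
    subsetConv (subsetConv F G) H = subsetConv F (subsetConv G H) := by
  ext J
  simp only [subsetConv, Finset.sum_mul, Finset.mul_sum]
  rw [sum_powerset_sum_powerset J fun B S T => F B * G S * H T]
  simp only [mul_assoc]

/-- The law `exp (C + D) = exp C * exp D`: expanding the product over blocks colours each block by
`C` or `D`, and the union of the `C`-blocks is the subset in the convolution. In the induction the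
colour of the block of one chosen element `a` gives the two halves of the sum. -/
theorem partitionSum_add (C D : Finset ι → R) :
    partitionSum (C + D) = subsetConv (partitionSum C) (partitionSum D) := by
  ext J
  induction J using Finset.strongInduction with
  | H J ih =>
    rcases J.eq_empty_or_nonempty with rfl | ⟨a, ha⟩
    · simp [subsetConv]
    obtain ⟨J, haJ, rfl⟩ : ∃ J' : Finset ι, a ∉ J' ∧ insert a J' = J :=
      ⟨J.erase a, Finset.notMem_erase _ _, Finset.insert_erase ha⟩
    have hsub : ∀ B : Finset ι, J \ B ⊂ insert a J := fun B =>
      Finset.sdiff_subset.trans_ssubset (Finset.ssubset_insert haJ)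
    rw [partitionSum_insert _ haJ, subsetConv, Finset.sum_powerset_insert haJ]
    have e1 : ∀ S ∈ J.powerset, partitionSum C S * partitionSum D (insert a J \ S)
        = ∑ B ∈ (J \ S).powerset, partitionSum C S * (D (insert a B) *
          partitionSum D ((J \ S) \ B)) := by
      intro S hS
      rw [Finset.mem_powerset] at hS
      rw [Finset.insert_sdiff_of_notMem _ fun h => haJ (hS h), partitionSum_insert _
        (fun h => haJ (Finset.sdiff_subset h)), Finset.mul_sum]
    have e2 : ∀ S ∈ J.powerset, partitionSum C (insert a S) * partitionSum D (insert a J \ insert a S)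
        = ∑ B ∈ S.powerset, C (insert a B) * partitionSum C (S \ B) * partitionSum D (J \ S) := by
      intro S hS
      rw [Finset.mem_powerset] at hS
      rw [Finset.insert_sdiff_insert, Finset.sdiff_insert_of_notMem haJ,
        partitionSum_insert _ fun h => haJ (hS h), Finset.sum_mul]
    rw [Finset.sum_congr rfl e1, Finset.sum_congr rfl e2,
      sum_powerset_sum_powerset J fun B S T => C (insert a B) * partitionSum C S * partitionSum D T,
      ← sum_powerset_sum_powerset J fun B S T => partitionSum C B * (D (insert a S) *
          partitionSum D T)]
    have e3 : ∀ S ∈ J.powerset, ∑ B ∈ S.powerset, partitionSum C B * (D (insert a (S \ B)) *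
          partitionSum D (J \ S)) = ∑ B ∈ S.powerset, D (insert a B) * partitionSum C (S \ B) *
          partitionSum D (J \ S) := by
      intro S hS
      have := congrFun (subsetConv_comm (partitionSum C) fun B => D (insert a B)) S
      simp only [subsetConv] at this
      simp only [← mul_assoc]
      rw [← Finset.sum_mul, this, Finset.sum_mul]
    rw [Finset.sum_congr rfl e3,
      sum_powerset_sum_powerset J fun B S T => D (insert a B) * partitionSum C S * partitionSum D T,
      ← Finset.sum_add_distrib]
    refine Finset.sum_congr rfl fun B _ => ?_
    rw [ih _ (hsub B), subsetConv, ← Finset.sum_add_distrib, Finset.mul_sum]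
    refine Finset.sum_congr rfl fun S _ => ?_
    simp only [Pi.add_apply]
    ring

theorem partitionSum_congr {C D : Finset ι → R} {J : Finset ι}
    (h : ∀ B ⊆ J, B.Nonempty → C B = D B) : partitionSum C J = partitionSum D J :=
  Finset.sum_congr rfl fun I _ => Finset.prod_congr rfl fun _ hB =>
    h _ (I.subset hB) (I.nonempty_of_mem_parts hB)

theorem partitionSum_zero {J : Finset ι} (hJ : J.Nonempty) :
    partitionSum (0 : Finset ι → R) J = 0 := by
  refine Finset.sum_eq_zero fun I _ => ?_
  obtain ⟨B, hB⟩ := I.parts_nonempty hJ.ne_empty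
  exact Finset.prod_eq_zero hB rfl

/-- The set function supported on singletons with value `X j` on `{j}`. -/
def singletonValue (X : ι → R) (B : Finset ι) : R := if B.card = 1 then ∏ j ∈ B, X j else 0

theorem partitionSum_singletonValue (X : ι → R) (J : Finset ι) :
    partitionSum (singletonValue X) J = ∏ j ∈ J, X j := by
  induction J using Finset.induction_on with
  | empty => simp
  | insert a J ha ih =>
    rw [partitionSum_insert _ ha, Finset.prod_insert ha, Finset.sum_eq_single ∅]
    · simp [singletonValue, ih]
    · intro B hB hne
      have : (insert a B).card ≠ 1 := by
        rw [Finset.card_insert_of_notMem fun h => ha (Finset.mem_powerset.1 hB h)]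
        simpa using hne
      simp [singletonValue, this]
    · simp

/-- A partition with a block meeting both `U` and `V` has weight zero; what remains are pairs of a
partition of `U` and one of `V`. -/
theorem partitionSum_union {D : Finset ι → R} {U V : Finset ι} (hUV : Disjoint U V)
    (hD : ∀ B ⊆ U ∪ V, (B ∩ U).Nonempty → (B ∩ V).Nonempty → D B = 0) :
    partitionSum D (U ∪ V) = partitionSum D U * partitionSum D V := by
  induction U using Finset.strongInduction with
  | H U ih =>
    rcases U.eq_empty_or_nonempty with rfl | ⟨a, ha⟩
    · simp
    obtain ⟨U, haU, rfl⟩ : ∃ J' : Finset ι, a ∉ J' ∧ insert a J' = U :=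
      ⟨U.erase a, Finset.notMem_erase _ _, Finset.insert_erase ha⟩
    have haV : a ∉ V := fun h => Finset.disjoint_left.1 hUV ha h
    have hUV' : Disjoint U V := hUV.mono_left (Finset.subset_insert _ _)
    rw [Finset.insert_union, partitionSum_insert _ (by simp [haU, haV]), partitionSum_insert _ haU,
      Finset.sum_mul]
    symm
    refine Finset.sum_subset_zero_on_sdiff (Finset.powerset_mono.2 Finset.subset_union_left) ?_ ?_
    · intro B hB
      simp only [Finset.mem_sdiff, Finset.mem_powerset] at hB
      rw [hD, zero_mul]
      · rw [Finset.insert_union]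
        exact Finset.insert_subset_insert _ hB.1
      · exact ⟨a, by simp⟩
      · obtain ⟨b, hb, hbU⟩ := Finset.not_subset.1 hB.2
        have := hB.1 hb
        exact ⟨b, by simp_all⟩
    · intro B hB
      rw [Finset.mem_powerset] at hB
      have : (U ∪ V) \ B = (U \ B) ∪ V := by
        rw [Finset.union_sdiff_distrib, Finset.sdiff_eq_self_of_disjoint (s := V)]
        exact (hUV'.mono_left hB).symm
      have hsub : U \ B ⊆ insert a U := Finset.sdiff_subset.trans (Finset.subset_insert _ _)
      rw [this, ih _ (Finset.sdiff_subset.trans_ssubset (Finset.ssubset_insert haU))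
        (hUV'.mono_left Finset.sdiff_subset), mul_assoc]
      intro D hD' h1 h2
      exact hD D (hD'.trans (Finset.union_subset_union_left hsub))
        (h1.mono (Finset.inter_subset_inter_left hsub)) h2

theorem partitionSum_map {κ : Type*} [DecidableEq κ] (e : κ ↪ ι) (C : Finset ι → R)
    (J : Finset κ) : partitionSum C (J.map e) = partitionSum (fun B => C (B.map e)) J := by
  induction J using Finset.strongInduction with
  | H J ih =>
    rcases J.eq_empty_or_nonempty with rfl | ⟨a, ha⟩
    · simp
    obtain ⟨J, haJ, rfl⟩ : ∃ J' : Finset κ, a ∉ J' ∧ insert a J' = J :=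
      ⟨J.erase a, Finset.notMem_erase _ _, Finset.insert_erase ha⟩
    rw [partitionSum_insert _ haJ, Finset.map_insert, partitionSum_insert _ (by simpa using haJ)]
    symm
    refine Finset.sum_bij (fun B _ => B.map e) ?_ ?_ ?_ ?_
    · intro B hB
      simpa using hB
    · intro B _ B' _ h
      exact Finset.map_injective e h
    · intro B hB
      rw [Finset.mem_powerset, Finset.subset_map_iff] at hB
      obtain ⟨B', h1, rfl⟩ := hB
      exact ⟨B', Finset.mem_powerset.2 h1, rfl⟩
    · intro B hB
      rw [← ih _ (Finset.sdiff_subset.trans_ssubset (Finset.ssubset_insert haJ))]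
      congr 2
      · simp
      · rw [Finset.map_eq_image, Finset.map_eq_image, Finset.map_eq_image,
          Finset.image_sdiff _ _ e.injective]

theorem sum_finpartition_notMem {M : Type*} [AddCommMonoid M] {J : Finset ι} (hJ : J.Nonempty)
    (f : Finset (Finset ι) → M) :
    ∑ I : Finpartition J, f I.parts
      = f {J} + ∑ I : {I : Finpartition J // J ∉ I.parts}, f I.1.parts := by
  rw [← Fintype.sum_subtype_add_sum_subtype (fun I : Finpartition J => J ∈ I.parts)
    fun I => f I.parts]
  congr 1
  have key : ∀ I : Finpartition J, J ∈ I.parts → I.parts = {J} := by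
    intro I h
    refine Finset.eq_singleton_iff_unique_mem.2 ⟨h, fun B hB => ?_⟩
    obtain ⟨b, hb⟩ := I.nonempty_of_mem_parts hB
    exact I.eq_of_mem_parts hB h hb (I.subset hB hb)
  rw [Fintype.sum_eq_single ⟨Finpartition.indiscrete hJ.ne_empty, by simp⟩]
  · simp
  · rintro ⟨I, hI⟩ hne
    exact absurd (Subtype.ext (Finpartition.ext (by rw [key I hI]; simp))) hne

theorem partitionSum_truncated {M : Finset ι → ℝ} (hM : M ∅ = 1) :
    partitionSum (truncated M) = M := by
  ext J
  rcases J.eq_empty_or_nonempty with rfl | hJ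
  · simp [hM]
  rw [partitionSum, sum_finpartition_notMem hJ fun P => ∏ B ∈ P, truncated M B,
    Finset.prod_singleton, truncated, sub_add_eq_add_sub, sub_eq_iff_eq_add]
  congr 1
  exact Finset.sum_congr rfl fun I _ => (Finset.prod_coe_sort I.1.parts (truncated M)).symm

/-- The relation between moments and cumulants is triangular, hence determines the cumulants on
nonempty sets. Complex weights are admitted because they will be derivatives of the logarithm of a
characteristic function. -/
theorem truncated_eq_of_partitionSum {M : Finset ι → ℝ} {C : Finset ι → ℂ}
    (hM : ∀ J, (M J : ℂ) = partitionSum C J) {J : Finset ι} (hJ : J.Nonempty) :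
    (truncated M J : ℂ) = C J := by
  induction J using Finset.strongInduction with
  | H J ih =>
    have h1 := hM J
    rw [partitionSum, sum_finpartition_notMem hJ fun P => ∏ B ∈ P, C B,
      Finset.prod_singleton] at h1
    rw [truncated]
    push_cast
    rw [h1, sub_eq_iff_eq_add]
    congr 1
    refine Finset.sum_congr rfl fun I _ => ?_
    rw [← Finset.prod_coe_sort]
    refine Finset.prod_congr rfl fun B _ => ?_
    refine (ih B.1 ?_ (I.1.nonempty_of_mem_parts B.2)).symm
    exact (I.1.subset B.2).ssubset_of_ne fun h =>
        I.2 (Eq.subst (motive := fun t => t ∈ I.1.parts) h B.2)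

/-- Summing over the blocks other than the marked one rebuilds a full moment, so the defining
recursion says that products of the `X j` are the convolution of Wick products with moments. The
separate term `M J` is the contribution of the empty Wick product. -/
theorem subsetConv_wickProduct {M : Finset ι → ℝ} (hM : M ∅ = 1) (X : ι → ℝ) :
    subsetConv (wickProduct M X) M = partitionSum (singletonValue X) := by
  ext J
  rw [partitionSum_singletonValue]
  rcases J.eq_empty_or_nonempty with rfl | hJ
  · rw [subsetConv, Finset.powerset_empty, Finset.sum_singleton, Finset.sdiff_empty, hM,
      wickProduct, if_pos rfl, Finset.prod_empty, one_mul]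
  have h0 : ∀ K, M K = ∑ I : Finpartition K, ∏ B ∈ I.parts, truncated M B := fun K =>
    (congrFun (partitionSum_truncated hM) K).symm
  have h1 : ∑ B ∈ J.powerset with B.Nonempty, wickProduct M X B * M (J \ B)
      = wickProduct M X J + ∑ I : {I : Finpartition J // J ∉ I.parts},
      ∑ B ∈ I.1.parts, wickProduct M X B *
        ∏ B' ∈ I.1.parts.erase B, truncated M B' := by
    have e := sum_finpartition_sum_parts J fun B P => wickProduct M X B * ∏ B' ∈ P, truncated M B'
    simp only [← Finset.mul_sum, ← h0] at e
    rw [← e, sum_finpartition_notMem hJ fun P => ∑ B ∈ P, wickProduct M X B *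
        ∏ B' ∈ P.erase B, truncated M B']
    simp
  rw [subsetConv, ← Finset.sum_filter_add_sum_filter_not _ fun B : Finset ι => B.Nonempty, h1]
  have h2 : J.powerset.filter (fun B : Finset ι => ¬ B.Nonempty) = {∅} := by
    ext B
    simp only [Finset.mem_filter, Finset.mem_powerset, Finset.not_nonempty_iff_eq_empty,
      Finset.mem_singleton]
    constructor
    · exact fun h => h.2
    · rintro rfl
      simp
  rw [h2, Finset.sum_singleton, Finset.sdiff_empty]
  have h3 : wickProduct M X J = ∏ j ∈ J, X j - M J - ∑ I : {I : Finpartition J // J ∉ I.parts},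
      ∑ B ∈ I.1.parts, wickProduct M X B *
        ∏ B' ∈ I.1.parts.erase B, truncated M B' := by
    conv_lhs => rw [wickProduct]
    rw [if_neg hJ.ne_empty]
    congr 1
    exact Finset.sum_congr rfl fun I _ => Finset.sum_coe_sort I.1.parts
      fun B => wickProduct M X B * ∏ B' ∈ I.1.parts.erase B, truncated M B'
  have h4 : wickProduct M X ∅ = 1 := by
    rw [wickProduct, if_pos rfl]
  rw [h4]
  linarith

/-- The equation `W * exp M^T = exp X` is solved for the Wick product `W` by convolving with `exp
(-M^T)`. -/
theorem wickProduct_eq_partitionSum {M : Finset ι → ℝ} (hM : M ∅ = 1) (X : ι → ℝ) :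
    wickProduct M X = partitionSum (singletonValue X - truncated M) := by
  have h0 : ∀ F : Finset ι → ℝ, subsetConv F (partitionSum 0) = F := by
    intro F
    ext J
    rw [subsetConv, Finset.sum_eq_single J]
    · simp
    · intro B hB hne
      rw [Finset.mem_powerset] at hB
      rw [partitionSum_zero, mul_zero]
      rw [Finset.sdiff_nonempty]
      exact fun h => hne (hB.antisymm h)
    · simp
  have h1 : partitionSum (0 : Finset ι → ℝ) = subsetConv M (partitionSum (-truncated M)) := by
    rw [← add_neg_cancel (truncated M), partitionSum_add, partitionSum_truncated hM]
  rw [← h0 (wickProduct M X), h1, ← subsetConv_assoc, subsetConv_wickProduct hM,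
    ← partitionSum_add, sub_eq_add_neg]

theorem truncated_map {κ : Type*} [DecidableEq κ] {M : Finset ι → ℝ} (hM : M ∅ = 1)
    (e : κ ↪ ι) {J : Finset κ} (hJ : J.Nonempty) :
    truncated (fun J => M (J.map e)) J = truncated M (J.map e) := by
  have h : ∀ J : Finset κ, ((M (J.map e) : ℝ) : ℂ)
      = partitionSum (fun B => ((truncated M (B.map e) : ℝ) : ℂ)) J := by
    intro J
    conv_lhs => rw [← partitionSum_truncated hM]
    rw [partitionSum_map]
    simp [partitionSum]
  exact_mod_cast truncated_eq_of_partitionSum h hJ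

end PartitionSums

/-! ### The combinatorial form of Wick's theorem -/

section WickGraphs

variable {n m : ℕ} {p : Fin m → ℕ}

/-- The embedding of the legs of the `l`-th inner full vertex into the set of all legs. -/
def innerLeg (n : ℕ) (p : Fin m → ℕ) (l : Fin m) : Fin (p l) ↪ Leg n p where
  toFun k := Sum.inr ⟨l, k⟩
  inj' k k' h := by simpa using h

open Classical in
/-- The restriction of a set function to the sets of legs of a single inner full vertex. -/
def selfContracted (C : Finset (Leg n p) → ℝ) (B : Finset (Leg n p)) : ℝ :=
  if ∃ l : Fin m, ∀ e ∈ B, ∃ k : Fin (p l), e = Sum.inr ⟨l, k⟩ then C B else 0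

theorem selfContracted_eq_zero {C : Finset (Leg n p) → ℝ} {B : Finset (Leg n p)} {i : Fin n}
    (h : Sum.inl i ∈ B) : selfContracted C B = 0 := by
  rw [selfContracted, if_neg]
  rintro ⟨l, hl⟩
  obtain ⟨k, hk⟩ := hl _ h
  simp at hk

theorem selfContracted_eq_zero_of_ne {C : Finset (Leg n p) → ℝ} {B : Finset (Leg n p)}
    {s s' : Σ l : Fin m, Fin (p l)} (h : Sum.inr s ∈ B) (h' : Sum.inr s' ∈ B) (hne : s.1 ≠ s'.1) :
    selfContracted C B = 0 := by
  rw [selfContracted, if_neg]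
  rintro ⟨l, hl⟩
  obtain ⟨k, hk⟩ := hl _ h
  obtain ⟨k', hk'⟩ := hl _ h'
  simp only [Sum.inr.injEq] at hk hk'
  exact hne (by rw [hk, hk'])

/-- The weight `Y` (field values on singletons minus self-contracted cumulants) vanishes on every
block that meets two different full vertices. So the partition sums of the individual vertices
multiply to a single one over all legs, and `partitionSum_add` then separates the field values from
the deterministic subtractions. -/
theorem prod_mul_prod_wickProduct {M : Finset (Leg n p) → ℝ} (hM : M ∅ = 1) (X : Leg n p → ℝ) :
    (∏ i, X (Sum.inl i)) * ∏ l, wickProduct (fun J => M (J.map (innerLeg n p l)))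
        (fun k => X (innerLeg n p l k)) Finset.univ
      = ∑ B : Finset (Leg n p), (∏ j ∈ B, X j) *
        partitionSum (-selfContracted (truncated M)) Bᶜ := by
  classical
  set D := selfContracted (truncated M) with hD
  set Y := singletonValue X - D with hY
  set U : Finset (Leg n p) := Finset.univ.map Function.Embedding.inl with hU
  set V : Finset (Fin m) → Finset (Leg n p) := fun s =>
    s.biUnion fun l => Finset.univ.map (innerLeg n p l) with hV
  have hYX : ∀ B : Finset (Leg n p), 1 < B.card → Y B = - D B := by
    intro B hB
    simp [hY, singletonValue, hB.ne']
  have hcard : ∀ {B : Finset (Leg n p)} {a b : Leg n p}, a ∈ B → b ∈ B → a ≠ b → 1 < B.card :=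
    fun ha hb hab => Finset.one_lt_card.2 ⟨_, ha, _, hb, hab⟩
  have houter : ∏ i, X (Sum.inl i) = partitionSum Y U := by
    have : ∏ i, X (Sum.inl i) = ∏ j ∈ U, X j := by simp [hU]
    rw [this, ← partitionSum_singletonValue]
    refine partitionSum_congr fun B hB ⟨b, hb⟩ => ?_
    obtain ⟨i, _, rfl⟩ := Finset.mem_map.1 (hB hb)
    rw [hY, Pi.sub_apply, hD, selfContracted_eq_zero hb, sub_zero]
  have hinner : ∀ l, wickProduct (fun J => M (J.map (innerLeg n p l)))
      (fun k => X (innerLeg n p l k)) Finset.univ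
      = partitionSum Y (Finset.univ.map (innerLeg n p l)) := by
    intro l
    rw [wickProduct_eq_partitionSum (by simpa using hM), partitionSum_map]
    refine partitionSum_congr fun B _ hB => ?_
    rw [Pi.sub_apply, truncated_map hM _ hB, hY, Pi.sub_apply, hD, selfContracted, if_pos]
    · simp [singletonValue]
    · refine ⟨l, fun e he => ?_⟩
      obtain ⟨k, _, rfl⟩ := Finset.mem_map.1 he
      exact ⟨k, rfl⟩
  have hprod : ∀ s : Finset (Fin m),
      partitionSum Y (V s) = ∏ l ∈ s, partitionSum Y (Finset.univ.map (innerLeg n p l)) := by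
    intro s
    induction s using Finset.induction_on with
    | empty => simp [hV]
    | insert l s hl ih =>
      have e : V (insert l s) = Finset.univ.map (innerLeg n p l) ∪ V s := by simp [hV]
      have hne : ∀ a ∈ Finset.univ.map (innerLeg n p l), ∀ b ∈ V s, ∃ t t', a = Sum.inr t ∧
          b = Sum.inr t' ∧ t.1 ≠ t'.1 := by
        intro a ha b hb
        obtain ⟨k, _, rfl⟩ := Finset.mem_map.1 ha
        obtain ⟨l', hl', hb⟩ := Finset.mem_biUnion.1 hb
        obtain ⟨k', _, rfl⟩ := Finset.mem_map.1 hb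
        exact ⟨⟨l, k⟩, ⟨l', k'⟩, rfl, rfl, fun h : l = l' => hl (h ▸ hl')⟩
      rw [e, partitionSum_union, ih, Finset.prod_insert hl]
      · refine Finset.disjoint_left.2 fun a ha hb => ?_
        obtain ⟨t, t', h1, h2, h3⟩ := hne a ha a hb
        rw [h1] at h2
        exact h3 (by rw [Sum.inr_injective h2])
      · rintro B - ⟨a, ha⟩ ⟨b, hb⟩
        rw [Finset.mem_inter] at ha hb
        obtain ⟨t, t', rfl, rfl, h3⟩ := hne a ha.2 b hb.2
        rw [hYX B (hcard ha.1 hb.1 fun h => h3 (by rw [Sum.inr_injective h])), hD,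
          selfContracted_eq_zero_of_ne ha.1 hb.1 h3, neg_zero]
  have hne : ∀ a ∈ U, ∀ b ∈ V Finset.univ, (∃ i, a = Sum.inl i) ∧ ∃ t, b = Sum.inr t := by
    intro a ha b hb
    obtain ⟨i, _, rfl⟩ := Finset.mem_map.1 ha
    obtain ⟨l', hl', hb⟩ := Finset.mem_biUnion.1 hb
    obtain ⟨k', _, rfl⟩ := Finset.mem_map.1 hb
    exact ⟨⟨i, rfl⟩, ⟨_, rfl⟩⟩
  have huniv : U ∪ V Finset.univ = Finset.univ := by
    refine Finset.eq_univ_of_forall fun e => Finset.mem_union.2 ?_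
    rcases e with i | ⟨l, k⟩
    · left; simp [hU]
    · right
      exact Finset.mem_biUnion.2 ⟨l, Finset.mem_univ _, Finset.mem_map.2 ⟨k, Finset.mem_univ _, rfl⟩⟩
  have hall : partitionSum Y Finset.univ = partitionSum Y U * partitionSum Y (V Finset.univ) := by
    rw [← huniv, partitionSum_union]
    · refine Finset.disjoint_left.2 fun a ha hb => ?_
      obtain ⟨⟨i, h1⟩, t, h2⟩ := hne a ha a hb
      rw [h1] at h2
      simp at h2
    · rintro B - ⟨a, ha⟩ ⟨b, hb⟩
      rw [Finset.mem_inter] at ha hb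
      obtain ⟨⟨i, rfl⟩, t, rfl⟩ := hne a ha.2 b hb.2
      rw [hYX B (hcard ha.1 hb.1 (by simp)), hD, selfContracted_eq_zero ha.1, neg_zero]
  rw [houter, Finset.prod_congr rfl fun l _ => hinner l, ← hprod, ← hall, hY, sub_eq_add_neg,
    partitionSum_add, subsetConv, Finset.powerset_univ]
  simp only [partitionSum_singletonValue, Finset.compl_eq_univ_sdiff]

-- In exponential form, `exp M^T * exp (-S) = exp (M^T - S)` with `S` the self-contracted part of
-- `M^T`: the new weight is zero on self-contracted blocks and unchanged on all others.
open Classical in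
theorem sum_mul_partitionSum_selfContracted {M : Finset (Leg n p) → ℝ} (hM : M ∅ = 1) :
    ∑ B : Finset (Leg n p), M B * partitionSum (-selfContracted (truncated M)) Bᶜ
      = ∑ G : FeynmanGraph n p with G.NoSelfContraction, ∏ B ∈ G.parts, truncated M B := by
  have h : ∑ B : Finset (Leg n p), M B * partitionSum (-selfContracted (truncated M)) Bᶜ
      = partitionSum (truncated M - selfContracted (truncated M)) Finset.univ := by
    rw [sub_eq_add_neg, partitionSum_add, partitionSum_truncated hM, subsetConv,
      Finset.powerset_univ]
    simp only [Finset.compl_eq_univ_sdiff]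
  rw [h, partitionSum, Finset.sum_filter]
  refine Finset.sum_congr rfl fun G _ => ?_
  split_ifs with hG
  · refine Finset.prod_congr rfl fun B hB => ?_
    rw [Pi.sub_apply, selfContracted, if_neg, sub_zero]
    rintro ⟨l, hl⟩
    exact hG B hB l hl
  · unfold FeynmanGraph.NoSelfContraction at hG
    push Not at hG
    obtain ⟨B, hB, l, hl⟩ := hG
    refine Finset.prod_eq_zero hB ?_
    rw [Pi.sub_apply, selfContracted, if_pos ⟨l, hl⟩, sub_self]

end WickGraphs

/-! ### Smooth characteristic functions have all moments -/

section CharacteristicFunctionMoments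

theorem contDiffAt_infty_deriv {E : Type*} [NormedAddCommGroup E] [NormedSpace ℝ E] {f : ℝ → E}
    {x : ℝ} (hf : ContDiffAt ℝ ∞ f x) : ContDiffAt ℝ ∞ (deriv f) x := by
  have h : ContDiffAt ℝ ∞ (fun y => fderiv ℝ f y 1) x :=
    (hf.fderiv_right (m := ∞) le_rfl).clm_apply contDiffAt_const
  exact h

theorem contDiffAt_infty_iteratedDeriv {E : Type*} [NormedAddCommGroup E] [NormedSpace ℝ E]
    {f : ℝ → E} {x : ℝ} (hf : ContDiffAt ℝ ∞ f x) (n : ℕ) :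
    ContDiffAt ℝ ∞ (iteratedDeriv n f) x := by
  induction n with
  | zero => simpa using hf
  | succ n ih =>
    rw [iteratedDeriv_succ]
    exact contDiffAt_infty_deriv ih

/-- The neighbourhood on which the `n`-th derivative is known may shrink with `n`; this is all that
smoothness at a single point requires. -/
theorem contDiffAt_infty_of_hasDerivAt {E : Type*} [NormedAddCommGroup E] [NormedSpace ℝ E]
    {k : ℕ → ℝ → E} {x : ℝ} (hk : ∀ n, ∀ᶠ s in 𝓝 x, HasDerivAt (k n) (k (n + 1) s) s) :
    ContDiffAt ℝ ∞ (k 0) x := by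
  rw [contDiffAt_infty]
  intro n
  suffices h : ∀ j, ContDiffAt ℝ n (k j) x from h 0
  induction n with
  | zero =>
    intro j
    exact contDiffAt_zero.2 ⟨_, hk j, fun s hs => (HasDerivAt.continuousAt hs).continuousWithinAt⟩
  | succ n ih =>
    intro j
    refine contDiffAt_succ_iff_hasFDerivAt.2
      ⟨fun s => ContinuousLinearMap.toSpanSingleton ℝ (k (j + 1) s), ⟨_, hk j, fun s hs => ?_⟩, ?_⟩
    · exact HasDerivAt.hasFDerivAt hs
    · have := (ContinuousLinearMap.toSpanSingletonCLE (𝕜 := ℝ) (E := E)).contDiff (n := n)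
      exact this.contDiffAt.comp x (ih (j + 1))

/-- The derivative of `f s + f (-s)` is `f' s - f' (-s)`, which is `O(s)` because `f'` is Lipschitz
near the origin. -/
theorem exists_norm_symmetric_difference_le {f : ℝ → ℂ} (hf : ContDiffAt ℝ ∞ f 0) :
    ∃ C > 0, ∃ δ > 0, ∀ t : ℝ, |t| < δ → ‖f t + f (-t) - 2 * f 0‖ ≤ C * t ^ 2 := by
  have h1 : ContDiffAt ℝ 1 (deriv f) 0 := (contDiffAt_infty_deriv hf).of_le (by exact_mod_cast le_top)
  obtain ⟨K, u, hu, hK⟩ := h1.exists_lipschitzOnWith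
  have hd : ∀ᶠ s in 𝓝 (0 : ℝ), DifferentiableAt ℝ f s := by
    have h2 : ContDiffAt ℝ 1 f 0 := hf.of_le (by exact_mod_cast le_top)
    filter_upwards [h2.eventually (by simp)] with s hs
    exact hs.differentiableAt (by simp)
  obtain ⟨δ, hδ, hball⟩ := Metric.eventually_nhds_iff.1 (hd.and hu)
  simp only [dist_zero_right, Real.norm_eq_abs] at hball
  refine ⟨2 * K + 1, by positivity, δ, hδ, fun t ht => ?_⟩
  have hder : ∀ s ∈ Set.Icc (-|t|) |t|, HasDerivWithinAt (fun s => f s + f (-s))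
      (deriv f s - deriv f (-s)) (Set.Icc (-|t|) |t|) s := by
    intro s hs
    have hs' : |s| < δ := (abs_le.2 hs).trans_lt ht
    have h2 := (hball hs').1.hasDerivAt
    have h3 : HasDerivAt f (deriv f (-s)) (-s) := (hball (by simpa using hs')).1.hasDerivAt
    have h4 := h3.scomp s (hasDerivAt_neg s)
    rw [neg_one_smul] at h4
    have h5 := (h2.add h4).hasDerivWithinAt (s := Set.Icc (-|t|) |t|)
    rw [← sub_eq_add_neg] at h5
    exact h5
  have hb : ∀ s ∈ Set.Icc (-|t|) |t|, ‖deriv f s - deriv f (-s)‖ ≤ K * (2 * |t|) := by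
    intro s hs
    have hst : |s| ≤ |t| := abs_le.2 hs
    have hs' : |s| < δ := hst.trans_lt ht
    have := hK.dist_le_mul s (hball hs').2 (-s) (hball (by simpa using hs')).2
    rw [dist_eq_norm, Real.dist_eq] at this
    refine this.trans ?_
    gcongr
    calc |s - -s| = 2 * |s| := by rw [sub_neg_eq_add, ← two_mul, abs_mul]; norm_num
      _ ≤ 2 * |t| := by gcongr
  have := (convex_Icc (-|t|) |t|).norm_image_sub_le_of_norm_hasDerivWithin_le hder hb
    (x := 0) (y := t) (by simp) ⟨neg_abs_le t, le_abs_self t⟩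
  simp only [neg_zero, sub_zero, Real.norm_eq_abs] at this
  calc ‖f t + f (-t) - 2 * f 0‖ = ‖f t + f (-t) - (f 0 + f 0)‖ := by rw [two_mul]
    _ ≤ K * (2 * |t|) * |t| := this
    _ = 2 * K * t ^ 2 := by rw [← sq_abs t]; ring
    _ ≤ (2 * K + 1) * t ^ 2 := by nlinarith [sq_nonneg t]

/-- Once the moment of order `2k` exists, the symmetric second difference of the `2k`-th derivative
has norm `∫ x^(2k) · 2 (1 - cos (t x))`. Smoothness makes this `O(t²)`, and letting `t → 0` bounds
the moment of order `2k + 2`. -/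
theorem memLp_two_mul_of_contDiffAt_charFun {μ : Measure ℝ} [IsFiniteMeasure μ]
    (hμ : ContDiffAt ℝ ∞ (charFun μ) 0) (k : ℕ) : MemLp id ((2 * k : ℕ) : ENNReal) μ := by
  induction k with
  | zero => simpa using (by fun_prop)
  | succ k ih =>
    have hint : Integrable (fun x : ℝ => x ^ (2 * k)) μ := by
      have := ih.integrable_norm_pow'
      simpa [pow_mul] using this
    obtain ⟨C, hC, δ, hδ, hb⟩ := exists_norm_symmetric_difference_le
      (contDiffAt_infty_iteratedDeriv hμ (2 * k))
    have key : ∀ t : ℝ, ‖iteratedDeriv (2 * k) (charFun μ) t + iteratedDeriv (2 * k) (charFun μ) (-t)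
        - 2 * iteratedDeriv (2 * k) (charFun μ) 0‖ = ∫ x, x ^ (2 * k) * (2 * (1 - Real.cos (t * x))) ∂μ := by
      intro t
      have hi : ∀ t : ℝ, Integrable (fun x : ℝ => (x : ℂ) ^ (2 * k) * Complex.exp (t * x * Complex.I)) μ := by
        intro t
        refine (hint.ofReal (𝕜 := ℂ)).mono (by fun_prop) (ae_of_all _ fun x => ?_)
        have : Complex.exp (t * x * Complex.I) = Complex.exp ((t * x : ℝ) * Complex.I) := by push_cast; rfl
        simp [this, Complex.norm_exp_ofReal_mul_I]
      have hadd : ∀ t : ℝ, Integrable (fun x : ℝ => (x : ℂ) ^ (2 * k) * Complex.exp (t * x * Complex.I)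
          + (x : ℂ) ^ (2 * k) * Complex.exp ((-t : ℝ) * x * Complex.I)) μ := fun t =>
        (hi t).add (hi (-t))
      rw [iteratedDeriv_charFun ih, iteratedDeriv_charFun ih, iteratedDeriv_charFun ih]
      have e : ∫ x : ℝ, ((x ^ (2 * k) * (2 * (1 - Real.cos (t * x))) : ℝ) : ℂ) ∂μ
          = -((∫ x : ℝ, (x : ℂ) ^ (2 * k) * Complex.exp (t * x * Complex.I) ∂μ)
          + (∫ x : ℝ, (x : ℂ) ^ (2 * k) * Complex.exp ((-t : ℝ) * x * Complex.I) ∂μ)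
          - 2 * ∫ x : ℝ, (x : ℂ) ^ (2 * k) * Complex.exp ((0 : ℝ) * x * Complex.I) ∂μ) := by
        rw [← integral_const_mul, ← integral_add (hi t) (hi (-t)),
          ← integral_sub (hadd t) ((hi 0).const_mul 2), ← integral_neg]
        refine integral_congr_ae (ae_of_all _ fun x => ?_)
        have h2 := Complex.two_cos (t * x)
        push_cast
        have h3 : (-(t : ℂ) * x * Complex.I) = -(t * x) * Complex.I := by ring
        rw [h3, zero_mul, zero_mul, Complex.exp_zero]
        linear_combination -(x : ℂ) ^ (2 * k) * h2
      have hn : ‖(Complex.I : ℂ) ^ (2 * k)‖ = 1 := by simp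
      rw [← mul_add, mul_left_comm, ← mul_sub, norm_mul, hn, one_mul, ← norm_neg, ← e,
        integral_complex_ofReal, Complex.norm_real, Real.norm_eq_abs, abs_of_nonneg]
      refine integral_nonneg fun x => mul_nonneg (by rw [pow_mul]; positivity) ?_
      have := Real.cos_le_one (t * x)
      dsimp only
      linarith
    have hcover : AECover μ atTop fun N : ℕ => {x : ℝ | |x| ≤ N} := by
      refine ⟨ae_of_all _ fun x => ?_, fun N => measurableSet_le (by fun_prop) (by fun_prop)⟩
      obtain ⟨N, hN⟩ := exists_nat_ge |x|
      filter_upwards [eventually_ge_atTop N] with M hM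
      exact hN.trans (by exact_mod_cast hM)
    have hres : Integrable (fun x : ℝ => x ^ (2 * (k + 1))) μ := by
      -- On `|x| ≤ N` take `t = 1 / N`, so that `|t x| ≤ π` and `1 - cos u ≥ 2 u² / π²` yields `x² ≤
      -- π²/4 · N² · 2 (1 - cos (x / N))`. The factor `N²` cancels against the bound `C / N²` for
      -- the second difference.
      refine hcover.integrable_of_integral_norm_bounded (Real.pi ^ 2 / 4 * C) ?_ ?_
      · intro N
        have h1 : Integrable (fun x : ℝ => (N : ℝ) ^ 2 * x ^ (2 * k)) μ := hint.const_mul _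
        refine h1.integrableOn.mono' (by fun_prop) ?_
        refine (ae_restrict_iff' (hcover.measurableSet N)).2 (ae_of_all _ fun x hx => ?_)
        rw [Real.norm_eq_abs, abs_of_nonneg (by rw [pow_mul]; positivity)]
        have h2 : x ^ 2 ≤ (N : ℝ) ^ 2 := by rw [← sq_abs]; gcongr; exact hx
        have h3 : 0 ≤ x ^ (2 * k) := by rw [pow_mul]; positivity
        calc x ^ (2 * (k + 1)) = x ^ 2 * x ^ (2 * k) := by ring
          _ ≤ _ := by gcongr
      · filter_upwards [eventually_gt_atTop (Nat.ceil (1 / δ)), eventually_gt_atTop 0] with N hN hN0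
        have hN0' : (0 : ℝ) < N := by exact_mod_cast hN0
        have hNδ : |1 / (N : ℝ)| < δ := by
          rw [abs_of_pos (by positivity), one_div_lt hN0' hδ]
          exact (Nat.le_ceil _).trans_lt (by exact_mod_cast hN)
        have h1 := hb _ hNδ
        rw [key] at h1
        have hi : Integrable (fun x : ℝ => x ^ (2 * k) * (2 * (1 - Real.cos (1 / N * x)))) μ := by
          refine (hint.mul_const 4).mono' (by fun_prop) (ae_of_all _ fun x => ?_)
          have h3 : 0 ≤ x ^ (2 * k) := by rw [pow_mul]; positivity
          rw [norm_mul, Real.norm_eq_abs, abs_of_nonneg h3, Real.norm_eq_abs]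
          gcongr
          rw [abs_le]
          constructor <;> nlinarith [Real.cos_le_one (1 / N * x), Real.neg_one_le_cos (1 / N * x)]
        have h2 : ∫ x in {x : ℝ | |x| ≤ N}, ‖x ^ (2 * (k + 1))‖ ∂μ
            ≤ ∫ x in {x : ℝ | |x| ≤ N}, Real.pi ^ 2 / 4 * N ^ 2 *
              (x ^ (2 * k) * (2 * (1 - Real.cos (1 / N * x)))) ∂μ := by
          refine setIntegral_mono_on₀ ?_ (hi.const_mul _).integrableOn
            (hcover.measurableSet N).nullMeasurableSet ?_
          · have h1 : Integrable (fun x : ℝ => (N : ℝ) ^ 2 * x ^ (2 * k)) μ := hint.const_mul _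
            refine h1.integrableOn.mono' (by fun_prop) ?_
            refine (ae_restrict_iff' (hcover.measurableSet N)).2 (ae_of_all _ fun x hx => ?_)
            rw [norm_norm, Real.norm_eq_abs, abs_of_nonneg (by rw [pow_mul]; positivity)]
            have h2 : x ^ 2 ≤ (N : ℝ) ^ 2 := by rw [← sq_abs]; gcongr; exact hx
            have h3 : 0 ≤ x ^ (2 * k) := by rw [pow_mul]; positivity
            calc x ^ (2 * (k + 1)) = x ^ 2 * x ^ (2 * k) := by ring
              _ ≤ _ := by gcongr
          · intro x hx
            have hx' : |1 / (N : ℝ) * x| ≤ Real.pi := by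
              rw [abs_mul, abs_of_pos (by positivity : 0 < 1 / (N : ℝ)), one_div,
                inv_mul_le_iff₀ hN0']
              have := Real.pi_gt_three
              exact hx.trans (by nlinarith)
            have h4 := Real.cos_le_one_sub_mul_cos_sq hx'
            have h3 : 0 ≤ x ^ (2 * k) := by rw [pow_mul]; positivity
            rw [Real.norm_eq_abs, abs_of_nonneg (by rw [pow_mul]; positivity)]
            have h5 : x ^ 2 ≤ Real.pi ^ 2 / 4 * N ^ 2 * (2 * (1 - Real.cos (1 / N * x))) := by
              have h6 : 2 / Real.pi ^ 2 * (1 / N * x) ^ 2 ≤ 1 - Real.cos (1 / N * x) := by linarith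
              calc x ^ 2 = Real.pi ^ 2 / 4 * N ^ 2 * (2 * (2 / Real.pi ^ 2 * (1 / N * x) ^ 2)) := by
                    have := Real.pi_pos
                    field_simp
                    ring
                _ ≤ _ := by gcongr
            calc x ^ (2 * (k + 1)) = x ^ (2 * k) * x ^ 2 := by ring
              _ ≤ x ^ (2 * k) * (Real.pi ^ 2 / 4 * N ^ 2 * (2 * (1 - Real.cos (1 / N * x)))) := by gcongr
              _ = _ := by ring
        refine h2.trans ?_
        rw [integral_const_mul]
        have h6 : ∫ x in {x : ℝ | |x| ≤ N}, x ^ (2 * k) * (2 * (1 - Real.cos (1 / N * x))) ∂μ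
            ≤ C * (1 / N) ^ 2 := by
          refine (setIntegral_le_integral hi (ae_of_all _ fun x => ?_)).trans h1
          refine mul_nonneg (by rw [pow_mul]; positivity) ?_
          have := Real.cos_le_one (1 / N * x)
          linarith
        calc _ ≤ Real.pi ^ 2 / 4 * N ^ 2 * (C * (1 / N) ^ 2) := by gcongr
          _ = _ := by field_simp
    refine (integrable_norm_rpow_iff (by fun_prop) (by simp) (ENNReal.natCast_ne_top _)).1 ?_
    refine hres.congr (ae_of_all _ fun x => ?_)
    dsimp only
    rw [ENNReal.toReal_natCast, Real.rpow_natCast, pow_mul, pow_mul, id, Real.norm_eq_abs, sq_abs]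

theorem memLp_of_contDiffAt_charFun {μ : Measure ℝ} [IsFiniteMeasure μ]
    (hμ : ContDiffAt ℝ ∞ (charFun μ) 0) (k : ℕ) : MemLp id (k : ENNReal) μ :=
  (memLp_two_mul_of_contDiffAt_charFun hμ k).mono_exponent (by exact_mod_cast (by omega))

end CharacteristicFunctionMoments

/-! ### Cumulants as mixed derivatives of the logarithm of the characteristic function -/

section JointCumulants

variable {Ω ι : Type*} [MeasurableSpace Ω] {P : Measure Ω}

theorem memLp_finset_prod [IsFiniteMeasure P] {X : ι → Ω → ℝ} {J : Finset ι}
    (hX : ∀ j ∈ J, ∀ k : ℕ, MemLp (X j) k P) (k : ℕ) : MemLp (fun w => ∏ j ∈ J, X j w) k P := by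
  have h := MemLp.prod' (s := J) (p := fun _ => ((k * J.card : ℕ) : ENNReal)) fun j hj => hX j hj _
  refine h.mono_exponent ?_
  rw [Finset.sum_const, nsmul_eq_mul, ENNReal.le_inv_iff_mul_le, ← mul_assoc, Nat.cast_mul]
  exact ENNReal.mul_inv_le_one _

theorem integrable_finset_prod_of_memLp [IsFiniteMeasure P] {X : ι → Ω → ℝ}
    (hX : ∀ j, ∀ k : ℕ, MemLp (X j) k P) (J : Finset ι) :
    Integrable (fun w => ∏ j ∈ J, X j w) P :=
  memLp_one_iff_integrable.1 (by simpa using memLp_finset_prod (fun j _ => hX j) 1)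

variable [IsProbabilityMeasure P]

variable [Fintype ι] [DecidableEq ι]

theorem sum_add_smul_single_mul (t y : ι → ℝ) (b : ι) (s : ℝ) :
    ∑ j, (t + s • Pi.single b 1 : ι → ℝ) j * y j = ∑ j, t j * y j + s * y b := by
  simp only [Pi.add_apply, Pi.smul_apply, smul_eq_mul, add_mul, Finset.sum_add_distrib]
  congr 1
  rw [Finset.sum_eq_single b]
  · simp
  · intro j _ hj
    simp [Pi.single_eq_of_ne hj]
  · simp

/-- Differentiation under the integral, dominated by the integrable product over `insert b J`. Since
`b ∉ J`, each direction is used at most once, which is why finite sets suffice to index the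
derivatives. -/
theorem hasDerivAt_integral_prod_mul_exp {X : ι → Ω → ℝ} (hm : ∀ j, Measurable (X j))
    (hX : ∀ j, ∀ k : ℕ, MemLp (X j) k P) (J : Finset ι) {b : ι} (hb : b ∉ J) (t : ι → ℝ) :
    HasDerivAt (fun s : ℝ => ∫ w, ((∏ j ∈ J, X j w : ℝ) : ℂ) *
        Complex.exp (Complex.I * (∑ j, (t + s • Pi.single b 1 : ι → ℝ) j * X j w : ℝ)) ∂P)
      (Complex.I * ∫ w, ((∏ j ∈ insert b J, X j w : ℝ) : ℂ) *
        Complex.exp (Complex.I * (∑ j, t j * X j w : ℝ)) ∂P) 0 := by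
  have hmp : ∀ J : Finset ι, Measurable fun w => ∏ j ∈ J, X j w := fun J =>
    Finset.measurable_fun_prod _ fun j _ => hm j
  have hexp : ∀ r : ℝ, ‖Complex.exp (Complex.I * r)‖ = 1 := fun r => by
    rw [mul_comm, Complex.norm_exp_ofReal_mul_I]
  have hms : ∀ s : ℝ, Measurable fun w => ∑ j, (t + s • Pi.single b 1 : ι → ℝ) j * X j w := by
    intro s
    fun_prop
  have h := hasDerivAt_integral_of_dominated_loc_of_deriv_le (μ := P) (𝕜 := ℝ) (s := Set.univ)
    (x₀ := 0)
    (F := fun (s : ℝ) w => ((∏ j ∈ J, X j w : ℝ) : ℂ) *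
        Complex.exp (Complex.I * (∑ j, (t + s • Pi.single b 1 : ι → ℝ) j * X j w : ℝ)))
    (F' := fun (s : ℝ) w => Complex.I * (((∏ j ∈ insert b J, X j w : ℝ) : ℂ) *
        Complex.exp (Complex.I * (∑ j, (t + s • Pi.single b 1 : ι → ℝ) j * X j w : ℝ))))
    (bound := fun w => ‖∏ j ∈ insert b J, X j w‖) Filter.univ_mem ?_ ?_ ?_ ?_ ?_ ?_
  · rw [← integral_const_mul]
    simpa using h.2
  · exact Eventually.of_forall fun s => (((Complex.measurable_ofReal.comp (hmp J))).mul
      (((Complex.measurable_ofReal.comp (hms s)).const_mul _).cexp)).aestronglyMeasurable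
  · refine (integrable_finset_prod_of_memLp hX J).mono (((Complex.measurable_ofReal.comp (hmp J))).mul
      (((Complex.measurable_ofReal.comp (hms 0)).const_mul _).cexp)).aestronglyMeasurable
      (ae_of_all _ fun w => ?_)
    rw [norm_mul, hexp, mul_one, Complex.norm_real]
  · exact (((Complex.measurable_ofReal.comp (hmp _)).mul
      (((Complex.measurable_ofReal.comp (hms 0)).const_mul _).cexp)).const_mul _).aestronglyMeasurable
  · refine ae_of_all _ fun w s _ => ?_
    rw [norm_mul, norm_mul, hexp, mul_one, Complex.norm_real, Complex.norm_I, one_mul]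
  · exact (integrable_finset_prod_of_memLp hX _).norm
  · refine ae_of_all _ fun w s _ => ?_
    simp only [sum_add_smul_single_mul]
    have h1 : HasDerivAt (fun s : ℝ => (((∑ j, t j * X j w + s * X b w : ℝ)) : ℂ)) (X b w : ℂ) s := by
      have : HasDerivAt (fun s : ℝ => ∑ j, t j * X j w + s * X b w) (X b w) s := by
        simpa using ((hasDerivAt_id s).mul_const (X b w)).const_add (∑ j, t j * X j w)
      exact this.ofReal_comp
    have h2 := ((h1.const_mul Complex.I).cexp).const_mul ((∏ j ∈ J, X j w : ℝ) : ℂ)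
    refine h2.congr_deriv ?_
    rw [Finset.prod_insert hb]
    push_cast
    ring

/-- Moments are sums over partitions of products of cumulants, where the cumulants are the
partial derivatives at `0` of the logarithm of the characteristic function. -/
theorem integral_prod_eq_partitionSum {X : ι → Ω → ℝ} (hm : ∀ j, Measurable (X j))
    (hX : ∀ j, ∀ k : ℕ, MemLp (X j) k P) (K : Finset ι → (ι → ℝ) → ℂ)
    (hK0 : ∀ᶠ t in 𝓝 (0 : ι → ℝ), ∫ w, Complex.exp (Complex.I * (∑ j, t j * X j w : ℝ)) ∂P
      = Complex.exp (K ∅ t))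
    (hK : ∀ B : Finset ι, ∀ b ∉ B, ∀ᶠ t in 𝓝 (0 : ι → ℝ),
      HasDerivAt (fun s : ℝ => K B (t + s • Pi.single b 1)) (K (insert b B) t) 0)
    (J : Finset ι) :
    ((∫ w, ∏ j ∈ J, X j w ∂P : ℝ) : ℂ)
      = partitionSum (fun B => (-Complex.I) ^ B.card * K B 0) J := by
  -- `F J` is the mixed derivative of the characteristic function in the directions of `J`.
  set F : Finset ι → (ι → ℝ) → ℂ := fun J t => Complex.I ^ J.card *
    ∫ w, ((∏ j ∈ J, X j w : ℝ) : ℂ) * Complex.exp (Complex.I * (∑ j, t j * X j w : ℝ)) ∂P with hF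
  have hFd : ∀ J : Finset ι, ∀ b ∉ J, ∀ t, HasDerivAt (fun s : ℝ => F J (t + s • Pi.single b 1))
      (F (insert b J) t) 0 := by
    intro J b hb t
    refine ((hasDerivAt_integral_prod_mul_exp hm hX J hb t).const_mul
      (Complex.I ^ J.card)).congr_deriv ?_
    simp only [hF]
    rw [Finset.card_insert_of_notMem hb, pow_succ, mul_assoc]
  have hnear : ∀ {p : (ι → ℝ) → Prop}, (∀ᶠ t in 𝓝 0, p t) → ∀ b : ι, ∀ᶠ t in 𝓝 (0 : ι → ℝ),
      ∀ᶠ s in 𝓝 (0 : ℝ), p (t + s • Pi.single b 1) := by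
    intro p hp b
    filter_upwards [hp.eventually_nhds] with t ht
    have hc : Tendsto (fun s : ℝ => t + s • (Pi.single b 1 : ι → ℝ)) (𝓝 0) (𝓝 t) := by
      have : Continuous fun s : ℝ => t + s • (Pi.single b 1 : ι → ℝ) := by fun_prop
      simpa using this.tendsto 0
    exact hc.eventually ht
  -- One derivative of `exp (K ∅)` in the direction `a` gives `K {a} · F ∅`; the remaining
  -- directions are distributed by the Leibniz rule. The identity is kept on a whole neighbourhood
  -- of `0`, since it is differentiated again at each step. At `t = 0` it is the recursion
  -- `partitionSum_insert`.
  have hrec : ∀ J : Finset ι, ∀ a ∉ J, ∀ᶠ t in 𝓝 (0 : ι → ℝ),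
      F (insert a J) t = ∑ B ∈ J.powerset, K (insert a B) t * F (J \ B) t := by
    intro J
    induction J using Finset.induction_on with
    | empty =>
      intro a ha
      filter_upwards [hK0, hnear hK0 a, hK ∅ a ha] with t ht0 ht hd
      have h1 := hFd ∅ a ha t
      have h2 := hd.cexp
      have h3 := h2.congr_of_eventuallyEq (f₁ := fun s : ℝ => F ∅ (t + s • Pi.single a 1)) (by
        filter_upwards [ht] with s hs
        simp only [hF, Finset.card_empty, pow_zero, Finset.prod_empty, Complex.ofReal_one, one_mul]
        exact hs)
      rw [h1.unique h3]
      simp only [zero_smul, add_zero, Finset.powerset_empty, Finset.sum_singleton,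
        Finset.sdiff_empty, hF, Finset.card_empty, pow_zero, Finset.prod_empty, Complex.ofReal_one,
        one_mul]
      rw [ht0]
      ring
    | insert b J hb ih =>
      intro a ha
      have haJ : a ∉ J := fun h => ha (Finset.mem_insert_of_mem h)
      have hab : a ≠ b := fun h => ha (h ▸ Finset.mem_insert_self _ _)
      have hKall : ∀ᶠ t in 𝓝 (0 : ι → ℝ), ∀ B ∈ J.powerset,
          HasDerivAt (fun s : ℝ => K (insert a B) (t + s • Pi.single b 1))
            (K (insert b (insert a B)) t) 0 := by
        rw [Filter.eventually_all_finset]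
        intro B hB
        refine hK _ b ?_
        rw [Finset.mem_insert, not_or]
        exact ⟨hab.symm, fun h => hb (Finset.mem_powerset.1 hB h)⟩
      filter_upwards [hnear (ih a haJ) b, hKall] with t ht hd
      have h1 := hFd (insert a J) b (by simp [hab.symm, hb]) t
      have h2 : HasDerivAt (fun s : ℝ => ∑ B ∈ J.powerset,
          K (insert a B) (t + s • Pi.single b 1) * F (J \ B) (t + s • Pi.single b 1))
          (∑ B ∈ J.powerset, (K (insert b (insert a B)) t * F (J \ B) t
            + K (insert a B) t * F (insert b (J \ B)) t)) 0 := by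
        refine HasDerivAt.fun_sum fun B hB => ?_
        have h := (hd B hB).mul (hFd (J \ B) b (fun h => hb (Finset.sdiff_subset h)) t)
        simp only [zero_smul, add_zero] at h
        exact h
      have h3 := h2.congr_of_eventuallyEq (f₁ := fun s : ℝ => F (insert a J) (t + s • Pi.single b 1)) ht
      rw [Finset.insert_comm, h1.unique h3, Finset.sum_powerset_insert hb, Finset.sum_add_distrib,
        add_comm]
      congr 1
      · refine Finset.sum_congr rfl fun B hB => ?_
        rw [Finset.insert_sdiff_of_notMem _ fun h => hb (Finset.mem_powerset.1 hB h)]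
      · refine Finset.sum_congr rfl fun B hB => ?_
        rw [Finset.insert_sdiff_insert, Finset.sdiff_insert_of_notMem hb, Finset.insert_comm]
  have hI : ∀ k : ℕ, (-Complex.I) ^ k * Complex.I ^ k = 1 := fun k => by
    rw [← mul_pow, neg_mul, Complex.I_mul_I, neg_neg, one_pow]
  have hM : ∀ J : Finset ι, ((∫ w, ∏ j ∈ J, X j w ∂P : ℝ) : ℂ) = (-Complex.I) ^ J.card * F J 0 := by
    intro J
    simp only [hF]
    rw [← mul_assoc, hI, one_mul, ← integral_complex_ofReal]
    simp
  induction J using Finset.strongInduction with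
  | H J ih =>
    rcases J.eq_empty_or_nonempty with rfl | ⟨a, ha⟩
    · simp
    obtain ⟨J, haJ, rfl⟩ : ∃ J' : Finset ι, a ∉ J' ∧ insert a J' = J :=
      ⟨J.erase a, Finset.notMem_erase _ _, Finset.insert_erase ha⟩
    rw [hM, (hrec J a haJ).self_of_nhds, partitionSum_insert _ haJ, Finset.mul_sum]
    refine Finset.sum_congr rfl fun B hB => ?_
    rw [Finset.mem_powerset] at hB
    rw [← ih _ (Finset.sdiff_subset.trans_ssubset (Finset.ssubset_insert haJ)), hM,
      Finset.card_insert_of_notMem haJ, Finset.card_insert_of_notMem fun h => haJ (hB h),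
      ← Finset.card_sdiff_add_card_eq_card hB]
    ring

end JointCumulants

/-! ### Differentiating the Lévy functional `∫ ψ(h(x)) dx` -/

section LevyFunctional

variable {ψ : ℝ → ℂ}

/-- As `ψ` is only assumed smooth at `0`, the radius on which the derivatives exist and are bounded
depends on the order `k`. -/
theorem exists_hasDerivAt_iteratedDeriv (hψ : ContDiffAt ℝ ∞ ψ 0) (k : ℕ) :
    ∃ r > 0, ∃ C > 0, ∀ s : ℝ, |s| < r →
      HasDerivAt (iteratedDeriv k ψ) (iteratedDeriv (k + 1) ψ s) s ∧
      ‖iteratedDeriv (k + 1) ψ s‖ ≤ C ∧ ‖iteratedDeriv k ψ s‖ ≤ C := by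
  have hk := contDiffAt_infty_iteratedDeriv hψ k
  have hk1 := contDiffAt_infty_iteratedDeriv hψ (k + 1)
  have h1 : ∀ᶠ s in 𝓝 (0 : ℝ), DifferentiableAt ℝ (iteratedDeriv k ψ) s := by
    have h2 : ContDiffAt ℝ 1 (iteratedDeriv k ψ) 0 := hk.of_le (by exact_mod_cast le_top)
    filter_upwards [h2.eventually (by simp)] with s hs
    exact hs.differentiableAt (by simp)
  have h2 := hk.continuousAt.norm.eventually_le_const (lt_add_one _)
  have h3 := hk1.continuousAt.norm.eventually_le_const (lt_add_one _)
  obtain ⟨r, hr, h⟩ := Metric.eventually_nhds_iff.1 ((h1.and h2).and h3)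
  simp only [dist_zero_right, Real.norm_eq_abs] at h
  refine ⟨r, hr, max (‖iteratedDeriv k ψ 0‖ + 1) (‖iteratedDeriv (k + 1) ψ 0‖ + 1),
    lt_max_of_lt_left (by positivity), fun s hs => ⟨?_, ?_, ?_⟩⟩
  · rw [iteratedDeriv_succ]
    exact (h hs).1.1.hasDerivAt
  · exact (h hs).2.trans (le_max_right _ _)
  · exact (h hs).1.2.trans (le_max_left _ _)

theorem measurable_iteratedDeriv_of_continuous (hψ : Continuous ψ) (k : ℕ) :
    Measurable (iteratedDeriv k ψ) := by
  cases k with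
  | zero => simpa using hψ.measurable
  | succ k =>
    rw [iteratedDeriv_succ]
    exact measurable_deriv _

theorem exists_integrable_iteratedDeriv_mul (hc : Continuous ψ) (hψ : ContDiffAt ℝ ∞ ψ 0) (k : ℕ) :
    ∃ r > 0, ∀ v w : Plane → ℝ, Measurable v → Integrable w → (∀ x, |v x| ≤ r) →
      Integrable fun x => iteratedDeriv k ψ (v x) * (w x : ℂ) := by
  obtain ⟨r, hr, C, hC, h⟩ := exists_hasDerivAt_iteratedDeriv hψ k
  refine ⟨r / 2, by positivity, fun v w hv hw hvr => ?_⟩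
  refine hw.ofReal.bdd_mul (c := C) ?_ (ae_of_all _ fun x => ?_)
  · exact ((measurable_iteratedDeriv_of_continuous hc k).comp hv).aestronglyMeasurable
  · exact (h _ ((hvr x).trans_lt (by linarith))).2.2

/-- `ψ 0 = 0` and a bounded derivative give `|ψ s| ≤ C |s|` near `0`. This covers order zero, where
no integrable factor accompanies `ψ`. -/
theorem exists_integrable_comp (hc : Continuous ψ) (hψ : ContDiffAt ℝ ∞ ψ 0) (h0 : ψ 0 = 0) :
    ∃ r > 0, ∀ v : Plane → ℝ, Measurable v → Integrable v → (∀ x, |v x| ≤ r) →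
      Integrable fun x => ψ (v x) := by
  obtain ⟨r, hr, C, hC, h⟩ := exists_hasDerivAt_iteratedDeriv hψ 0
  refine ⟨r / 2, by positivity, fun v hv hi hvr => ?_⟩
  refine (hi.norm.const_mul C).mono' ((hc.measurable.comp hv).aestronglyMeasurable)
    (ae_of_all _ fun x => ?_)
  have hx : |v x| < r := (hvr x).trans_lt (by linarith)
  have h1 := (convex_Icc (-|v x|) |v x|).norm_image_sub_le_of_norm_hasDerivWithin_le
    (f := ψ) (f' := iteratedDeriv 1 ψ) (C := C) (x := 0) (y := v x)
    (fun s hs => by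
      have := ((h s ((abs_le.2 hs).trans_lt hx)).1).hasDerivWithinAt (s := Set.Icc (-|v x|) |v x|)
      rwa [iteratedDeriv_zero] at this)
    (fun s hs => (h s ((abs_le.2 hs).trans_lt hx)).2.1)
    ⟨neg_nonpos.2 (abs_nonneg _), abs_nonneg _⟩ ⟨neg_abs_le _, le_abs_self _⟩
  simpa [h0] using h1

/-- The derivative carries the integrable factor `u`, which together with the bounds for `w` and for
the next derivative of `ψ` gives the dominating function. -/
theorem exists_hasDerivAt_integral_iteratedDeriv (hc : Continuous ψ) (hψ : ContDiffAt ℝ ∞ ψ 0)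
    (k : ℕ) : ∃ r > 0, ∀ v u w : Plane → ℝ, Measurable v → Measurable u → Integrable u →
      (∃ C, ∀ x, |u x| ≤ C) → Measurable w → (∃ C, ∀ x, |w x| ≤ C) → (∀ x, |v x| ≤ r) →
      Integrable (fun x => iteratedDeriv k ψ (v x) * (w x : ℂ)) →
      HasDerivAt (fun s : ℝ => ∫ x, iteratedDeriv k ψ (v x + s * u x) * (w x : ℂ))
        (∫ x, iteratedDeriv (k + 1) ψ (v x) * ((u x * w x : ℝ) : ℂ)) 0 := by
  obtain ⟨r, hr, C, hC, h⟩ := exists_hasDerivAt_iteratedDeriv hψ k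
  refine ⟨r / 2, by positivity, ?_⟩
  rintro v u w hv hu hui ⟨Cu, hCu⟩ hw ⟨Cw, hCw⟩ hvr hint
  have hCu0 : 0 ≤ Cu := (abs_nonneg _).trans (hCu 0)
  have hCw0 : 0 ≤ Cw := (abs_nonneg _).trans (hCw 0)
  -- Half of the radius `r` is reserved for `v`; the size of the ball keeps `s * u x` within the
  -- other half.
  have hsmall : ∀ x, ∀ s ∈ Metric.ball (0 : ℝ) (r / (2 * (Cu + 1))), |v x + s * u x| < r := by
    intro x s hs
    rw [mem_ball_zero_iff, Real.norm_eq_abs, lt_div_iff₀ (by positivity)] at hs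
    have h1 : |s * u x| ≤ |s| * Cu := by rw [abs_mul]; gcongr; exact hCu x
    have h2 := abs_add_le (v x) (s * u x)
    have h3 := hvr x
    nlinarith [abs_nonneg s]
  have hmeas : ∀ (j : ℕ) (s : ℝ), Measurable fun x => iteratedDeriv j ψ (v x + s * u x) := fun j s =>
    (measurable_iteratedDeriv_of_continuous hc j).comp (by fun_prop)
  have key := hasDerivAt_integral_of_dominated_loc_of_deriv_le (μ := (volume : Measure Plane))
    (𝕜 := ℝ) (s := Metric.ball (0 : ℝ) (r / (2 * (Cu + 1)))) (x₀ := 0)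
    (F := fun s x => iteratedDeriv k ψ (v x + s * u x) * (w x : ℂ))
    (F' := fun s x => iteratedDeriv (k + 1) ψ (v x + s * u x) * ((u x * w x : ℝ) : ℂ))
    (bound := fun x => C * (|u x| * Cw)) (Metric.ball_mem_nhds _ (by positivity)) ?_ ?_ ?_ ?_ ?_ ?_
  · simpa using key.2
  · exact Eventually.of_forall fun s => ((hmeas k s).mul
      (Complex.measurable_ofReal.comp hw)).aestronglyMeasurable
  · simpa using hint
  · exact ((hmeas (k + 1) 0).mul
      (Complex.measurable_ofReal.comp (hu.mul hw))).aestronglyMeasurable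
  · refine ae_of_all _ fun x s hs => ?_
    rw [norm_mul, Complex.norm_real, norm_mul, Real.norm_eq_abs, Real.norm_eq_abs]
    gcongr
    · exact (h _ (hsmall x s hs)).2.1
    · exact hCw x
  · exact (hui.abs.mul_const Cw).const_mul C
  · refine ae_of_all _ fun x s hs => ?_
    have h1 := (h _ (hsmall x s hs)).1
    have h2 : HasDerivAt (fun s : ℝ => v x + s * u x) (u x) s := by
      simpa using ((hasDerivAt_id s).mul_const (u x)).const_add (v x)
    have h3 := (h1.scomp s h2).mul_const (w x : ℂ)
    refine h3.congr_deriv ?_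
    rw [Complex.real_smul]
    push_cast
    ring

theorem exists_abs_schwartz_le (f : 𝓢(Plane, ℝ)) : ∃ C, 0 ≤ C ∧ ∀ x, |f x| ≤ C :=
  ⟨SchwartzMap.seminorm ℝ 0 0 f, apply_nonneg _ _, fun x => SchwartzMap.norm_le_seminorm ℝ f x⟩

theorem measurable_schwartz (f : 𝓢(Plane, ℝ)) : Measurable f := f.continuous.measurable

theorem exists_abs_prod_schwartz_le {ι : Type*} (u : ι → 𝓢(Plane, ℝ)) (B : Finset ι) :
    ∃ C, ∀ x, |∏ j ∈ B, u j x| ≤ C := by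
  choose C hC0 hC using fun j => exists_abs_schwartz_le (u j)
  refine ⟨∏ j ∈ B, C j, fun x => ?_⟩
  rw [Finset.abs_prod]
  exact Finset.prod_le_prod (fun _ _ => abs_nonneg _) fun j _ => hC j x

theorem integrable_prod_schwartz {ι : Type*} [DecidableEq ι] (u : ι → 𝓢(Plane, ℝ)) {B : Finset ι}
    (hB : B.Nonempty) : Integrable fun x => ∏ j ∈ B, u j x := by
  obtain ⟨a, ha⟩ := hB
  obtain ⟨C, hC⟩ := exists_abs_prod_schwartz_le u (B.erase a)
  have h := (u a).integrable (μ := volume).bdd_mul (c := C)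
    (f := fun x => ∏ j ∈ B.erase a, u j x)
    (Finset.measurable_fun_prod _ fun j _ => measurable_schwartz (u j)).aestronglyMeasurable
    (ae_of_all _ hC)
  refine h.congr (ae_of_all _ fun x => ?_)
  exact Finset.prod_erase_mul _ (fun j => u j x) ha

/-- Integration by parts in an orthonormal frame. In this form the gradient energy can be combined
with the mass term by means of the equation for `u`. -/
theorem integral_norm_gradient_sq (u : 𝓢(Plane, ℝ)) :
    ∫ x, ‖gradient (fun y => u y) x‖ ^ 2 = ∫ x, u x * (-(Δ u)) x := by
  open scoped LineDeriv in
  set b := stdOrthonormalBasis ℝ Plane with hb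
  have h1 : ∀ x, ‖gradient (fun y => u y) x‖ ^ 2 = ∑ i, (∂_{b i} u) x * (∂_{b i} u) x := by
    intro x
    rw [← b.sum_sq_norm_inner_right]
    refine Finset.sum_congr rfl fun i _ => ?_
    rw [SchwartzMap.lineDerivOp_apply_eq_fderiv, real_inner_comm, gradient,
      InnerProductSpace.toDual_symm_apply, Real.norm_eq_abs, sq_abs, sq]
  have h2 : ∀ i, Integrable fun x => (∂_{b i} u) x * (∂_{b i} u) x := fun i => by
    have := integrable_prod_schwartz ![∂_{b i} u, ∂_{b i} u] (B := Finset.univ) ⟨0, by simp⟩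
    simpa [Fin.prod_univ_two] using this
  have h3 : ∀ i, Integrable fun x => u x * (∂_{b i} (∂_{b i} u)) x := fun i => by
    have := integrable_prod_schwartz ![u, ∂_{b i} (∂_{b i} u)] (B := Finset.univ) ⟨0, by simp⟩
    simpa [Fin.prod_univ_two] using this
  simp only [h1]
  rw [integral_finsetSum _ fun i _ => h2 i]
  have h4 : ∀ x, u x * (-(Δ u)) x = -∑ i, u x * (∂_{b i} (∂_{b i} u)) x := by
    intro x
    rw [SchwartzMap.laplacian_eq_sum b, neg_apply, sum_apply, mul_neg,
      Finset.mul_sum]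
  simp only [h4]
  rw [integral_neg, integral_finsetSum _ fun i _ => h3 i, ← Finset.sum_neg_distrib]
  refine Finset.sum_congr rfl fun i _ => ?_
  rw [SchwartzMap.integral_mul_lineDerivOp_right_eq_neg_left]
  simp only [mul_comm]

end LevyFunctional

/-! ### Moments and truncated moments of the massive field -/

section MassiveField

variable {Ω : Type*} [MeasurableSpace Ω] {P : Measure Ω}

theorem continuous_eval_distribution (h : 𝓢(Plane, ℝ)) :
    Continuous fun T : RealDistribution => T h :=
  (PointwiseConvergenceCLM.evalCLM (RingHom.id ℝ) ℝ h).continuous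

theorem measurable_eval_distribution (h : 𝓢(Plane, ℝ)) :
    Measurable fun T : RealDistribution => T h := by
  have : BorelSpace RealDistribution := ⟨rfl⟩
  exact (continuous_eval_distribution h).measurable

/-- Almost surely `φ f = η u + ηg u`, because the equation may be tested with the Schwartz solution
`u`. Independence factorizes the expectation. -/
theorem integral_exp_massive_field {ψ : ℝ → ℂ} {m₀ κ : ℝ}
    {η ηg φ : Ω → RealDistribution} (hη_meas : Measurable η) (hηg_meas : Measurable ηg)
    (hη : IsLevyNoise P ψ η) (hηg : IsGradientGaussianNoise P κ ηg) (hindep : IndepFun η ηg P)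
    (hφ : ∀ᵐ w ∂P, SolvesMassiveEquation m₀ (φ w) (η w + ηg w)) {f u : 𝓢(Plane, ℝ)}
    (hu : -(Δ u) + m₀ ^ 2 • u = f) :
    ∫ w, Complex.exp (Complex.I * (φ w f : ℂ)) ∂P
      = Complex.exp ((∫ x, ψ (u x)) - κ * ((∫ x, u x * (-(Δ u)) x : ℝ) : ℂ)) := by
  have h1 : ∫ w, Complex.exp (Complex.I * (φ w f : ℂ)) ∂P
      = ∫ w, Complex.exp (Complex.I * (η w u : ℂ)) * Complex.exp (Complex.I * (ηg w u : ℂ)) ∂P := by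
    refine integral_congr_ae ?_
    filter_upwards [hφ] with w hw
    rw [← hu, hw u, ← Complex.exp_add, ← mul_add, ← Complex.ofReal_add]
    rfl
  have hm : Measurable fun T : RealDistribution => Complex.exp (Complex.I * (T u : ℂ)) :=
    ((Complex.measurable_ofReal.comp (measurable_eval_distribution u)).const_mul _).cexp
  rw [h1, hindep.integral_fun_comp_mul_comp
    (f := fun T : RealDistribution => Complex.exp (Complex.I * (T u : ℂ)))
    (g := fun T : RealDistribution => Complex.exp (Complex.I * (T u : ℂ))) hη_meas.aemeasurable
    hηg_meas.aemeasurable hm.aestronglyMeasurable hm.aestronglyMeasurable, hη u, hηg u,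
    ← Complex.exp_add, integral_norm_gradient_sq]
  congr 1
  push_cast
  ring

section Cumulants

variable {ι : Type*} [Fintype ι]

/-- The partial derivatives of the quadratic form `-κ ∑ t_i t_j Γ_ij` with respect to the
coordinates in `B`. -/
def quadraticPartial [DecidableEq ι] (κ : ℝ) (Γ : ι → ι → ℝ) (B : Finset ι) (t : ι → ℝ) : ℝ :=
  if B.card = 0 then -κ * ∑ i, ∑ j, t i * t j * Γ i j
  else if B.card = 1 then -2 * κ * ∑ a ∈ B, ∑ j, t j * Γ a j
  else if B.card = 2 then -κ * ∑ a ∈ B, ∑ b ∈ B.erase a, Γ a b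
  else 0

theorem hasDerivAt_quadraticPartial [DecidableEq ι] {κ : ℝ} {Γ : ι → ι → ℝ} (hΓ : ∀ i j, Γ i j = Γ j i)
    (B : Finset ι) {b : ι} (hb : b ∉ B) (t : ι → ℝ) :
    HasDerivAt (fun s : ℝ => quadraticPartial κ Γ B (t + s • Pi.single b 1))
      (quadraticPartial κ Γ (insert b B) t) 0 := by
  have hcard := Finset.card_insert_of_notMem hb
  have hi : ∀ i, HasDerivAt (fun s : ℝ => (t + s • Pi.single b 1 : ι → ℝ) i)
      ((Pi.single b 1 : ι → ℝ) i) 0 := by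
    intro i
    simpa using ((hasDerivAt_id (0 : ℝ)).mul_const ((Pi.single b 1 : ι → ℝ) i)).const_add (t i)
  have hsingle : ∀ y : ι → ℝ, ∑ j, (Pi.single b 1 : ι → ℝ) j * y j = y b := by
    intro y
    simp [Pi.single_apply]
  unfold quadraticPartial
  rw [hcard]
  rcases h : B.card with _ | _ | _ | k
  · obtain rfl := Finset.card_eq_zero.1 h
    simp only [if_true, zero_add, if_neg one_ne_zero]
    refine ((HasDerivAt.fun_sum fun i _ => HasDerivAt.fun_sum fun j _ =>
      ((hi i).mul (hi j)).mul_const (Γ i j)).const_mul (-κ)).congr_deriv ?_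
    simp only [zero_smul, add_zero, insert_empty_eq, Finset.sum_singleton, add_mul,
      Finset.sum_add_distrib]
    have e1 : ∑ i, ∑ j, (Pi.single b 1 : ι → ℝ) i * t j * Γ i j = ∑ j, t j * Γ b j := by
      rw [← hsingle fun i => ∑ j, t j * Γ i j]
      simp only [Finset.mul_sum, mul_assoc]
    have e2 : ∑ i, ∑ j, t i * (Pi.single b 1 : ι → ℝ) j * Γ i j = ∑ j, t j * Γ b j := by
      rw [Finset.sum_comm, ← hsingle fun i => ∑ j, t j * Γ i j]
      simp only [Finset.mul_sum]
      refine Finset.sum_congr rfl fun i _ => Finset.sum_congr rfl fun j _ => ?_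
      rw [hΓ j i]
      ring
    rw [e1, e2]
    ring
  · obtain ⟨a, rfl⟩ := Finset.card_eq_one.1 h
    have hab : b ≠ a := fun e => hb (by simp [e])
    simp only [zero_add, one_ne_zero, if_false, if_true, Nat.reduceAdd, OfNat.ofNat_ne_zero,
      OfNat.ofNat_ne_one, Finset.sum_singleton]
    refine ((HasDerivAt.fun_sum fun j _ => (hi j).mul_const (Γ a j)).const_mul
      (-2 * κ)).congr_deriv ?_
    rw [hsingle, Finset.sum_pair hab]
    have e1 : ({b, a} : Finset ι).erase b = {a} := by
      rw [Finset.erase_insert]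
      simpa using hab
    have e2 : ({b, a} : Finset ι).erase a = {b} := by
      rw [Finset.pair_comm, Finset.erase_insert]
      simpa using hab.symm
    rw [e1, e2, Finset.sum_singleton, Finset.sum_singleton, hΓ b a]
    ring
  · simp only [zero_add, Nat.reduceAdd, OfNat.ofNat_ne_zero, OfNat.ofNat_ne_one, if_false, if_true]
    exact hasDerivAt_const _ _
  · simp only [Nat.add_eq_zero_iff, and_false, if_false,
      show k + 1 + 1 + 1 ≠ 1 by omega, show k + 1 + 1 + 1 ≠ 2 by omega,
      show k + 1 + 1 + 1 + 1 ≠ 1 by omega, show k + 1 + 1 + 1 + 1 ≠ 2 by omega, one_ne_zero]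
    exact hasDerivAt_const _ _

theorem eventually_abs_sum_schwartz_le (u : ι → 𝓢(Plane, ℝ)) {r : ℝ} (hr : 0 < r) :
    ∀ᶠ t in 𝓝 (0 : ι → ℝ), ∀ x, |∑ j, t j * u j x| ≤ r := by
  choose C hC0 hC using fun j => exists_abs_schwartz_le (u j)
  have hc : Tendsto (fun t : ι → ℝ => ∑ j, |t j| * C j) (𝓝 0) (𝓝 0) := by
    have : Continuous fun t : ι → ℝ => ∑ j, |t j| * C j := by fun_prop
    simpa using this.tendsto 0
  filter_upwards [hc.eventually_le_const hr] with t ht x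
  refine (Finset.abs_sum_le_sum_abs _ _).trans (le_trans ?_ ht)
  refine Finset.sum_le_sum fun j _ => ?_
  rw [abs_mul]
  gcongr
  exact hC j x

theorem eventually_hasDerivAt_levy [DecidableEq ι] {ψ : ℝ → ℂ} (hψ : IsLevyCharacteristic ψ)
    (hs : ContDiffAt ℝ ∞ ψ 0) (u : ι → 𝓢(Plane, ℝ)) (B : Finset ι) {b : ι} (hb : b ∉ B) :
    ∀ᶠ t in 𝓝 (0 : ι → ℝ), HasDerivAt (fun s : ℝ => ∫ x, iteratedDeriv B.card ψ
        (∑ j, (t + s • Pi.single b 1 : ι → ℝ) j * u j x) * ((∏ j ∈ B, u j x : ℝ) : ℂ))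
      (∫ x, iteratedDeriv (insert b B).card ψ (∑ j, t j * u j x)
        * ((∏ j ∈ insert b B, u j x : ℝ) : ℂ)) 0 := by
  obtain ⟨r₁, hr₁, h₁⟩ := exists_integrable_iteratedDeriv_mul hψ.continuous hs B.card
  obtain ⟨r₂, hr₂, h₂⟩ := exists_integrable_comp hψ.continuous hs hψ.map_zero
  obtain ⟨r₃, hr₃, h₃⟩ := exists_hasDerivAt_integral_iteratedDeriv hψ.continuous hs B.card
  filter_upwards [eventually_abs_sum_schwartz_le u hr₁, eventually_abs_sum_schwartz_le u hr₂,
    eventually_abs_sum_schwartz_le u hr₃] with t ht₁ ht₂ ht₃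
  have hv : Measurable fun x => ∑ j, t j * u j x :=
    Finset.measurable_fun_sum _ fun j _ => (measurable_schwartz (u j)).const_mul _
  have hvi : Integrable fun x => ∑ j, t j * u j x :=
    integrable_finsetSum _ fun j _ => (u j).integrable.const_mul _
  have hw : Measurable fun x => ∏ j ∈ B, u j x :=
    Finset.measurable_fun_prod _ fun j _ => measurable_schwartz (u j)
  obtain ⟨C, _, hC⟩ := exists_abs_schwartz_le (u b)
  have key := h₃ (fun x => ∑ j, t j * u j x) (u b) (fun x => ∏ j ∈ B, u j x) hv
    (measurable_schwartz _) (u b).integrable ⟨C, hC⟩ hw (exists_abs_prod_schwartz_le u B) ht₃ ?_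
  · rw [Finset.card_insert_of_notMem hb]
    simp only [Finset.prod_insert hb]
    simpa only [sum_add_smul_single_mul] using key
  · rcases B.eq_empty_or_nonempty with rfl | hB
    · simpa using h₂ _ hv hvi ht₂
    · exact h₁ _ _ hv (integrable_prod_schwartz u hB) ht₁

/-- Repeated differentiation along a single ray, at all small `s` and not only at `0`. It yields
smoothness of the characteristic function of one variable `φ f`, and with it the moments that the
joint cumulant formula presupposes. -/
theorem eventually_hasDerivAt_levy_smul {ψ : ℝ → ℂ} (hψ : IsLevyCharacteristic ψ)
    (hs : ContDiffAt ℝ ∞ ψ 0) (u : 𝓢(Plane, ℝ)) (n : ℕ) :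
    ∀ᶠ s in 𝓝 (0 : ℝ), HasDerivAt
      (fun s : ℝ => ∫ x, iteratedDeriv n ψ (s * u x) * ((u x ^ n : ℝ) : ℂ))
      (∫ x, iteratedDeriv (n + 1) ψ (s * u x) * ((u x ^ (n + 1) : ℝ) : ℂ)) s := by
  obtain ⟨r₁, hr₁, h₁⟩ := exists_integrable_iteratedDeriv_mul hψ.continuous hs n
  obtain ⟨r₂, hr₂, h₂⟩ := exists_integrable_comp hψ.continuous hs hψ.map_zero
  obtain ⟨r₃, hr₃, h₃⟩ := exists_hasDerivAt_integral_iteratedDeriv hψ.continuous hs n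
  obtain ⟨C, hC0, hC⟩ := exists_abs_schwartz_le u
  have hsmall : ∀ r > 0, ∀ᶠ s in 𝓝 (0 : ℝ), ∀ x, |s * u x| ≤ r := by
    intro r hr
    have hc : Tendsto (fun s : ℝ => |s| * C) (𝓝 0) (𝓝 0) := by
      have : Continuous fun s : ℝ => |s| * C := by fun_prop
      simpa using this.tendsto 0
    filter_upwards [hc.eventually_le_const hr] with s hs x
    rw [abs_mul]
    exact (mul_le_mul_of_nonneg_left (hC x) (abs_nonneg s)).trans hs
  filter_upwards [hsmall r₁ hr₁, hsmall r₂ hr₂, hsmall r₃ hr₃] with s hs₁ hs₂ hs₃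
  have hv : Measurable fun x => s * u x := (measurable_schwartz u).const_mul _
  have key := h₃ (fun x => s * u x) u (fun x => u x ^ n) hv (measurable_schwartz _) u.integrable
    ⟨C, hC⟩ ((measurable_schwartz u).pow_const n)
    ⟨C ^ n, fun x => by rw [abs_pow]; exact pow_le_pow_left₀ (abs_nonneg _) (hC x) n⟩ hs₃ ?_
  -- The previous lemma differentiates at `0`, so the parameter is shifted by `s`.
  · rw [← sub_self s] at key
    have h := key.comp_sub_const s s
    refine (h.congr_deriv ?_).congr_of_eventuallyEq (Eventually.of_forall fun s' => ?_)
    · simp only [pow_succ, mul_comm]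
    · refine integral_congr_ae (ae_of_all _ fun x => ?_)
      dsimp only
      congr 2
      ring
  · rcases n with _ | n
    · simpa using h₂ _ hv (u.integrable.const_mul s) hs₂
    · refine h₁ _ _ hv ?_ hs₁
      simpa using integrable_prod_schwartz (fun _ : Fin (n + 1) => u) Finset.univ_nonempty

theorem neg_laplacian_add_sum {m₀ : ℝ} {f u : ι → 𝓢(Plane, ℝ)}
    (hu : ∀ j, -(Δ (u j)) + m₀ ^ 2 • u j = f j) (t : ι → ℝ) :
    -(Δ (∑ j, t j • u j)) + m₀ ^ 2 • ∑ j, t j • u j = ∑ j, t j • f j := by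
  have h : ∀ v : 𝓢(Plane, ℝ), Δ v = LineDeriv.laplacianCLM ℝ Plane 𝓢(Plane, ℝ) v := fun v =>
    (SchwartzMap.laplacianCLM_eq' v).symm
  simp only [← hu, h, map_sum, map_smul, smul_add, smul_neg, Finset.smul_sum,
    Finset.sum_add_distrib, Finset.sum_neg_distrib]
  congr 1
  exact Finset.sum_congr rfl fun j _ => smul_comm _ _ _

theorem integral_sum_mul_neg_laplacian (u : ι → 𝓢(Plane, ℝ)) (t : ι → ℝ) :
    ∫ x, (∑ j, t j • u j) x * (-(Δ (∑ j, t j • u j))) x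
      = ∑ i, ∑ j, t i * t j * ∫ x, u i x * (-(Δ (u j))) x := by
  have h : ∀ v : 𝓢(Plane, ℝ), Δ v = LineDeriv.laplacianCLM ℝ Plane 𝓢(Plane, ℝ) v := fun v =>
    (SchwartzMap.laplacianCLM_eq' v).symm
  have hint : ∀ i j, Integrable fun x => t i * t j * (u i x * (-(Δ (u j))) x) := fun i j => by
    have := integrable_prod_schwartz ![u i, -(Δ (u j))] (B := Finset.univ) ⟨0, by simp⟩
    simp only [Fin.prod_univ_two, Matrix.cons_val_zero, Matrix.cons_val_one] at this
    exact this.const_mul _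
  simp only [← integral_const_mul]
  simp_rw [← integral_finsetSum _ fun j _ => hint _ j]
  rw [← integral_finsetSum _ fun i _ => integrable_finsetSum _ fun j _ => hint i j]
  refine integral_congr_ae (ae_of_all _ fun x => ?_)
  simp only [h, map_sum, map_smul, ← Finset.sum_neg_distrib, sum_apply, neg_apply, smul_apply,
    smul_eq_mul, Finset.sum_mul_sum]
  refine Finset.sum_congr rfl fun i _ => Finset.sum_congr rfl fun j _ => ?_
  ring

/-- `φ` solves the massive equation driven by a Lévy noise and an independent gradient Gaussian noise. -/
structure IsMassiveLevyField (P : Measure Ω) (ψ : ℝ → ℂ) (m₀ : ℝ)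
    (η ηg φ : Ω → RealDistribution) : Prop where
  levy : IsLevyCharacteristic ψ
  smooth : ContDiffAt ℝ ∞ ψ 0
  pos : 0 < m₀
  measurable_levy : Measurable η
  measurable_gauss : Measurable ηg
  measurable_field : Measurable φ
  law_levy : IsLevyNoise P ψ η
  law_gauss : IsGradientGaussianNoise P (levyCumulant ψ 2 / (2 * m₀ ^ 2)) ηg
  indep : IndepFun η ηg P
  solves : ∀ᵐ w ∂P, SolvesMassiveEquation m₀ (φ w) (η w + ηg w)

namespace IsMassiveLevyField

variable {ψ : ℝ → ℂ} {m₀ : ℝ} {η ηg φ : Ω → RealDistribution}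

theorem measurable_apply (h : IsMassiveLevyField P ψ m₀ η ηg φ) (f : 𝓢(Plane, ℝ)) :
    Measurable fun w => φ w f :=
  (measurable_eval_distribution f).comp h.measurable_field

variable [IsProbabilityMeasure P]

/-- The characteristic function of `φ f` is the exponential of a Lévy functional along a ray minus a
quadratic term, hence smooth at the origin. -/
theorem memLp (h : IsMassiveLevyField P ψ m₀ η ηg φ) {f u : 𝓢(Plane, ℝ)}
    (hu : -(Δ u) + m₀ ^ 2 • u = f) (k : ℕ) : MemLp (fun w => φ w f) k P := by
  have hm := h.measurable_apply f
  have hprob : IsProbabilityMeasure (P.map fun w => φ w f) :=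
    Measure.isProbabilityMeasure_map hm.aemeasurable
  have hchar : charFun (P.map fun w => φ w f) = fun s : ℝ => Complex.exp
      ((∫ x, iteratedDeriv 0 ψ (s * u x) * ((u x ^ 0 : ℝ) : ℂ))
        - (levyCumulant ψ 2 / (2 * m₀ ^ 2) : ℝ) * ((s : ℂ) ^ 2 * (∫ x, u x * (-(Δ u)) x : ℝ))) := by
    ext s
    rw [charFun_apply_real, integral_map hm.aemeasurable
      (by fun_prop)]
    -- The multivariate identities are reused with a one-element index set.
    have hs : -(Δ (∑ j : Unit, s • u)) + m₀ ^ 2 • ∑ j : Unit, s • u = ∑ j : Unit, s • f :=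
      neg_laplacian_add_sum (f := fun _ : Unit => f) (u := fun _ => u) (fun _ => hu) fun _ => s
    have key := integral_exp_massive_field h.measurable_levy h.measurable_gauss h.law_levy
      h.law_gauss h.indep h.solves hs
    have hq := integral_sum_mul_neg_laplacian (fun _ : Unit => u) fun _ => s
    rw [hq] at key
    simp only [Finset.univ_unique, Finset.sum_singleton, map_smul, smul_apply, smul_eq_mul] at key
    simp only [iteratedDeriv_zero, pow_zero, Complex.ofReal_one, mul_one]
    convert key using 2
    · ext w
      congr 1
      push_cast
      ring
    · push_cast
      ring
  refine (memLp_map_measure_iff (g := id) (f := fun w => φ w f) (by fun_prop) hm.aemeasurable).1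
    (memLp_of_contDiffAt_charFun ?_ k)
  rw [hchar]
  refine ContDiffAt.cexp (ContDiffAt.sub ?_ ?_)
  · exact contDiffAt_infty_of_hasDerivAt (k := fun n s => ∫ x, iteratedDeriv n ψ (s * u x) *
      ((u x ^ n : ℝ) : ℂ)) fun n => eventually_hasDerivAt_levy_smul h.levy h.smooth u n
  · exact contDiffAt_const.mul ((Complex.ofRealCLM.contDiff.contDiffAt.pow 2).mul contDiffAt_const)

variable [DecidableEq ι]

/-- The first summand comes from differentiating `∫ ψ(∑ t_j u_j)` once in each direction of `B`. The
Gaussian noise contributes a quadratic form in `t`, whose mixed derivatives at `0` vanish unless `B`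
has two elements. -/
theorem truncated_eq_aux (h : IsMassiveLevyField P ψ m₀ η ηg φ) {f u : ι → 𝓢(Plane, ℝ)}
    (hu : ∀ j, -(Δ (u j)) + m₀ ^ 2 • u j = f j) {B : Finset ι} (hB : B.Nonempty) :
    truncated (fun J => ∫ w, ∏ j ∈ J, φ w (f j) ∂P) B
      = levyCumulant ψ B.card * (∫ x, ∏ j ∈ B, u j x)
        + if B.card = 2 then levyCumulant ψ 2 / (2 * m₀ ^ 2) *
          ∑ a ∈ B, ∑ b ∈ B.erase a, ∫ x, u a x * (-(Δ (u b))) x else 0 := by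
  set κ := levyCumulant ψ 2 / (2 * m₀ ^ 2) with hκ
  set Γ : ι → ι → ℝ := fun i j => ∫ x, u i x * (-(Δ (u j))) x with hΓ
  have hsymm : ∀ i j, Γ i j = Γ j i := by
    intro i j
    simp only [hΓ, neg_apply, mul_neg, integral_neg]
    rw [SchwartzMap.integral_mul_laplacian_right_eq_left]
    simp only [mul_comm]
  have key := integral_prod_eq_partitionSum (P := P) (X := fun j w => φ w (f j))
    (fun j => h.measurable_apply (f j)) (fun j k => h.memLp (hu j) k)
    (fun B t => (∫ x, iteratedDeriv B.card ψ (∑ j, t j * u j x) * ((∏ j ∈ B, u j x : ℝ) : ℂ))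
      + (quadraticPartial κ Γ B t : ℂ)) ?_ ?_
  · have h1 := truncated_eq_of_partitionSum key hB
    have h2 := congrArg Complex.re h1
    rw [Complex.ofReal_re] at h2
    rw [h2]
    have h3 : ∫ x, iteratedDeriv B.card ψ (∑ j, (0 : ι → ℝ) j * u j x) *
        ((∏ j ∈ B, u j x : ℝ) : ℂ) = iteratedDeriv B.card ψ 0 * ((∫ x, ∏ j ∈ B, u j x : ℝ) : ℂ) := by
      rw [← integral_complex_ofReal, ← integral_const_mul]
      simp
    rw [h3, mul_add, ← mul_assoc, Complex.add_re, Complex.re_mul_ofReal, Complex.re_mul_ofReal,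
      levyCumulant]
    congr 1
    by_cases h2 : B.card = 2
    · simp [quadraticPartial, h2, hΓ]
    · unfold quadraticPartial
      rw [if_neg h2, if_neg hB.card_ne_zero, if_neg h2]
      split_ifs <;> simp
  · filter_upwards with t
    have h1 := integral_exp_massive_field h.measurable_levy h.measurable_gauss h.law_levy
      h.law_gauss h.indep h.solves (neg_laplacian_add_sum hu t)
    rw [integral_sum_mul_neg_laplacian] at h1
    simp only [map_sum, map_smul, smul_eq_mul, sum_apply, smul_apply] at h1
    rw [h1]
    congr 1
    simp [quadraticPartial, hκ, hΓ, sub_eq_add_neg]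
  · intro B b hb
    filter_upwards [eventually_hasDerivAt_levy h.levy h.smooth u B hb] with t ht
    exact ht.add (hasDerivAt_quadraticPartial hsymm B hb t).ofReal_comp

theorem truncated_eq (h : IsMassiveLevyField P ψ m₀ η ηg φ) {f u : ι → 𝓢(Plane, ℝ)}
    (hu : ∀ j, -(Δ (u j)) + m₀ ^ 2 • u j = f j) {B : Finset ι} (hB : B.Nonempty)
    (hB2 : B.card ≠ 2) :
    truncated (fun J => ∫ w, ∏ j ∈ J, φ w (f j) ∂P) B
      = levyCumulant ψ B.card * (∫ x, ∏ j ∈ B, u j x) := by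
  rw [h.truncated_eq_aux hu hB, if_neg hB2, add_zero]

/-- The strength `c₂ / (2 m₀²)` occurs twice, once for each order of the pair. Thus `c₂ ∫ u_a u_b +
(c₂ / m₀²) ∫ u_a (-Δ u_b)` is `c₂ / m₀²` times `∫ u_a (-Δ + m₀²) u_b`, and one Green's function
disappears. -/
theorem truncated_pair_eq (h : IsMassiveLevyField P ψ m₀ η ηg φ) {f u : ι → 𝓢(Plane, ℝ)}
    (hu : ∀ j, -(Δ (u j)) + m₀ ^ 2 • u j = f j) {a b : ι} (hab : a ≠ b) :
    truncated (fun J => ∫ w, ∏ j ∈ J, φ w (f j) ∂P) {a, b}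
      = levyCumulant ψ 2 / m₀ ^ 2 * (∫ x, u a x * f b x) := by
  have hint : ∀ v w : 𝓢(Plane, ℝ), Integrable fun x => v x * w x := fun v w => by
    have := integrable_prod_schwartz ![v, w] (B := Finset.univ) ⟨0, by simp⟩
    simpa only [Fin.prod_univ_two, Matrix.cons_val_zero, Matrix.cons_val_one] using this
  have hsymm : ∫ x, u b x * (-(Δ (u a))) x = ∫ x, u a x * (-(Δ (u b))) x := by
    simp only [neg_apply, mul_neg, integral_neg]
    rw [SchwartzMap.integral_mul_laplacian_right_eq_left]
    simp only [mul_comm]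
  have hcard := Finset.card_pair hab
  have e1 : ({a, b} : Finset ι).erase a = {b} := Finset.erase_insert (by simpa using hab)
  have e2 : ({a, b} : Finset ι).erase b = {a} := by
    rw [Finset.pair_comm]
    exact Finset.erase_insert (by simpa using hab.symm)
  have h1 : ∫ x, u a x * f b x = (∫ x, u a x * (-(Δ (u b))) x) + m₀ ^ 2 * ∫ x, u a x * u b x := by
    rw [← integral_const_mul, ← integral_add (hint _ _) ((hint _ _).const_mul _)]
    refine integral_congr_ae (ae_of_all _ fun x => ?_)
    simp only [← hu b, add_apply, smul_apply, smul_eq_mul]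
    ring
  rw [h.truncated_eq_aux hu (Finset.insert_nonempty _ _), hcard, if_pos rfl, Finset.sum_pair hab,
    e1, e2, Finset.sum_singleton, Finset.sum_singleton, hsymm, h1]
  simp only [Finset.prod_pair hab]
  have := h.pos
  field_simp
  ring

end IsMassiveLevyField

end Cumulants

end MassiveField

/-! ### The Green's function: integrability and regularity -/

section GreenFunction

open Real Set

/-- The heat kernel of `-Δ + m²` at time `t`. -/
def massiveHeatKernel (m t : ℝ) (x : Plane) : ℝ :=
  (4 * π * t)⁻¹ * exp (-(m ^ 2 * t) - ‖x‖ ^ 2 / (4 * t))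

/-- The Green's function of `-Δ + m²` on the plane. -/
def massiveGreen (m : ℝ) (x : Plane) : ℝ := ∫ t in Ioi (0 : ℝ), massiveHeatKernel m t x

theorem measurable_massiveHeatKernel (m : ℝ) :
    Measurable fun z : ℝ × Plane => massiveHeatKernel m z.1 z.2 := by
  unfold massiveHeatKernel
  fun_prop

theorem massiveHeatKernel_nonneg (m : ℝ) {t : ℝ} (ht : 0 < t) (x : Plane) :
    0 ≤ massiveHeatKernel m t x := by
  unfold massiveHeatKernel
  positivity

theorem massiveGreen_nonneg (m : ℝ) (x : Plane) : 0 ≤ massiveGreen m x :=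
  setIntegral_nonneg measurableSet_Ioi fun _ ht => massiveHeatKernel_nonneg m ht x

theorem massiveGreen_neg (m : ℝ) (x : Plane) : massiveGreen m (-x) = massiveGreen m x := by
  simp [massiveGreen, massiveHeatKernel]

theorem measurable_massiveGreen (m : ℝ) : Measurable (massiveGreen m) := by
  have h : StronglyMeasurable fun z : Plane × ℝ => massiveHeatKernel m z.2 z.1 :=
    ((measurable_massiveHeatKernel m).comp measurable_swap).stronglyMeasurable
  exact (h.integral_prod_right' (ν := volume.restrict (Ioi (0 : ℝ)))).measurable

/-- The inequality `exp (-v) ≤ 1 / v` for `v = u / a`, raised to the power `a`. -/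
theorem exp_neg_le_rpow {u a : ℝ} (hu : 0 < u) (ha : 0 < a) : exp (-u) ≤ (u / a) ^ (-a) := by
  have h1 : exp (-u) = exp (-(u / a)) ^ a := by
    rw [← exp_mul]
    congr 1
    field_simp
  have h2 : exp (-(u / a)) ≤ (u / a)⁻¹ := by
    rw [exp_neg]
    refine inv_anti₀ (by positivity) ?_
    linarith [add_one_le_exp (u / a)]
  rw [h1, rpow_neg (by positivity), ← inv_rpow (by positivity)]
  exact rpow_le_rpow (exp_pos _).le h2 ha.le

theorem integrableOn_rpow_mul_exp {m s : ℝ} (hm : 0 < m) (hs : -1 < s) :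
    IntegrableOn (fun t : ℝ => t ^ s * exp (-(m ^ 2 * t))) (Ioi 0) := by
  have h := integrableOn_rpow_mul_exp_neg_mul_rpow (p := 1) hs one_pos (b := m ^ 2) (by positivity)
  simpa using h

/-- The Gaussian factor is traded for the power `‖x‖^(-2a)` and a factor `t^a`; the latter makes the
singularity `1 / t` integrable at `t = 0`. -/
theorem massiveHeatKernel_le (m : ℝ) {t a : ℝ} (ht : 0 < t) (ha : 0 < a) {x : Plane} (hx : x ≠ 0) :
    massiveHeatKernel m t x
      ≤ (4 * π)⁻¹ * (4 * a) ^ a * ‖x‖ ^ (-(2 * a)) * (t ^ (a - 1) * exp (-(m ^ 2 * t))) := by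
  have hx' : 0 < ‖x‖ := norm_pos_iff.2 hx
  have h1 := exp_neg_le_rpow (u := ‖x‖ ^ 2 / (4 * t)) (a := a) (by positivity) ha
  have h2 : (‖x‖ ^ 2 / (4 * t) / a) ^ (-a) = (4 * a) ^ a * ‖x‖ ^ (-(2 * a)) * t ^ a := by
    rw [rpow_neg (by positivity), ← inv_rpow (by positivity), inv_div, div_div_eq_mul_div,
      div_rpow (by positivity) (by positivity), mul_comm a, mul_right_comm,
      mul_rpow (by positivity) (by positivity), rpow_neg (by positivity), rpow_mul (by positivity)]
    norm_num
    ring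
  unfold massiveHeatKernel
  rw [sub_eq_add_neg, exp_add]
  calc (4 * π * t)⁻¹ * (exp (-(m ^ 2 * t)) * exp (-(‖x‖ ^ 2 / (4 * t))))
      ≤ (4 * π * t)⁻¹ * (exp (-(m ^ 2 * t)) * ((4 * a) ^ a * ‖x‖ ^ (-(2 * a)) * t ^ a)) := by
        rw [← h2]
        gcongr
    _ = _ := by
        rw [rpow_sub_one ht.ne', mul_inv]
        ring

theorem integrableOn_massiveHeatKernel {m : ℝ} (hm : 0 < m) {x : Plane} (hx : x ≠ 0) :
    IntegrableOn (fun t => massiveHeatKernel m t x) (Ioi 0) := by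
  refine Integrable.mono' ((integrableOn_rpow_mul_exp hm (s := (1 : ℝ) - 1) (by norm_num)).const_mul
    ((4 * π)⁻¹ * (4 * 1) ^ (1 : ℝ) * ‖x‖ ^ (-(2 * 1) : ℝ))) ?_ ?_
  · exact ((measurable_massiveHeatKernel m).comp (measurable_id.prodMk measurable_const)
      ).aestronglyMeasurable
  · refine (ae_restrict_iff' measurableSet_Ioi).2 (ae_of_all _ fun t ht => ?_)
    rw [Real.norm_of_nonneg (massiveHeatKernel_nonneg m ht x)]
    exact massiveHeatKernel_le m ht one_pos hx

/-- The freedom in `a` is essential: small `a` shows that the singularity at the origin is weaker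
than any power, large `a` gives the decay at infinity. -/
theorem exists_massiveGreen_le {m a : ℝ} (hm : 0 < m) (ha : 0 < a) :
    ∃ C, 0 ≤ C ∧ ∀ x : Plane, x ≠ 0 → massiveGreen m x ≤ C * ‖x‖ ^ (-(2 * a)) := by
  refine ⟨(4 * π)⁻¹ * (4 * a) ^ a * ∫ t in Ioi (0 : ℝ), t ^ (a - 1) * exp (-(m ^ 2 * t)), ?_, ?_⟩
  · refine mul_nonneg (by positivity) (setIntegral_nonneg measurableSet_Ioi fun t ht => ?_)
    have : 0 < t := ht
    positivity
  · intro x hx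
    calc massiveGreen m x ≤ ∫ t in Ioi (0 : ℝ), (4 * π)⁻¹ * (4 * a) ^ a * ‖x‖ ^ (-(2 * a)) *
          (t ^ (a - 1) * exp (-(m ^ 2 * t))) :=
          setIntegral_mono_on (integrableOn_massiveHeatKernel hm hx)
            ((integrableOn_rpow_mul_exp hm (by linarith)).const_mul _) measurableSet_Ioi
            fun t ht => massiveHeatKernel_le m ht ha hx
      _ = _ := by
          rw [integral_const_mul]
          ring

theorem memLp_massiveGreen {m : ℝ} (hm : 0 < m) {q : ℕ} (hq : q ≠ 0) :
    MemLp (massiveGreen m) q := by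
  have hq' : (0 : ℝ) < q := by exact_mod_cast Nat.pos_of_ne_zero hq
  -- With this `a` the `q`-th power is bounded by a multiple of `‖x‖⁻¹`, integrable near the origin
  -- of the plane. The second choice, `a = 2`, bounds it by a multiple of `‖x‖⁻⁴` outside the unit
  -- ball.
  obtain ⟨C₁, hC₁, h₁⟩ := exists_massiveGreen_le hm (a := 1 / (2 * q)) (by positivity)
  obtain ⟨C₂, hC₂, h₂⟩ := exists_massiveGreen_le hm (a := 2) (by norm_num)
  refine (integrable_norm_rpow_iff (measurable_massiveGreen m).aestronglyMeasurable
    (by simpa using hq) (ENNReal.natCast_ne_top _)).1 ?_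
  set f : ℝ → ℝ := fun r => if r ≤ 1 then C₁ ^ q * r ^ (-1 : ℝ) else C₂ ^ q * r ^ (-4 : ℝ) with hf
  have hfi : Integrable fun x : Plane => f ‖x‖ := by
    rw [integrable_fun_norm_addHaar (μ := volume) (f := f), ← Ioc_union_Ioi_eq_Ioi zero_le_one,
      integrableOn_union]
    simp only [finrank_euclideanSpace, Fintype.card_fin, Nat.add_one_sub_one, pow_one, smul_eq_mul]
    constructor
    · refine (integrableOn_const (C := C₁ ^ q) (by simp)).congr_fun (fun r hr => ?_)
        measurableSet_Ioc
      have : 0 < r := hr.1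
      simp only [hf, if_pos hr.2, rpow_neg_one]
      field_simp
    · refine (IntegrableOn.congr_fun (((integrableOn_Ioi_rpow_of_lt (a := -3) (by norm_num)
        one_pos).const_mul (C₂ ^ q))) (fun r hr => ?_) measurableSet_Ioi)
      have h0 : 0 < r := one_pos.trans hr
      simp only [hf, if_neg (not_le.2 (show (1 : ℝ) < r from hr))]
      rw [show (-3 : ℝ) = 1 + -4 by norm_num, rpow_add h0, rpow_one]
      ring
  refine hfi.mono' (by
    have := (measurable_massiveGreen m).norm
    exact (this.pow_const _).aestronglyMeasurable) ?_
  have h0 : ∀ᵐ x : Plane, x ≠ 0 := by simp [ae_iff]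
  filter_upwards [h0] with x hx
  have hx' : 0 < ‖x‖ := norm_pos_iff.2 hx
  rw [ENNReal.toReal_natCast, rpow_natCast, Real.norm_of_nonneg (massiveGreen_nonneg m x),
    Real.norm_of_nonneg (pow_nonneg (massiveGreen_nonneg m x) q)]
  simp only [hf]
  split_ifs with h
  · calc massiveGreen m x ^ q ≤ (C₁ * ‖x‖ ^ (-(2 * (1 / (2 * q))) : ℝ)) ^ q :=
        pow_le_pow_left₀ (massiveGreen_nonneg m x) (h₁ x hx) q
      _ = C₁ ^ q * ‖x‖ ^ (-1 : ℝ) := by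
        rw [mul_pow, ← rpow_natCast (‖x‖ ^ _), ← rpow_mul hx'.le]
        congr 2
        field_simp
  · push Not at h
    calc massiveGreen m x ^ q ≤ (C₂ * ‖x‖ ^ (-(2 * 2) : ℝ)) ^ q :=
        pow_le_pow_left₀ (massiveGreen_nonneg m x) (h₂ x hx) q
      _ = C₂ ^ q * ‖x‖ ^ (-4 * q : ℝ) := by
        rw [mul_pow, ← rpow_natCast (‖x‖ ^ _), ← rpow_mul hx'.le]
        norm_num
      _ ≤ C₂ ^ q * ‖x‖ ^ (-4 : ℝ) := by
        gcongr
        · exact h.le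
        · have : (1 : ℝ) ≤ q := by exact_mod_cast Nat.one_le_iff_ne_zero.2 hq
          linarith

theorem integrable_massiveGreen {m : ℝ} (hm : 0 < m) : Integrable (massiveGreen m) := by
  simpa using memLp_one_iff_integrable.1 (by simpa using memLp_massiveGreen hm one_ne_zero)

/-- Of the factor `t²` from `exp_neg_le_rpow` with exponent `2`, one power of `t` survives the
difference of the exponents and later cancels the `1 / t` of the heat kernel. The condition `b ≤ a +
1` serves to bound `a + b` by a multiple of `a`. -/
theorem exp_sub_exp_le {t δ a b : ℝ} (ht : 0 < t) (hδ : 0 < δ) (ha : δ ≤ a) (hab : a ≤ b)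
    (hb : b ≤ a + 1) :
    exp (-(a ^ 2 / (4 * t))) - exp (-(b ^ 2 / (4 * t)))
      ≤ 16 * (2 + 1 / δ) / δ ^ 3 * (b - a) * t := by
  have ha0 : 0 < a := hδ.trans_le ha
  have h1 := exp_neg_le_rpow (u := a ^ 2 / (4 * t)) (a := 2) (by positivity) two_pos
  have h2 : (a ^ 2 / (4 * t) / 2) ^ (-2 : ℝ) = 64 * t ^ 2 / a ^ 4 := by
    rw [rpow_neg (by positivity), rpow_two]
    field_simp
    norm_num
  rw [h2] at h1
  have h3 : 1 - exp (-((b ^ 2 - a ^ 2) / (4 * t))) ≤ (b ^ 2 - a ^ 2) / (4 * t) := by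
    linarith [add_one_le_exp (-((b ^ 2 - a ^ 2) / (4 * t)))]
  have h4 : exp (-(b ^ 2 / (4 * t)))
      = exp (-(a ^ 2 / (4 * t))) * exp (-((b ^ 2 - a ^ 2) / (4 * t))) := by
    rw [← exp_add]
    congr 1
    ring
  have h5 : 0 ≤ (b ^ 2 - a ^ 2) / (4 * t) := by
    have : a ^ 2 ≤ b ^ 2 := by gcongr
    exact div_nonneg (by linarith) (by positivity)
  have h6 : b + a ≤ (2 + 1 / δ) * a := by
    have : 1 ≤ 1 / δ * a := by rw [one_div, ← div_eq_inv_mul, one_le_div hδ]; exact ha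
    nlinarith
  have h7 : a * (1 / a ^ 4) ≤ 1 / δ ^ 3 := by
    have : a * (1 / a ^ 4) = 1 / a ^ 3 := by field_simp
    rw [this]
    gcongr
  calc exp (-(a ^ 2 / (4 * t))) - exp (-(b ^ 2 / (4 * t)))
      = exp (-(a ^ 2 / (4 * t))) * (1 - exp (-((b ^ 2 - a ^ 2) / (4 * t)))) := by rw [h4]; ring
    _ ≤ (64 * t ^ 2 / a ^ 4) * ((b ^ 2 - a ^ 2) / (4 * t)) := by
        refine mul_le_mul h1 h3 ?_ (by positivity)
        rw [sub_nonneg, exp_le_one_iff]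
        linarith
    _ = 16 * t * (b - a) * ((b + a) * (1 / a ^ 4)) := by field_simp; ring
    _ ≤ 16 * t * (b - a) * ((2 + 1 / δ) * a * (1 / a ^ 4)) := by
        have : 0 ≤ b - a := by linarith
        gcongr
    _ = 16 * t * (b - a) * ((2 + 1 / δ) * (a * (1 / a ^ 4))) := by ring
    _ ≤ 16 * t * (b - a) * ((2 + 1 / δ) * (1 / δ ^ 3)) := by
        have : 0 ≤ b - a := by linarith
        gcongr
    _ = _ := by ring

theorem exists_abs_massiveGreen_sub_le {m δ : ℝ} (hm : 0 < m) (hδ : 0 < δ) :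
    ∃ L, 0 ≤ L ∧ ∀ x y : Plane, δ ≤ ‖x‖ → δ ≤ ‖y‖ → ‖x - y‖ ≤ 1 →
      |massiveGreen m x - massiveGreen m y| ≤ L * ‖x - y‖ := by
  set K := 16 * (2 + 1 / δ) / δ ^ 3 with hK
  set L := (4 * π)⁻¹ * K * ∫ t in Ioi (0 : ℝ), exp (-(m ^ 2 * t)) with hL
  have hL0 : 0 ≤ L := by
    have : 0 ≤ ∫ t in Ioi (0 : ℝ), exp (-(m ^ 2 * t)) := integral_nonneg fun t => (exp_pos _).le
    positivity
  have hexp : IntegrableOn (fun t : ℝ => exp (-(m ^ 2 * t))) (Ioi 0) := by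
    simpa using integrableOn_rpow_mul_exp hm (s := 0) (by norm_num)
  refine ⟨L, hL0, ?_⟩
  have key : ∀ x y : Plane, δ ≤ ‖x‖ → ‖x‖ ≤ ‖y‖ → ‖x - y‖ ≤ 1 →
      |massiveGreen m x - massiveGreen m y| ≤ L * ‖x - y‖ := by
    intro x y hx hxy h1
    have hx0 : x ≠ 0 := norm_pos_iff.1 (hδ.trans_le hx)
    have hy0 : y ≠ 0 := norm_pos_iff.1 (hδ.trans_le (hx.trans hxy))
    have hd : ‖y‖ - ‖x‖ ≤ ‖x - y‖ := by
      rw [norm_sub_rev]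
      exact norm_sub_norm_le y x
    have hpt : ∀ t ∈ Ioi (0 : ℝ), |massiveHeatKernel m t x - massiveHeatKernel m t y|
        ≤ (4 * π)⁻¹ * K * ‖x - y‖ * exp (-(m ^ 2 * t)) := by
      intro t (ht : 0 < t)
      have h2 := exp_sub_exp_le ht hδ hx hxy (by linarith)
      have h3 : 0 ≤ exp (-(‖x‖ ^ 2 / (4 * t))) - exp (-(‖y‖ ^ 2 / (4 * t))) := by
        rw [sub_nonneg]
        gcongr
      have h4 : massiveHeatKernel m t x - massiveHeatKernel m t y = (4 * π * t)⁻¹ *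
          exp (-(m ^ 2 * t)) * (exp (-(‖x‖ ^ 2 / (4 * t))) - exp (-(‖y‖ ^ 2 / (4 * t)))) := by
        simp only [massiveHeatKernel, sub_eq_add_neg (-(m ^ 2 * t)), exp_add]
        ring
      rw [h4, abs_of_nonneg (by positivity)]
      calc (4 * π * t)⁻¹ * exp (-(m ^ 2 * t)) *
            (exp (-(‖x‖ ^ 2 / (4 * t))) - exp (-(‖y‖ ^ 2 / (4 * t))))
          ≤ (4 * π * t)⁻¹ * exp (-(m ^ 2 * t)) * (K * ‖x - y‖ * t) := by
            refine mul_le_mul_of_nonneg_left (h2.trans ?_) (by positivity)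
            rw [hK]
            gcongr
        _ = _ := by field_simp
    rw [massiveGreen, massiveGreen, ← integral_sub (integrableOn_massiveHeatKernel hm hx0)
      (integrableOn_massiveHeatKernel hm hy0)]
    calc |∫ t in Ioi (0 : ℝ), (massiveHeatKernel m t x - massiveHeatKernel m t y)|
        ≤ ∫ t in Ioi (0 : ℝ), |massiveHeatKernel m t x - massiveHeatKernel m t y| :=
          abs_integral_le_integral_abs
      _ ≤ ∫ t in Ioi (0 : ℝ), (4 * π)⁻¹ * K * ‖x - y‖ * exp (-(m ^ 2 * t)) :=
          setIntegral_mono_on ((integrableOn_massiveHeatKernel hm hx0).sub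
            (integrableOn_massiveHeatKernel hm hy0)).abs (hexp.const_mul _) measurableSet_Ioi hpt
      _ = _ := by
          rw [integral_const_mul, hL]
          ring
  intro x y hx hy h1
  rcases le_total ‖x‖ ‖y‖ with h | h
  · exact key x y hx h h1
  · rw [abs_sub_comm, norm_sub_rev]
    exact key y x hy h (by rwa [norm_sub_rev])

theorem exists_massiveGreen_le_of_le_norm {m δ : ℝ} (hm : 0 < m) (hδ : 0 < δ) :
    ∃ C, 0 ≤ C ∧ ∀ x : Plane, δ ≤ ‖x‖ → |massiveGreen m x| ≤ C := by
  obtain ⟨C, hC, h⟩ := exists_massiveGreen_le hm (a := 1 / 2) (by norm_num)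
  refine ⟨C * δ ^ (-1 : ℝ), by positivity, fun x hx => ?_⟩
  rw [abs_of_nonneg (massiveGreen_nonneg m x)]
  refine (h x (norm_pos_iff.1 (hδ.trans_le hx))).trans ?_
  norm_num
  rw [rpow_neg_one, rpow_neg_one]
  gcongr

end GreenFunction

/-! ### Schwartz solutions of the massive equation -/

section MassiveSolution

open Real Set
open scoped FourierTransform

/-- Composition of a Schwartz function with a continuous linear map on the left. -/
def schwartzPostcomp {E F : Type*} [NormedAddCommGroup E] [NormedSpace ℝ E] [NormedAddCommGroup F]
    [NormedSpace ℝ F] (L : E →L[ℝ] F) (f : 𝓢(Plane, E)) : 𝓢(Plane, F) where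
  toFun := L ∘ f
  smooth' := L.contDiff.comp (f.smooth ⊤)
  decay' k n := by
    obtain ⟨C, hC⟩ := f.decay' k n
    refine ⟨‖L‖ * C, fun x => ?_⟩
    have h := L.norm_iteratedFDeriv_comp_left (f := f) (x := x) (n := n) (N := ∞)
      (f.smooth ⊤).contDiffAt (by exact_mod_cast le_top)
    calc ‖x‖ ^ k * ‖iteratedFDeriv ℝ n (L ∘ f) x‖
        ≤ ‖x‖ ^ k * (‖L‖ * ‖iteratedFDeriv ℝ n f x‖) := by gcongr
      _ = ‖L‖ * (‖x‖ ^ k * ‖iteratedFDeriv ℝ n f x‖) := by ring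
      _ ≤ ‖L‖ * C := by
        gcongr
        exact hC x

theorem schwartzPostcomp_apply {E F : Type*} [NormedAddCommGroup E] [NormedSpace ℝ E]
    [NormedAddCommGroup F] [NormedSpace ℝ F] (L : E →L[ℝ] F) (f : 𝓢(Plane, E)) (x : Plane) :
    schwartzPostcomp L f x = L (f x) := rfl

theorem laplacian_schwartzPostcomp {E F : Type*} [NormedAddCommGroup E] [NormedSpace ℝ E]
    [NormedAddCommGroup F] [NormedSpace ℝ F] (L : E →L[ℝ] F) (f : 𝓢(Plane, E)) :
    Δ (schwartzPostcomp L f) = schwartzPostcomp L (Δ f) := by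
  ext x
  rw [SchwartzMap.laplacian_apply, schwartzPostcomp_apply, SchwartzMap.laplacian_apply]
  exact ContDiffAt.laplacian_CLM_comp_left (l := L) (f.smooth 2).contDiffAt

/-- After rescaling `ξ` by `2π / m` the symbol is `m⁻²` times `(1 + ‖·‖²)⁻¹`. -/
theorem hasTemperateGrowth_massive_symbol {m : ℝ} (hm : 0 < m) :
    Function.HasTemperateGrowth fun ξ : Plane => ((2 * π) ^ 2 * ‖ξ‖ ^ 2 + m ^ 2)⁻¹ := by
  have h1 := (Function.hasTemperateGrowth_one_add_norm_sq_rpow (-1) (H := Plane)).comp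
    (((2 * π / m) • ContinuousLinearMap.id ℝ Plane).hasTemperateGrowth)
  have h2 := (Function.HasTemperateGrowth.const (E := Plane) ((m ^ 2)⁻¹ : ℝ)).mul h1
  refine (congrArg Function.HasTemperateGrowth (funext fun ξ => ?_)).mpr h2
  have h3 : 0 ≤ 2 * π / m := by positivity
  simp only [Pi.mul_apply, Function.comp_apply, smul_apply, ContinuousLinearMap.id_apply,
    norm_smul, Real.norm_of_nonneg h3]
  rw [rpow_neg_one, ← mul_inv]
  congr 1
  field_simp
  ring

theorem neg_laplacian_add_fourierMultiplier {m : ℝ} (hm : 0 < m) (f : 𝓢(Plane, ℂ)) :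
    -(Δ (SchwartzMap.fourierMultiplierCLM ℂ
      (fun ξ : Plane => ((2 * π) ^ 2 * ‖ξ‖ ^ 2 + m ^ 2)⁻¹) f))
    + m ^ 2 • SchwartzMap.fourierMultiplierCLM ℂ
      (fun ξ : Plane => ((2 * π) ^ 2 * ‖ξ‖ ^ 2 + m ^ 2)⁻¹) f = f := by
  have hσ := hasTemperateGrowth_massive_symbol hm
  have hn : Function.HasTemperateGrowth fun ξ : Plane => ‖ξ‖ ^ 2 := by fun_prop
  have h1 : SchwartzMap.fourierMultiplierCLM ℂ
      ((fun ξ : Plane => (2 * π) ^ 2 * ‖ξ‖ ^ 2 + m ^ 2) *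
        fun ξ : Plane => ((2 * π) ^ 2 * ‖ξ‖ ^ 2 + m ^ 2)⁻¹) f = f := by
    have : ((fun ξ : Plane => (2 * π) ^ 2 * ‖ξ‖ ^ 2 + m ^ 2) *
        fun ξ : Plane => ((2 * π) ^ 2 * ‖ξ‖ ^ 2 + m ^ 2)⁻¹) = fun _ => 1 := by
      ext ξ
      exact mul_inv_cancel₀ (by positivity)
    rw [this, SchwartzMap.fourierMultiplierCLM_const]
    simp
  have hsum : Function.HasTemperateGrowth fun ξ : Plane => (2 * π) ^ 2 * ‖ξ‖ ^ 2 + m ^ 2 :=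
    ((Function.HasTemperateGrowth.const _).mul hn).add (Function.HasTemperateGrowth.const _)
  rw [SchwartzMap.laplacian_eq_fourierMultiplierCLM]
  conv_rhs => rw [← h1, ← SchwartzMap.fourierMultiplierCLM_fourierMultiplierCLM_apply hsum hσ]
  generalize SchwartzMap.fourierMultiplierCLM ℂ
      (fun ξ : Plane => ((2 * π) ^ 2 * ‖ξ‖ ^ 2 + m ^ 2)⁻¹) f = U
  ext x
  simp only [SchwartzMap.fourierMultiplierCLM_apply, add_apply, neg_apply, smul_apply]
  have e : SchwartzMap.smulLeftCLM ℂ (fun ξ : Plane => (2 * π) ^ 2 * ‖ξ‖ ^ 2 + m ^ 2) (𝓕 U)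
      = (2 * π) ^ 2 • SchwartzMap.smulLeftCLM ℂ (fun ξ : Plane => ‖ξ‖ ^ 2) (𝓕 U) + m ^ 2 • 𝓕 U := by
    ext ξ
    rw [SchwartzMap.smulLeftCLM_apply_apply hsum, add_apply, smul_apply, smul_apply,
      SchwartzMap.smulLeftCLM_apply_apply hn, add_smul, mul_smul]
  rw [e, FourierTransform.fourierInv_add, FourierTransform.fourierInv_smul,
    FourierTransform.fourierInv_smul, FourierTransform.fourierInv_fourier_eq]
  simp

theorem integral_massiveHeatKernel (m : ℝ) {t : ℝ} (ht : 0 < t) (x : Plane) :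
    ∫ y, massiveHeatKernel m t (x - y) = exp (-(m ^ 2 * t)) := by
  rw [integral_sub_left_eq_self (massiveHeatKernel m t) volume x]
  have h : ∀ y : Plane, massiveHeatKernel m t y
      = (4 * π * t)⁻¹ * exp (-(m ^ 2 * t)) * exp (-(1 / (4 * t)) * ‖y‖ ^ 2) := by
    intro y
    rw [massiveHeatKernel, sub_eq_add_neg, exp_add, ← mul_assoc]
    congr 2
    ring
  simp only [h]
  rw [integral_const_mul, GaussianFourier.integral_rexp_neg_mul_sq_norm (by positivity)]
  simp only [finrank_euclideanSpace, Fintype.card_fin]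
  norm_num
  field_simp

/-- A non-integrable function would have integral zero by convention, whereas the integral is
positive. -/
theorem integrable_massiveHeatKernel (m : ℝ) {t : ℝ} (ht : 0 < t) (x : Plane) :
    Integrable fun y => massiveHeatKernel m t (x - y) := by
  by_contra hn
  have h := integral_massiveHeatKernel m ht x
  rw [integral_undef hn] at h
  exact (exp_pos _).ne h

/-- The Fourier transform is moved from `f` to the Gaussian, whose transform is known explicitly. -/
theorem integral_exp_mul_fourier {t : ℝ} (ht : 0 < t) (f : 𝓢(Plane, ℂ)) (x : Plane) :
    ∫ ξ : Plane, Complex.exp (-(((4 * π ^ 2 * t : ℝ) : ℂ)) * ‖ξ‖ ^ 2 + 2 * π * Complex.I * inner ℝ x ξ)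
        * 𝓕 f ξ
      = ∫ y, (4 * π * t : ℂ)⁻¹ * Complex.exp (-‖x - y‖ ^ 2 / (4 * t)) * f y := by
  have hb : 0 < (((4 * π ^ 2 * t : ℝ) : ℂ)).re := by
    rw [Complex.ofReal_re]
    positivity
  have hint : Integrable fun ξ : Plane =>
      Complex.exp (-(((4 * π ^ 2 * t : ℝ) : ℂ)) * ‖ξ‖ ^ 2 + 2 * π * Complex.I * inner ℝ x ξ) :=
    GaussianFourier.integrable_cexp_neg_mul_sq_norm_add hb _ _
  have h := VectorFourier.integral_fourierIntegral_smul_eq_flip (L := innerₗ Plane)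
    (μ := volume) (ν := volume) Real.continuous_fourierChar
    (by exact continuous_inner) (f.integrable (μ := volume)) hint
  have h2 : ∀ y : Plane, VectorFourier.fourierIntegral Real.fourierChar volume (innerₗ Plane).flip
      (fun ξ : Plane => Complex.exp (-(((4 * π ^ 2 * t : ℝ) : ℂ)) * ‖ξ‖ ^ 2
        + 2 * π * Complex.I * inner ℝ x ξ)) y
      = (4 * π * t : ℂ)⁻¹ * Complex.exp (-‖x - y‖ ^ 2 / (4 * t)) := by
    intro y
    rw [flip_innerₗ]
    refine (fourier_gaussian_innerProductSpace' hb x y).trans ?_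
    have hp : (π : ℂ) ≠ 0 := by exact_mod_cast pi_ne_zero
    have ht' : (t : ℂ) ≠ 0 := by exact_mod_cast ht.ne'
    congr 1
    · rw [finrank_euclideanSpace, Fintype.card_fin]
      norm_num
      field_simp
    · congr 1
      push_cast
      field_simp
  simp only [h2, smul_eq_mul] at h
  calc _ = ∫ ξ, 𝓕 f ξ * Complex.exp (-(((4 * π ^ 2 * t : ℝ) : ℂ)) * ‖ξ‖ ^ 2
        + 2 * π * Complex.I * inner ℝ x ξ) := by simp only [mul_comm]
    _ = ∫ y, f y * ((4 * π * t : ℂ)⁻¹ * Complex.exp (-‖x - y‖ ^ 2 / (4 * t))) := h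
    _ = _ := by simp only [mul_comm]

theorem integral_exp_neg_mul_Ioi {c : ℝ} (hc : 0 < c) :
    IntegrableOn (fun t : ℝ => exp (-(c * t))) (Ioi 0) ∧
      ∫ t in Ioi (0 : ℝ), exp (-(c * t)) = c⁻¹ := by
  constructor
  · simpa using integrableOn_exp_mul_Ioi (a := -c) (by linarith) 0
  · have := integral_exp_mul_Ioi (a := -c) (by linarith) 0
    simpa using this

/-- The symbol is written as `∫ exp (-(4π²‖ξ‖² + m²) t) dt` over `t > 0`. Exchanging integrals once
in frequency and once in position space, with the Gaussian transform in between, produces the heat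
kernel representation of `massiveGreen`. -/
theorem fourierMultiplier_eq_integral_massiveGreen {m : ℝ} (hm : 0 < m) (f : 𝓢(Plane, ℂ))
    (x : Plane) :
    SchwartzMap.fourierMultiplierCLM ℂ
      (fun ξ : Plane => ((2 * π) ^ 2 * ‖ξ‖ ^ 2 + m ^ 2)⁻¹) f x
      = ∫ y, (massiveGreen m (x - y) : ℂ) * f y := by
  set μ := volume.restrict (Ioi (0 : ℝ)) with hμ
  have hσ := hasTemperateGrowth_massive_symbol hm
  have hexp := integral_exp_neg_mul_Ioi (c := m ^ 2) (by positivity)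
  have hpos : ∀ᵐ t ∂μ, 0 < t := (ae_restrict_iff' measurableSet_Ioi).2 (ae_of_all _ fun t ht => ht)
  have h1 : Integrable (fun z : ℝ × Plane => (exp (-(((2 * π) ^ 2 * ‖z.2‖ ^ 2 + m ^ 2) * z.1)) : ℂ)
      * (Complex.exp (2 * π * Complex.I * inner ℝ x z.2) * 𝓕 f z.2)) (μ.prod volume) := by
    have hdom : Integrable (fun z : ℝ × Plane => exp (-(m ^ 2 * z.1)) * ‖𝓕 f z.2‖)
        (μ.prod volume) := hexp.1.mul_prod (𝓕 f).integrable.norm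
    have hc : Continuous fun z : ℝ × Plane => 𝓕 f z.2 := (𝓕 f).continuous.comp continuous_snd
    refine hdom.mono' ?_ ?_
    · refine Continuous.aestronglyMeasurable ?_
      fun_prop
    · have : ∀ᵐ z : ℝ × Plane ∂(μ.prod volume), 0 < z.1 :=
        Measure.quasiMeasurePreserving_fst.ae hpos
      filter_upwards [this] with z hz
      have e : Complex.exp (2 * π * Complex.I * inner ℝ x z.2)
          = Complex.exp ((2 * π * inner ℝ x z.2 : ℝ) * Complex.I) := by
        congr 1
        push_cast
        ring
      rw [norm_mul, norm_mul, Complex.norm_real, e, Complex.norm_exp_ofReal_mul_I, one_mul,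
        Real.norm_of_nonneg (exp_pos _).le]
      gcongr
      have : 0 ≤ (2 * π) ^ 2 * ‖z.2‖ ^ 2 := by positivity
      linarith
  have h2 : Integrable (fun z : ℝ × Plane => (massiveHeatKernel m z.1 (x - z.2) : ℂ) * f z.2)
      (μ.prod volume) := by
    have hmeas : Measurable fun z : ℝ × Plane => massiveHeatKernel m z.1 (x - z.2) :=
      (measurable_massiveHeatKernel m).comp
        (measurable_fst.prodMk (measurable_const.sub measurable_snd))
    have hdom : Integrable (fun z : ℝ × Plane => massiveHeatKernel m z.1 (x - z.2))
        (μ.prod volume) := by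
      rw [integrable_prod_iff hmeas.aestronglyMeasurable]
      constructor
      · filter_upwards [hpos] with t ht
        exact integrable_massiveHeatKernel m ht x
      · refine hexp.1.congr ?_
        filter_upwards [hpos] with t ht
        rw [← integral_massiveHeatKernel m ht x]
        exact integral_congr_ae (ae_of_all _ fun y =>
          (Real.norm_of_nonneg (massiveHeatKernel_nonneg m ht _)).symm)
    have hc : Continuous fun z : ℝ × Plane => f z.2 := f.continuous.comp continuous_snd
    refine hdom.ofReal.mul_bdd (c := SchwartzMap.seminorm ℝ 0 0 f) hc.aestronglyMeasurable
      (ae_of_all _ fun z => SchwartzMap.norm_le_seminorm ℝ f z.2)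
  calc SchwartzMap.fourierMultiplierCLM ℂ
        (fun ξ : Plane => ((2 * π) ^ 2 * ‖ξ‖ ^ 2 + m ^ 2)⁻¹) f x
      = ∫ ξ : Plane, Complex.exp (2 * π * Complex.I * inner ℝ x ξ) *
          (((((2 * π) ^ 2 * ‖ξ‖ ^ 2 + m ^ 2)⁻¹ : ℝ) : ℂ) * 𝓕 f ξ) := by
        rw [SchwartzMap.fourierMultiplierCLM_apply, SchwartzMap.fourierInv_coe, Real.fourierInv_eq']
        refine integral_congr_ae (ae_of_all _ fun ξ => ?_)
        dsimp only
        rw [SchwartzMap.smulLeftCLM_apply_apply hσ, smul_eq_mul, Complex.real_smul,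
          real_inner_comm]
        congr 2
        push_cast
        ring
    _ = ∫ ξ : Plane, ∫ t, (exp (-(((2 * π) ^ 2 * ‖ξ‖ ^ 2 + m ^ 2) * t)) : ℂ)
          * (Complex.exp (2 * π * Complex.I * inner ℝ x ξ) * 𝓕 f ξ) ∂μ := by
        refine integral_congr_ae (ae_of_all _ fun ξ => ?_)
        dsimp only
        rw [integral_mul_const, integral_complex_ofReal, hμ,
          (integral_exp_neg_mul_Ioi (c := (2 * π) ^ 2 * ‖ξ‖ ^ 2 + m ^ 2) (by positivity)).2]
        ring
    _ = ∫ t, (∫ ξ : Plane, (exp (-(((2 * π) ^ 2 * ‖ξ‖ ^ 2 + m ^ 2) * t)) : ℂ)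
          * (Complex.exp (2 * π * Complex.I * inner ℝ x ξ) * 𝓕 f ξ)) ∂μ :=
        (integral_integral_swap h1).symm
    _ = ∫ t, (∫ y, (massiveHeatKernel m t (x - y) : ℂ) * f y) ∂μ := by
        refine integral_congr_ae ?_
        filter_upwards [hpos] with t ht
        have e1 : ∀ ξ : Plane, (exp (-(((2 * π) ^ 2 * ‖ξ‖ ^ 2 + m ^ 2) * t)) : ℂ)
            * (Complex.exp (2 * π * Complex.I * inner ℝ x ξ) * 𝓕 f ξ)
            = Complex.exp (-(m ^ 2 * t)) * (Complex.exp (-(((4 * π ^ 2 * t : ℝ) : ℂ)) * ‖ξ‖ ^ 2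
              + 2 * π * Complex.I * inner ℝ x ξ) * 𝓕 f ξ) := by
          intro ξ
          push_cast
          rw [← mul_assoc, ← mul_assoc, ← Complex.exp_add, ← Complex.exp_add]
          congr 2
          ring
        have e2 : ∀ y : Plane, (massiveHeatKernel m t (x - y) : ℂ) * f y
            = Complex.exp (-(m ^ 2 * t)) *
              ((4 * π * t : ℂ)⁻¹ * Complex.exp (-‖x - y‖ ^ 2 / (4 * t)) * f y) := by
          intro y
          rw [massiveHeatKernel, sub_eq_add_neg, exp_add]
          push_cast
          rw [neg_div]
          ring
        simp only [e1, e2]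
        rw [integral_const_mul, integral_const_mul, integral_exp_mul_fourier ht]
    _ = ∫ y, ∫ t, (massiveHeatKernel m t (x - y) : ℂ) * f y ∂μ := integral_integral_swap h2
    _ = _ := by
        refine integral_congr_ae (ae_of_all _ fun y => ?_)
        dsimp only
        rw [integral_mul_const, integral_complex_ofReal, massiveGreen]

/-- The Fourier multiplier yields a complex Schwartz solution for the complexified right-hand side;
its real part is the solution sought. -/
theorem exists_massive_solution {m : ℝ} (hm : 0 < m) (f : 𝓢(Plane, ℝ)) :
    ∃ u : 𝓢(Plane, ℝ), -(Δ u) + m ^ 2 • u = f ∧ ∀ x, u x = ∫ y, massiveGreen m (x - y) * f y := by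
  set F : 𝓢(Plane, ℂ) := schwartzPostcomp Complex.ofRealCLM f with hF
  set U := SchwartzMap.fourierMultiplierCLM ℂ
    (fun ξ : Plane => ((2 * π) ^ 2 * ‖ξ‖ ^ 2 + m ^ 2)⁻¹) F with hU
  refine ⟨schwartzPostcomp Complex.reCLM U, ?_, fun x => ?_⟩
  · ext x
    have h := congrArg (fun V : 𝓢(Plane, ℂ) => (V x).re) (neg_laplacian_add_fourierMultiplier hm F)
    rw [← hU] at h
    clear_value U
    rw [laplacian_schwartzPostcomp]
    simpa [schwartzPostcomp_apply, hF, ← Complex.ofReal_pow] using h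
  · rw [schwartzPostcomp_apply, hU, fourierMultiplier_eq_integral_massiveGreen hm F x]
    have : ∀ y, (massiveGreen m (x - y) : ℂ) * F y = ((massiveGreen m (x - y) * f y : ℝ) : ℂ) := by
      intro y
      simp [hF, schwartzPostcomp_apply]
    simp only [this, integral_complex_ofReal]
    simp

end MassiveSolution

/-! ### Young's inequality and uniform convergence away from the origin -/

section ApproximateIdentity

open scoped ENNReal NNReal

/-- The convolution of two functions on the plane. -/
def smear (χ f : Plane → ℝ) (x : Plane) : ℝ := ∫ u, χ u * f (x - u)

theorem measurable_smear {χ f : Plane → ℝ} (hχ : Measurable χ) (hf : Measurable f) :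
    Measurable (smear χ f) := by
  have h : StronglyMeasurable fun z : Plane × Plane => χ z.2 * f (z.1 - z.2) :=
    ((hχ.comp measurable_snd).mul
      (hf.comp (measurable_fst.sub measurable_snd))).stronglyMeasurable
  exact (h.integral_prod_right' (ν := volume)).measurable

/-- Hölder's inequality for the splitting `a b = a^(1 - 1/q) (a b^q)^(1/q)`. -/
theorem lintegral_mul_pow_le {β : Type*} [MeasurableSpace β] {μ : Measure β} {a b : β → ℝ≥0∞}
    (ha : AEMeasurable a μ) (hb : AEMeasurable b μ) {q : ℕ} (hq : q ≠ 0) :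
    (∫⁻ x, a x * b x ∂μ) ^ q ≤ (∫⁻ x, a x ∂μ) ^ (q - 1) * ∫⁻ x, a x * b x ^ q ∂μ := by
  have hq0 : (0 : ℝ) < q := by exact_mod_cast Nat.pos_of_ne_zero hq
  have hq1 : (1 : ℝ) ≤ q := by exact_mod_cast Nat.one_le_iff_ne_zero.2 hq
  have hp : 0 ≤ 1 - (q : ℝ)⁻¹ := by
    rw [sub_nonneg]
    exact inv_le_one_of_one_le₀ hq1
  have h := ENNReal.lintegral_mul_norm_pow_le (μ := μ) ha (ha.mul (hb.pow_const q))
    (p := 1 - (q : ℝ)⁻¹) (q := (q : ℝ)⁻¹) hp (by positivity) (by ring)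
  have e1 : ∀ x, a x ^ (1 - (q : ℝ)⁻¹) * (a x * b x ^ q) ^ (q : ℝ)⁻¹ = a x * b x := by
    intro x
    rw [ENNReal.mul_rpow_of_nonneg _ _ (by positivity), ← mul_assoc,
      ← ENNReal.rpow_add_of_nonneg _ _ hp (by positivity), sub_add_cancel, ENNReal.rpow_one,
      ← ENNReal.rpow_natCast, ← ENNReal.rpow_mul, mul_inv_cancel₀ hq0.ne', ENNReal.rpow_one]
  simp only [Pi.mul_apply, e1] at h
  refine (pow_le_pow_left₀ zero_le h q).trans_eq ?_
  rw [mul_pow, ← ENNReal.rpow_natCast, ← ENNReal.rpow_natCast, ← ENNReal.rpow_mul,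
    ← ENNReal.rpow_mul, inv_mul_cancel₀ hq0.ne', ENNReal.rpow_one, sub_mul, one_mul,
    inv_mul_cancel₀ hq0.ne', ← ENNReal.rpow_natCast, Nat.cast_sub (Nat.one_le_iff_ne_zero.2 hq),
    Nat.cast_one]

theorem eLpNorm_pow_natCast {β : Type*} [MeasurableSpace β] {μ : Measure β} {f : β → ℝ} {q : ℕ}
    (hq : q ≠ 0) : eLpNorm f q μ ^ q = ∫⁻ x, ‖f x‖ₑ ^ q ∂μ := by
  have h := eLpNorm_nnreal_pow_eq_lintegral (μ := μ) (f := f) (p := (q : ℝ≥0)) (by exact_mod_cast hq)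
  simpa using h

/-- Young's convolution inequality for an integrable function and an `L^q` function. -/
theorem eLpNorm_smear_le {χ f : Plane → ℝ} (hχ : Measurable χ) (hf : Measurable f) {q : ℕ}
    (hq : q ≠ 0) : eLpNorm (smear χ f) q volume ≤ eLpNorm χ 1 volume * eLpNorm f q volume := by
  rw [← ENNReal.pow_le_pow_left_iff hq, mul_pow, eLpNorm_pow_natCast hq, eLpNorm_pow_natCast hq,
    eLpNorm_one_eq_lintegral_enorm]
  have hm : Measurable fun z : Plane × Plane => ‖χ z.2‖ₑ * ‖f (z.1 - z.2)‖ₑ ^ q :=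
    (hχ.comp measurable_snd).enorm.mul
      ((hf.comp (measurable_fst.sub measurable_snd)).enorm.pow_const q)
  calc ∫⁻ x, ‖smear χ f x‖ₑ ^ q
      ≤ ∫⁻ x, (∫⁻ u, ‖χ u‖ₑ) ^ (q - 1) * ∫⁻ u, ‖χ u‖ₑ * ‖f (x - u)‖ₑ ^ q := by
        refine lintegral_mono fun x => ?_
        refine le_trans (pow_le_pow_left₀ zero_le
          (enorm_integral_le_lintegral_enorm _) q) ?_
        simp only [enorm_mul]
        exact lintegral_mul_pow_le hχ.enorm.aemeasurable
          (hf.comp (measurable_const.sub measurable_id)).enorm.aemeasurable hq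
    _ = (∫⁻ u, ‖χ u‖ₑ) ^ (q - 1) * ∫⁻ u, ‖χ u‖ₑ * ∫⁻ x, ‖f x‖ₑ ^ q := by
        rw [lintegral_const_mul _ hm.lintegral_prod_right', lintegral_lintegral_swap hm.aemeasurable]
        congr 1
        refine lintegral_congr fun u => ?_
        dsimp only
        rw [lintegral_const_mul _ (show Measurable fun x => ‖f (x - u)‖ₑ ^ q from
            (hf.comp (measurable_id.sub_const u)).enorm.pow_const q),
          lintegral_sub_right_eq_self (fun x => ‖f x‖ₑ ^ q) u]
    _ = _ := by
        rw [lintegral_mul_const _ hχ.enorm, ← mul_assoc, ← pow_succ,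
          Nat.sub_add_cancel (Nat.one_le_iff_ne_zero.2 hq)]

/-- Approximations of the Dirac measure at the origin of the plane by bounded integrable
functions. -/
structure IsApproximateIdentity {α : Type*} (l : Filter α) (χ : α → Plane → ℝ) : Prop where
  measurable : ∀ i, Measurable (χ i)
  integrable : ∀ i, Integrable (χ i)
  pointwise_bounded : ∀ i, ∃ C, ∀ x, |χ i x| ≤ C
  norm_bounded : ∃ C, ∀ᶠ i in l, ∫ x, |χ i x| ≤ C
  tendsto_one : Tendsto (fun i => ∫ x, χ i x) l (𝓝 1)
  tail_integral : ∀ δ > 0,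
    Tendsto (fun i => ∫ x in {x : Plane | δ ≤ ‖x‖}, |χ i x|) l (𝓝 0)
  tail_uniform : ∀ δ > 0,
    TendstoUniformlyOn χ (fun _ => 0) l {x : Plane | δ ≤ ‖x‖}

theorem IsDiracApproximation.isApproximateIdentity {χ : ℝ → 𝓢(Plane, ℝ)}
    (h : IsDiracApproximation χ) :
    IsApproximateIdentity (𝓝[>] (0 : ℝ)) fun ε x => χ ε x := by
  refine ⟨fun ε => measurable_schwartz _, fun ε => (χ ε).integrable, fun ε => ?_, h.bounded, ?_,
    h.tail_integral, h.tail_uniform⟩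
  · obtain ⟨C, _, hC⟩ := exists_abs_schwartz_le (χ ε)
    exact ⟨C, hC⟩
  -- Convergence to the Dirac measure only tests against Schwartz functions. A bump equal to `1` on
  -- the unit ball replaces the constant `1`, and the error is controlled by the tail in `L¹`.
  · let b : ContDiffBump (0 : Plane) := ⟨1, 2, one_pos, one_lt_two⟩
    let B : 𝓢(Plane, ℝ) := b.hasCompactSupport.toSchwartzMap b.contDiff
    have hB : ∀ x, B x = b x := fun x => rfl
    have hB0 : B 0 = 1 := b.one_of_mem_closedBall (by simp [b])
    have h1 := h.tendsto_dirac B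
    rw [hB0] at h1
    have h2 : Tendsto (fun ε => ∫ x, χ ε x * (1 - B x)) (𝓝[>] 0) (𝓝 0) := by
      refine squeeze_zero_norm (fun ε => ?_) (h.tail_integral 1 one_pos)
      rw [← integral_indicator (measurableSet_le measurable_const measurable_norm)]
      refine norm_integral_le_of_norm_le ?_ (ae_of_all _ fun x => ?_)
      · exact (χ ε).integrable.abs.indicator (measurableSet_le measurable_const measurable_norm)
      · rw [norm_mul, Real.norm_eq_abs, Real.norm_eq_abs]
        by_cases hx : 1 ≤ ‖x‖
        · rw [Set.indicator_of_mem (by exact hx)]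
          refine mul_le_of_le_one_right (abs_nonneg _) ?_
          rw [hB, abs_le]
          constructor <;> linarith [b.nonneg (x := x), b.le_one (x := x)]
        · have : B x = 1 := b.one_of_mem_closedBall (by
            simpa [b] using (not_le.1 hx).le)
          rw [this]
          simp only [sub_self, abs_zero, mul_zero]
          exact Set.indicator_nonneg (fun _ _ => abs_nonneg _) _
    have hi : ∀ ε, Integrable fun x => χ ε x * B x := fun ε => by
      have := integrable_prod_schwartz ![χ ε, B] (B := Finset.univ) ⟨0, by simp⟩
      simpa only [Fin.prod_univ_two, Matrix.cons_val_zero, Matrix.cons_val_one] using this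
    have h3 := h1.add h2
    rw [add_zero] at h3
    refine h3.congr fun ε => ?_
    rw [← integral_add (hi ε)]
    · simp only [← mul_add, add_sub_cancel, mul_one]
    · exact ((χ ε).integrable.sub (hi ε)).congr (ae_of_all _ fun x => by simp [mul_sub])

variable {α : Type*} {l : Filter α}

theorem integrable_mul_comp_sub {χ f : Plane → ℝ} (hm : Measurable χ) (hb : ∃ C, ∀ x, |χ x| ≤ C)
    (hf : Integrable f) (x : Plane) : Integrable fun u => χ u * f (x - u) := by
  obtain ⟨C, hC⟩ := hb
  exact (hf.comp_sub_left x).bdd_mul hm.aestronglyMeasurable (ae_of_all _ hC)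

/-- For `u` near the origin, `f (x - u)` is close to `f₀ (x - u)` and thus to `f₀ x`. For `u` away
from it, `χ` is uniformly small while `f` is bounded in `L¹`, so that `f` may be singular at the
origin. The rest is `f₀ x` times a defect of mass. -/
theorem IsApproximateIdentity.tendstoUniformlyOn_smear {χ : α → Plane → ℝ}
    (h : IsApproximateIdentity l χ) {f : α → Plane → ℝ} {f₀ : Plane → ℝ}
    (hfm : ∀ i, Integrable (f i)) (hfb : ∃ C, ∀ᶠ i in l, ∫ x, |f i x| ≤ C)
    (hf : ∀ δ > 0, TendstoUniformlyOn f f₀ l {x : Plane | δ ≤ ‖x‖})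
    (hf₀b : ∀ δ > 0, ∃ C, ∀ x : Plane, δ ≤ ‖x‖ → |f₀ x| ≤ C)
    (hf₀ : ∀ δ > 0, ∃ L, 0 ≤ L ∧ ∀ x y : Plane, δ ≤ ‖x‖ → δ ≤ ‖y‖ → ‖x - y‖ ≤ 1 →
      |f₀ x - f₀ y| ≤ L * ‖x - y‖) {δ : ℝ} (hδ : 0 < δ) :
    TendstoUniformlyOn (fun i => smear (χ i) (f i)) f₀ l {x : Plane | δ ≤ ‖x‖} := by
  obtain ⟨A, hA⟩ := h.norm_bounded
  obtain ⟨A', hA'⟩ := hfb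
  obtain ⟨M, hM⟩ := hf₀b δ hδ
  obtain ⟨L, hL0, hL⟩ := hf₀ (δ / 2) (by positivity)
  rw [Metric.tendstoUniformlyOn_iff]
  intro ε hε
  -- The near part costs two sixths of `ε`, the far part and the two mass terms one sixth each.
  set η := ε / (6 * (|A| + 1)) with hη
  have hη0 : 0 < η := by positivity
  -- `δ / 2` keeps `x - u` away from the origin, `1` admits the local Lipschitz bound, and the last
  -- entry makes its contribution at most `η`.
  set ρ := min (min (δ / 2) 1) (η / (L + 1)) with hρ
  have hρ0 : 0 < ρ := by positivity
  have hρδ : ρ ≤ δ / 2 := (min_le_left _ _).trans (min_le_left _ _)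
  have hρ1 : ρ ≤ 1 := (min_le_left _ _).trans (min_le_right _ _)
  have hρL : L * ρ ≤ η := by
    have : ρ ≤ η / (L + 1) := min_le_right _ _
    rw [le_div_iff₀ (by positivity)] at this
    nlinarith
  have h1 := Metric.tendstoUniformlyOn_iff.1 (hf (δ / 2) (by positivity)) η hη0
  have h2 := Metric.tendstoUniformlyOn_iff.1 (h.tail_uniform ρ hρ0) (ε / (6 * (|A'| + 1)))
    (by positivity)
  have h3 := (h.tail_integral ρ hρ0).eventually_lt_const (show 0 < ε / (6 * (|M| + 1)) by positivity)
  have h4 := Metric.tendsto_nhds.1 h.tendsto_one (ε / (6 * (|M| + 1))) (by positivity)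
  filter_upwards [h1, h2, h3, h4, hA, hA'] with i hi1 hi2 hi3 hi4 hiA hiA' x hx
  have hx' : δ ≤ ‖x‖ := hx
  set S : Set Plane := {u : Plane | ρ ≤ ‖u‖} with hS
  have hSm : MeasurableSet S := measurableSet_le measurable_const measurable_norm
  have hint := integrable_mul_comp_sub (h.measurable i) (h.pointwise_bounded i) (hfm i) x
  have hχi := h.integrable i
  have hsplit : smear (χ i) (f i) x - f₀ x = (∫ u in Sᶜ, χ i u * (f i (x - u) - f₀ x))
      + (∫ u in S, χ i u * f i (x - u)) + (f₀ x * ((∫ u, χ i u) - 1)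
      - f₀ x * ∫ u in S, χ i u) := by
    have e1 : ∫ u in Sᶜ, χ i u * (f i (x - u) - f₀ x)
        = (∫ u in Sᶜ, χ i u * f i (x - u)) - (∫ u in Sᶜ, χ i u) * f₀ x := by
      simp only [mul_sub]
      rw [integral_sub hint.integrableOn (hχi.mul_const _).integrableOn, integral_mul_const]
    have e2 := integral_add_compl hSm hint
    have e3 := integral_add_compl hSm hχi
    rw [e1, smear, ← e2, ← e3]
    ring
  have b1 : |∫ u in Sᶜ, χ i u * (f i (x - u) - f₀ x)| ≤ 2 * η * |A| := by
    have hpt : ∀ u ∈ Sᶜ, ‖χ i u * (f i (x - u) - f₀ x)‖ ≤ 2 * η * |χ i u| := by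
      intro u hu
      have hu' : ‖u‖ < ρ := not_le.1 hu
      have hxu : δ / 2 ≤ ‖x - u‖ := by
        have := norm_sub_norm_le x u
        linarith
      have a1 := hi1 (x - u) hxu
      rw [dist_comm, Real.dist_eq] at a1
      have a2 := hL (x - u) x hxu (by linarith) (by simpa using hu'.le.trans hρ1)
      have a3 : ‖x - u - x‖ ≤ ρ := by simpa using hu'.le
      have a4 : |f i (x - u) - f₀ x| ≤ 2 * η := by
        have a5 := abs_sub_le (f i (x - u)) (f₀ (x - u)) (f₀ x)
        have a6 : L * ‖x - u - x‖ ≤ L * ρ := by gcongr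
        linarith
      rw [norm_mul, Real.norm_eq_abs, Real.norm_eq_abs, mul_comm]
      gcongr
    calc |∫ u in Sᶜ, χ i u * (f i (x - u) - f₀ x)| ≤ ∫ u in Sᶜ, 2 * η * |χ i u| :=
          norm_integral_le_of_norm_le (hχi.abs.const_mul _).integrableOn
            ((ae_restrict_iff' hSm.compl).2 (ae_of_all _ hpt))
      _ ≤ ∫ u, 2 * η * |χ i u| := setIntegral_le_integral (hχi.abs.const_mul _)
          (ae_of_all _ fun u => by positivity)
      _ = 2 * η * ∫ u, |χ i u| := integral_const_mul _ _
      _ ≤ 2 * η * |A| := by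
        gcongr
        exact hiA.trans (le_abs_self A)
  have b2 : |∫ u in S, χ i u * f i (x - u)| ≤ ε / (6 * (|A'| + 1)) * |A'| := by
    have hpt : ∀ u ∈ S, ‖χ i u * f i (x - u)‖ ≤ ε / (6 * (|A'| + 1)) * |f i (x - u)| := by
      intro u hu
      have := hi2 u hu
      rw [dist_zero_left, Real.norm_eq_abs] at this
      rw [norm_mul, Real.norm_eq_abs, Real.norm_eq_abs]
      gcongr
    have hfi : Integrable fun u => ε / (6 * (|A'| + 1)) * |f i (x - u)| :=
      ((hfm i).comp_sub_left x).abs.const_mul _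
    calc |∫ u in S, χ i u * f i (x - u)| ≤ ∫ u in S, ε / (6 * (|A'| + 1)) * |f i (x - u)| :=
          norm_integral_le_of_norm_le hfi.integrableOn
            ((ae_restrict_iff' hSm).2 (ae_of_all _ hpt))
      _ ≤ ∫ u, ε / (6 * (|A'| + 1)) * |f i (x - u)| := setIntegral_le_integral hfi
          (ae_of_all _ fun u => by positivity)
      _ = ε / (6 * (|A'| + 1)) * ∫ u, |f i u| := by
          rw [integral_const_mul, integral_sub_left_eq_self (fun u => |f i u|) volume x]
      _ ≤ ε / (6 * (|A'| + 1)) * |A'| := by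
        gcongr
        exact hiA'.trans (le_abs_self A')
  have b3 : |f₀ x * ((∫ u, χ i u) - 1)| ≤ |M| * (ε / (6 * (|M| + 1))) := by
    rw [abs_mul]
    rw [Real.dist_eq] at hi4
    exact mul_le_mul ((hM x hx').trans (le_abs_self M)) hi4.le (abs_nonneg _) (abs_nonneg _)
  have b4 : |f₀ x * ∫ u in S, χ i u| ≤ |M| * (ε / (6 * (|M| + 1))) := by
    rw [abs_mul]
    exact mul_le_mul ((hM x hx').trans (le_abs_self M)) (abs_integral_le_integral_abs.trans hi3.le)
      (abs_nonneg _) (abs_nonneg _)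
  have c : ∀ t : ℝ, 0 ≤ t → ε / (6 * (t + 1)) * t ≤ ε / 6 := by
    intro t ht
    rw [div_mul_eq_mul_div, div_le_div_iff₀ (by positivity) (by positivity)]
    nlinarith
  have c1 := c _ (abs_nonneg A)
  have c2 := c _ (abs_nonneg A')
  have c3 := c _ (abs_nonneg M)
  rw [dist_comm, Real.dist_eq, hsplit]
  have t1 := abs_add_le ((∫ u in Sᶜ, χ i u * (f i (x - u) - f₀ x))
      + (∫ u in S, χ i u * f i (x - u))) (f₀ x * ((∫ u, χ i u) - 1) - f₀ x * ∫ u in S, χ i u)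
  have t2 := abs_add_le (∫ u in Sᶜ, χ i u * (f i (x - u) - f₀ x))
      (∫ u in S, χ i u * f i (x - u))
  have t3 := abs_sub (f₀ x * ((∫ u, χ i u) - 1)) (f₀ x * ∫ u in S, χ i u)
  have d1 : 2 * η * |A| = 2 * (ε / (6 * (|A| + 1)) * |A|) := by rw [hη]; ring
  nlinarith

end ApproximateIdentity

/-! ### Convergence in all `L^q` and its stability under products -/

section LpConvergence

open scoped ENNReal NNReal

variable {α : Type*} {l : Filter α}

theorem pow_le_mul_pow_add_inv {s : ℝ≥0} (hs : 0 < s) (t : ℝ≥0∞) (q : ℕ) :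
    t ^ q ≤ s * t ^ (2 * q) + (s : ℝ≥0∞)⁻¹ := by
  have hs' : (s : ℝ≥0∞) ≠ 0 := by exact_mod_cast hs.ne'
  rcases le_total (t ^ q) (s : ℝ≥0∞)⁻¹ with h | h
  · exact h.trans le_add_self
  · have h1 : 1 ≤ s * t ^ q := by
      rw [← ENNReal.mul_inv_cancel hs' ENNReal.coe_ne_top]
      gcongr
    calc t ^ q = 1 * t ^ q := (one_mul _).symm
      _ ≤ s * t ^ q * t ^ q := by gcongr
      _ = s * t ^ (2 * q) := by rw [mul_assoc, ← pow_add, two_mul]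
      _ ≤ _ := le_self_add

/-- Functions on the plane which are bounded in every `L^q` and tend to zero uniformly away from the
origin tend to zero in `L^q` for `2 ≤ q`. -/
theorem tendsto_eLpNorm_zero {h : α → Plane → ℝ} (hm : ∀ i, Measurable (h i))
    (hb : ∀ q : ℕ, q ≠ 0 → ∃ C : ℝ≥0∞, C ≠ ⊤ ∧ ∀ᶠ i in l, eLpNorm (h i) q volume ≤ C)
    (hu : ∀ δ > 0, TendstoUniformlyOn h (fun _ => 0) l {x : Plane | δ ≤ ‖x‖}) {q : ℕ}
    (hq : 2 ≤ q) : Tendsto (fun i => eLpNorm (h i) q volume) l (𝓝 0) := by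
  have hq0 : q ≠ 0 := by omega
  rw [ENNReal.tendsto_nhds_zero]
  intro ε hε
  obtain ⟨C₂, hC₂, hb₂⟩ := hb (2 * q) (by omega)
  obtain ⟨C₁, hC₁, hb₁⟩ := hb 1 one_ne_zero
  set τ : ℝ≥0∞ := ε ^ q / 3 with hτ
  have hτ0 : τ ≠ 0 := by
    rw [hτ, Ne, ENNReal.div_eq_zero_iff]
    simp [hε.ne', hq0]
  obtain ⟨s, hs, hs'⟩ := ENNReal.exists_nnreal_pos_mul_lt (ENNReal.pow_ne_top hC₂ (n := 2 * q)) hτ0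
  have hsi : (s : ℝ≥0∞)⁻¹ ≠ ⊤ := by simpa using hs.ne'
  obtain ⟨δ', hδ', hδ''⟩ := ENNReal.exists_nnreal_pos_mul_lt
    (ENNReal.mul_ne_top hsi (ENNReal.coe_ne_top (r := NNReal.pi))) hτ0
  obtain ⟨η', hη', hη''⟩ := ENNReal.exists_nnreal_pos_mul_lt hC₁ hτ0
  set δ : ℝ≥0 := min δ' 1 with hδ
  set η : ℝ≥0 := min η' 1 with hη
  have hδ0 : 0 < δ := lt_min hδ' one_pos
  have hη0 : 0 < η := lt_min hη' one_pos
  have h1 := Metric.tendstoUniformlyOn_iff.1 (hu δ (by exact_mod_cast hδ0)) η (by exact_mod_cast hη0)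
  filter_upwards [h1, hb₁, hb₂] with i hi hi₁ hi₂
  rw [← ENNReal.pow_le_pow_left_iff hq0, eLpNorm_pow_natCast hq0]
  -- On the small ball `t^q ≤ s t^(2q) + 1/s`: first `s` is chosen small against the `L^(2q)` bound,
  -- then `δ` against `1/s`. Off the ball `t ≤ η ≤ 1`, so that `q ≥ 2` gives `t^q ≤ η t`, which the
  -- `L¹` bound controls.
  have hpt : ∀ x, ‖h i x‖ₑ ^ q ≤ s * ‖h i x‖ₑ ^ (2 * q)
      + (Metric.ball (0 : Plane) δ).indicator (fun _ => (s : ℝ≥0∞)⁻¹) x + η * ‖h i x‖ₑ := by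
    intro x
    by_cases hx : x ∈ Metric.ball (0 : Plane) δ
    · rw [Set.indicator_of_mem hx]
      exact (pow_le_mul_pow_add_inv hs _ _).trans le_self_add
    · have h2 := hi x (by simpa using hx)
      rw [dist_zero_left] at h2
      have h3 : ‖h i x‖ₑ ≤ η := by
        rw [← ofReal_norm, ← ENNReal.ofReal_coe_nnreal]
        exact ENNReal.ofReal_le_ofReal h2.le
      have h4 : ‖h i x‖ₑ ≤ 1 := h3.trans (by exact_mod_cast min_le_right _ _)
      refine le_trans ?_ le_add_self
      calc ‖h i x‖ₑ ^ q ≤ ‖h i x‖ₑ ^ 2 := pow_le_pow_of_le_one zero_le h4 hq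
        _ ≤ η * ‖h i x‖ₑ := by
          rw [pow_two]
          gcongr
  calc ∫⁻ x, ‖h i x‖ₑ ^ q ≤ ∫⁻ x, (s * ‖h i x‖ₑ ^ (2 * q)
        + (Metric.ball (0 : Plane) δ).indicator (fun _ => (s : ℝ≥0∞)⁻¹) x + η * ‖h i x‖ₑ) :=
        lintegral_mono hpt
    _ = s * eLpNorm (h i) (2 * q : ℕ) volume ^ (2 * q)
        + (s : ℝ≥0∞)⁻¹ * volume (Metric.ball (0 : Plane) δ) + η * eLpNorm (h i) 1 volume := by
      rw [lintegral_add_right _ ((hm i).enorm.const_mul _), lintegral_add_right _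
        (measurable_const.indicator measurableSet_ball), lintegral_const_mul _ ((hm i).enorm.pow_const _),
        lintegral_const_mul _ (hm i).enorm, lintegral_indicator_const measurableSet_ball,
        eLpNorm_pow_natCast (by omega), eLpNorm_one_eq_lintegral_enorm]
    _ ≤ τ + τ + τ := by
      refine add_le_add (add_le_add ?_ ?_) ?_
      · refine le_trans ?_ hs'.le
        gcongr
      · refine le_trans ?_ hδ''.le
        have h5 : (δ : ℝ≥0∞) ^ 2 ≤ δ' :=
          (pow_le_of_le_one zero_le (by exact_mod_cast min_le_right _ _) two_ne_zero).trans
            (by exact_mod_cast min_le_left _ _)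
        rw [EuclideanSpace.volume_ball_fin_two, ENNReal.ofReal_coe_nnreal, mul_left_comm]
        gcongr
        simp
      · refine le_trans ?_ hη''.le
        gcongr
        · exact min_le_left _ _
        · simpa using hi₁
    _ = ε ^ q := by
      rw [hτ, ENNReal.add_thirds]

/-- `F i - f i` tends to zero in every `L^q`, `2 ≤ q`, with `f i` bounded in `L^q`. -/
def TendstoInLp {β : Type*} [MeasurableSpace β] (μ : Measure β) (l : Filter α)
    (F f : α → β → ℝ) : Prop :=
  ∀ q : ℕ, 2 ≤ q → (∀ i, MemLp (F i) q μ) ∧ (∀ i, MemLp (f i) q μ) ∧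
    (∃ C : ℝ≥0∞, C ≠ ⊤ ∧ ∀ i, eLpNorm (f i) q μ ≤ C) ∧
    Tendsto (fun i => eLpNorm (F i - f i) q μ) l (𝓝 0)

variable {β : Type*} [MeasurableSpace β] {μ : Measure β} {F f G g : α → β → ℝ}

theorem eLpNorm_mul_le_two_mul {u v : β → ℝ} (q : ℕ) (hu : AEStronglyMeasurable u μ)
    (hv : AEStronglyMeasurable v μ) :
    eLpNorm (u * v) q μ ≤ eLpNorm u (2 * q : ℕ) μ * eLpNorm v (2 * q : ℕ) μ := by
  have : ENNReal.HolderTriple (2 * q : ℕ) (2 * q : ℕ) q := ⟨by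
    push_cast
    rw [ENNReal.mul_inv (by simp) (by simp), ← add_mul, ENNReal.inv_two_add_inv_two, one_mul]⟩
  simpa [smul_eq_mul] using eLpNorm_smul_le_mul_eLpNorm (p := (2 * q : ℕ)) (q := (2 * q : ℕ))
    (r := (q : ℝ≥0∞)) hv hu

theorem memLp_mul_two_mul {u v : β → ℝ} (q : ℕ) (hu : MemLp u (2 * q : ℕ) μ)
    (hv : MemLp v (2 * q : ℕ) μ) : MemLp (u * v) q μ :=
  ⟨hu.1.mul hv.1, (eLpNorm_mul_le_two_mul q hu.1 hv.1).trans_lt (ENNReal.mul_lt_top hu.2 hv.2)⟩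

/-- Cauchy–Schwarz with exponent `2q` on each term of `F G - f g = (F - f)(G - g) + f (G - g) + (F -
f) g`. Products reach `q = 1`, which the factors need not; this is what integrals over the whole
plane use. -/
theorem TendstoInLp.mul_aux (hF : TendstoInLp μ l F f) (hG : TendstoInLp μ l G g) {q : ℕ}
    (hq : 1 ≤ q) : (∀ i, MemLp (F i * G i) q μ) ∧ (∀ i, MemLp (f i * g i) q μ) ∧
    (∃ C : ℝ≥0∞, C ≠ ⊤ ∧ ∀ i, eLpNorm (f i * g i) q μ ≤ C) ∧
    Tendsto (fun i => eLpNorm (F i * G i - f i * g i) q μ) l (𝓝 0) := by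
  obtain ⟨hF1, hf1, ⟨C, hC, hfC⟩, hFf⟩ := hF (2 * q) (by omega)
  obtain ⟨hG1, hg1, ⟨D, hD, hgD⟩, hGg⟩ := hG (2 * q) (by omega)
  refine ⟨fun i => memLp_mul_two_mul q (hF1 i) (hG1 i), fun i => memLp_mul_two_mul q (hf1 i) (hg1 i),
    ⟨C * D, ENNReal.mul_ne_top hC hD, fun i => ?_⟩, ?_⟩
  · refine (eLpNorm_mul_le_two_mul q (hf1 i).1 (hg1 i).1).trans ?_
    gcongr
    · exact hfC i
    · exact hgD i
  · have hlim : Tendsto (fun i => eLpNorm (F i - f i) (2 * q : ℕ) μ * eLpNorm (G i - g i) (2 * q : ℕ) μ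
        + C * eLpNorm (G i - g i) (2 * q : ℕ) μ + eLpNorm (F i - f i) (2 * q : ℕ) μ * D) l (𝓝 0) := by
      have h1 := (ENNReal.Tendsto.mul hFf (Or.inr ENNReal.zero_ne_top) hGg
        (Or.inr ENNReal.zero_ne_top))
      have h2 := ENNReal.Tendsto.const_mul hGg (Or.inr hC)
      have h3 := ENNReal.Tendsto.mul_const hFf (Or.inr hD)
      simpa using (h1.add h2).add h3
    refine tendsto_of_tendsto_of_tendsto_of_le_of_le tendsto_const_nhds hlim (fun _ => zero_le)
      fun i => ?_
    have e : F i * G i - f i * g i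
        = (F i - f i) * (G i - g i) + f i * (G i - g i) + (F i - f i) * g i := by ring
    have m1 := ((hF1 i).sub (hf1 i)).1
    have m2 := ((hG1 i).sub (hg1 i)).1
    have hq' : (1 : ℝ≥0∞) ≤ q := by exact_mod_cast hq
    dsimp only
    rw [e]
    refine (eLpNorm_add_le ((m1.mul m2).add ((hf1 i).1.mul m2)) (m1.mul (hg1 i).1) hq').trans ?_
    refine add_le_add ((eLpNorm_add_le (m1.mul m2) ((hf1 i).1.mul m2) hq').trans
      (add_le_add (eLpNorm_mul_le_two_mul q m1 m2) ?_)) ?_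
    · refine (eLpNorm_mul_le_two_mul q (hf1 i).1 m2).trans ?_
      gcongr
      exact hfC i
    · refine (eLpNorm_mul_le_two_mul q m1 (hg1 i).1).trans ?_
      gcongr
      exact hgD i

theorem TendstoInLp.mul (hF : TendstoInLp μ l F f) (hG : TendstoInLp μ l G g) :
    TendstoInLp μ l (fun i => F i * G i) (fun i => f i * g i) :=
  fun q hq => hF.mul_aux hG (by omega)

theorem TendstoInLp.prod {κ : Type*} {F f : κ → α → β → ℝ} {s : Finset κ} (hs : s.Nonempty)
    (h : ∀ j ∈ s, TendstoInLp μ l (F j) (f j)) :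
    TendstoInLp μ l (fun i => ∏ j ∈ s, F j i) (fun i => ∏ j ∈ s, f j i) := by
  classical
  induction hs using Finset.Nonempty.cons_induction with
  | singleton a => simpa using h a (by simp)
  | cons a s ha hs ih =>
    simp only [Finset.prod_cons]
    exact (h a (by simp)).mul (ih fun j hj => h j (by simp [hj]))

/-- On a finite measure space, uniform convergence of bounded functions to a bounded function
implies convergence in every `L^q`. -/
theorem TendstoInLp.of_tendstoUniformly [IsFiniteMeasure μ] (hFm : ∀ i, Measurable (F i))
    (hFb : ∀ i, ∃ C, ∀ y, |F i y| ≤ C) {f : β → ℝ} (hfm : Measurable f) (hfb : ∃ C, ∀ y, |f y| ≤ C)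
    (h : TendstoUniformly F f l) : TendstoInLp μ l F (fun _ => f) := by
  have hmem : ∀ u : β → ℝ, Measurable u → (∃ C, ∀ y, |u y| ≤ C) → ∀ q : ℕ, MemLp u q μ := by
    rintro u hu ⟨C, hC⟩ q
    exact MemLp.of_bound hu.aestronglyMeasurable C (ae_of_all _ hC)
  refine fun q hq => ⟨fun i => hmem _ (hFm i) (hFb i) q, fun _ => hmem _ hfm hfb q,
    ⟨eLpNorm f q μ, (hmem _ hfm hfb q).2.ne, fun _ => le_rfl⟩, ?_⟩
  rw [ENNReal.tendsto_nhds_zero]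
  intro ε hε
  set A : ℝ≥0∞ := μ Set.univ ^ (q : ℝ≥0∞).toReal⁻¹ with hA
  have hA' : A ≠ ⊤ := ENNReal.rpow_ne_top_of_nonneg (inv_nonneg.2 ENNReal.toReal_nonneg)
    (measure_ne_top _ _)
  obtain ⟨s, hs, hs'⟩ := ENNReal.exists_nnreal_pos_mul_lt hA' hε.ne'
  filter_upwards [Metric.tendstoUniformly_iff.1 h s (by exact_mod_cast hs)] with i hi
  refine (eLpNorm_le_of_ae_bound (C := s) (ae_of_all _ fun y => ?_)).trans ?_
  · have := hi y
    rw [dist_comm, Real.dist_eq] at this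
    exact this.le
  · rw [ENNReal.ofReal_coe_nnreal, mul_comm]
    exact hs'.le

theorem TendstoInLp.tendsto_integral [IsFiniteMeasure μ] {f : β → ℝ}
    (h : TendstoInLp μ l F fun _ => f) :
    (∀ i, Integrable (F i) μ) ∧ Tendsto (fun i => ∫ y, F i y ∂μ) l (𝓝 (∫ y, f y ∂μ)) := by
  obtain ⟨hF, hf, -, ht⟩ := h 2 le_rfl
  have hFi : ∀ i, Integrable (F i) μ := fun i => (hF i).integrable (by norm_num)
  rcases isEmpty_or_nonempty α with hα | ⟨⟨i₀⟩⟩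
  · exact ⟨hFi, by rw [Filter.filter_eq_bot_of_isEmpty l]; exact tendsto_bot⟩
  refine ⟨hFi, tendsto_integral_of_L1' f (hf i₀).1 (Eventually.of_forall hFi) ?_⟩
  set A : ℝ≥0∞ := μ Set.univ ^ (1 / (1 : ℝ≥0∞).toReal - 1 / ((2 : ℕ) : ℝ≥0∞).toReal) with hA
  have hA' : A ≠ ⊤ := by
    rw [hA]
    exact ENNReal.rpow_ne_top_of_nonneg (by norm_num) (measure_ne_top _ _)
  have hlim := ENNReal.Tendsto.mul_const ht (Or.inr hA')
  rw [zero_mul] at hlim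
  refine tendsto_of_tendsto_of_tendsto_of_le_of_le tendsto_const_nhds hlim (fun _ => zero_le)
    fun i => eLpNorm_le_eLpNorm_mul_rpow_measure_univ (by norm_num) ((hF i).1.sub (hf i).1)

end LpConvergence

/-! ### Smeared Green's functions and integrals of their products -/

section GreenApproximation

open scoped ENNReal NNReal

variable {α : Type*} {l : Filter α} {m : ℝ}

/-- Approximations of the Green's function which are bounded in every `L^q` and converge uniformly
away from the origin. -/
structure ApproximatesGreen (m : ℝ) (l : Filter α) (f : α → Plane → ℝ) : Prop where
  measurable : ∀ i, Measurable (f i)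
  memLp : ∀ q : ℕ, q ≠ 0 → ∀ i, MemLp (f i) q
  norm_bounded : ∀ q : ℕ, q ≠ 0 → ∃ C : ℝ≥0∞, C ≠ ⊤ ∧ ∀ᶠ i in l, eLpNorm (f i) q volume ≤ C
  tendstoUniformlyOn : ∀ δ > 0,
    TendstoUniformlyOn f (massiveGreen m) l {x : Plane | δ ≤ ‖x‖}

theorem approximatesGreen_const (hm : 0 < m) :
    ApproximatesGreen m l fun _ : α => massiveGreen m where
  measurable _ := measurable_massiveGreen m
  memLp _ hq _ := memLp_massiveGreen hm hq
  norm_bounded _ hq := ⟨_, (memLp_massiveGreen hm hq).2.ne, Eventually.of_forall fun _ => le_rfl⟩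
  tendstoUniformlyOn _ _ := Metric.tendstoUniformlyOn_iff.2 fun ε hε =>
    Eventually.of_forall fun _ _ _ => by simpa using hε

theorem ApproximatesGreen.comp_neg {f : α → Plane → ℝ} (h : ApproximatesGreen m l f) :
    ApproximatesGreen m l fun i x => f i (-x) where
  measurable i := (h.measurable i).comp measurable_neg
  memLp q hq i := (h.memLp q hq i).comp_measurePreserving (Measure.measurePreserving_neg volume)
  norm_bounded q hq := by
    obtain ⟨C, hC, hb⟩ := h.norm_bounded q hq
    refine ⟨C, hC, hb.mono fun i hi => ?_⟩
    have := eLpNorm_comp_measurePreserving (p := q) (h.measurable i).aestronglyMeasurable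
      (Measure.measurePreserving_neg (volume : Measure Plane))
    exact this.trans_le hi
  tendstoUniformlyOn δ hδ := by
    rw [Metric.tendstoUniformlyOn_iff]
    intro ε hε
    filter_upwards [Metric.tendstoUniformlyOn_iff.1 (h.tendstoUniformlyOn δ hδ) ε hε] with i hi x hx
    have := hi (-x) (by simpa using hx)
    rwa [massiveGreen_neg] at this

theorem ApproximatesGreen.integrable {f : α → Plane → ℝ} (h : ApproximatesGreen m l f) (i : α) :
    Integrable (f i) := by
  simpa using memLp_one_iff_integrable.1 (by simpa using h.memLp 1 one_ne_zero i)

theorem ApproximatesGreen.smear (hm : 0 < m) {f χ : α → Plane → ℝ} (h : ApproximatesGreen m l f)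
    (hχ : IsApproximateIdentity l χ) : ApproximatesGreen m l fun i => smear (χ i) (f i) where
  measurable i := measurable_smear (hχ.measurable i) (h.measurable i)
  memLp q hq i := by
    refine ⟨(measurable_smear (hχ.measurable i) (h.measurable i)).aestronglyMeasurable,
      (eLpNorm_smear_le (hχ.measurable i) (h.measurable i) hq).trans_lt
        (ENNReal.mul_lt_top ?_ (h.memLp q hq i).2)⟩
    exact (memLp_one_iff_integrable.2 (hχ.integrable i)).2
  norm_bounded q hq := by
    obtain ⟨C, hC, hb⟩ := h.norm_bounded q hq
    obtain ⟨A, hA⟩ := hχ.norm_bounded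
    refine ⟨ENNReal.ofReal A * C, ENNReal.mul_ne_top ENNReal.ofReal_ne_top hC, ?_⟩
    filter_upwards [hb, hA] with i hi hAi
    refine (eLpNorm_smear_le (hχ.measurable i) (h.measurable i) hq).trans ?_
    gcongr
    rw [eLpNorm_one_eq_lintegral_enorm, ← ofReal_integral_norm_eq_lintegral_enorm (hχ.integrable i)]
    exact ENNReal.ofReal_le_ofReal hAi
  tendstoUniformlyOn δ hδ := by
    refine hχ.tendstoUniformlyOn_smear h.integrable ?_ h.tendstoUniformlyOn
      (fun δ hδ => ?_) (fun δ hδ => exists_abs_massiveGreen_sub_le hm hδ) hδ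
    · obtain ⟨C, hC, hb⟩ := h.norm_bounded 1 one_ne_zero
      refine ⟨C.toReal, hb.mono fun i hi => ?_⟩
      rw [Nat.cast_one, eLpNorm_one_eq_lintegral_enorm,
        ← ofReal_integral_norm_eq_lintegral_enorm (h.integrable i)] at hi
      exact (ENNReal.ofReal_le_iff_le_toReal hC).1 hi
    · obtain ⟨C, -, hC⟩ := exists_massiveGreen_le_of_le_norm hm hδ
      exact ⟨C, hC⟩

/-- The difference from the Green's function is bounded in every `L^q` and tends to zero uniformly
off the origin, as `tendsto_eLpNorm_zero` requires. -/
theorem ApproximatesGreen.tendstoInLp (hm : 0 < m) {f : α → Plane → ℝ}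
    (h : ApproximatesGreen m l f) : TendstoInLp volume l f fun _ => massiveGreen m := by
  refine fun q hq => ⟨h.memLp q (by omega), fun _ => memLp_massiveGreen hm (by omega),
    ⟨_, (memLp_massiveGreen hm (by omega)).2.ne, fun _ => le_rfl⟩, ?_⟩
  refine tendsto_eLpNorm_zero (fun i => (h.measurable i).sub (measurable_massiveGreen m))
    (fun q hq => ?_) (fun δ hδ => ?_) hq
  · obtain ⟨C, hC, hb⟩ := h.norm_bounded q hq
    refine ⟨C + eLpNorm (massiveGreen m) q volume,
      ENNReal.add_ne_top.2 ⟨hC, (memLp_massiveGreen hm hq).2.ne⟩, hb.mono fun i hi => ?_⟩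
    refine (eLpNorm_sub_le (h.measurable i).aestronglyMeasurable
      (measurable_massiveGreen m).aestronglyMeasurable
      (by exact_mod_cast Nat.one_le_iff_ne_zero.2 hq)).trans ?_
    gcongr
  · rw [Metric.tendstoUniformlyOn_iff]
    intro ε hε
    filter_upwards [Metric.tendstoUniformlyOn_iff.1 (h.tendstoUniformlyOn δ hδ) ε hε] with i hi x hx
    have := hi x hx
    rw [Real.dist_eq] at this
    simpa [Real.dist_eq] using this

theorem integral_smear {χ f : Plane → ℝ} (hχ : Integrable χ) (hf : Integrable f) :
    ∫ x, smear χ f x = (∫ x, χ x) * ∫ x, f x := by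
  have := integral_convolution (L := ContinuousLinearMap.mul ℝ ℝ) hχ hf
  simpa [convolution, smear] using this

section ProductIntegral

variable {κ : Type*} {B : Finset κ}

theorem measurable_integral_prod_sub {f : Plane → ℝ} (hf : Measurable f) (B : Finset κ) :
    Measurable fun c : κ → Plane => ∫ z, ∏ j ∈ B, f (c j - z) := by
  have h : StronglyMeasurable fun p : (κ → Plane) × Plane => ∏ j ∈ B, f (p.1 j - p.2) := by
    refine (Finset.measurable_fun_prod _ fun j _ => hf.comp ?_).stronglyMeasurable
    exact ((measurable_pi_apply j).comp measurable_fst).sub measurable_snd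
  exact (h.integral_prod_right' (ν := volume)).measurable

/-- The base points are made part of the index, with the filter `⊤`, so that convergence is uniform
in them. Translation and reflection do not change the norms. -/
theorem TendstoInLp.comp_sub_left {F : α → Plane → ℝ} {f : Plane → ℝ}
    (h : TendstoInLp volume l F fun _ => f) (j : κ) :
    TendstoInLp volume (l ×ˢ (⊤ : Filter (κ → Plane)))
      (fun i z => F i.1 (i.2 j - z)) (fun i z => f (i.2 j - z)) := by
  intro q hq
  obtain ⟨hF, hf, ⟨C, hC, hfC⟩, ht⟩ := h q hq
  have hp : ∀ i : α × (κ → Plane), MeasurePreserving (fun z => i.2 j - z) (volume : Measure Plane)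
      volume := fun i => Measure.measurePreserving_sub_left volume _
  refine ⟨fun i => (hF i.1).comp_measurePreserving (hp i),
    fun i => (hf i.1).comp_measurePreserving (hp i), ⟨C, hC, fun i => ?_⟩, ?_⟩
  · exact (eLpNorm_comp_measurePreserving (hf i.1).1 (hp i)).trans_le (hfC i.1)
  · refine (ht.comp tendsto_fst).congr fun i => ?_
    exact (eLpNorm_comp_measurePreserving ((hF i.1).sub (hf i.1)).1 (hp i)).symm

/-- One factor is split off and `mul_aux` with `q = 1` is applied to it and the nonempty rest: the
products converge in `L¹`, uniformly in the base points, even where these coincide. -/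
theorem TendstoInLp.prod_sub_left {F : α → Plane → ℝ} {f : Plane → ℝ}
    (h : TendstoInLp volume l F fun _ => f) (hB : 2 ≤ B.card) :
    (∀ _ : α, ∃ C : ℝ, ∀ c : κ → Plane, |∫ z, ∏ j ∈ B, f (c j - z)| ≤ C) ∧
    TendstoUniformly (fun i (c : κ → Plane) => ∫ z, ∏ j ∈ B, F i (c j - z))
      (fun c => ∫ z, ∏ j ∈ B, f (c j - z)) l := by
  classical
  obtain ⟨a, ha⟩ : B.Nonempty := Finset.card_pos.1 (by omega)
  have hB' : (B.erase a).Nonempty := Finset.card_pos.1 (by rw [Finset.card_erase_of_mem ha]; omega)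
  obtain ⟨h1, h2, ⟨C, hC, h3⟩, h4⟩ := (h.comp_sub_left a).mul_aux
    (TendstoInLp.prod hB' fun j _ => h.comp_sub_left j) (q := 1) le_rfl
  have e : ∀ (u : Plane → ℝ) (c : κ → Plane), (fun z => u (c a - z)) *
      ∏ j ∈ B.erase a, (fun z => u (c j - z)) = fun z => ∏ j ∈ B, u (c j - z) := by
    intro u c
    ext z
    rw [Pi.mul_apply, Finset.prod_apply, Finset.mul_prod_erase B (fun j => u (c j - z)) ha]
  simp only [e, Nat.cast_one] at h1 h2 h3 h4
  have i1 : ∀ i (c : κ → Plane), Integrable fun z => ∏ j ∈ B, F i (c j - z) := fun i c =>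
    memLp_one_iff_integrable.1 (h1 (i, c))
  have i2 : ∀ (_ : α) (c : κ → Plane), Integrable fun z => ∏ j ∈ B, f (c j - z) := fun i c =>
    memLp_one_iff_integrable.1 (h2 (i, c))
  refine ⟨fun i => ⟨C.toReal, fun c => ?_⟩, ?_⟩
  · rw [← Real.norm_eq_abs]
    refine (norm_integral_le_integral_norm _).trans ?_
    have := h3 (i, c)
    rw [eLpNorm_one_eq_lintegral_enorm, ← ofReal_integral_norm_eq_lintegral_enorm (i2 i c)] at this
    exact (ENNReal.ofReal_le_iff_le_toReal hC).1 this
  · rw [tendstoUniformly_iff_tendsto, Metric.uniformity_eq_comap_nhds_zero, tendsto_comap_iff]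
    refine squeeze_zero (fun _ => dist_nonneg) (fun i => ?_)
      ((ENNReal.tendsto_toReal ENNReal.zero_ne_top).comp h4)
    rw [Function.comp_apply, dist_comm, Real.dist_eq, ← integral_sub (i1 i.1 i.2) (i2 i.1 i.2),
      Function.comp_apply, eLpNorm_one_eq_lintegral_enorm,
      ← ofReal_integral_norm_eq_lintegral_enorm ((i1 i.1 i.2).sub (i2 i.1 i.2)),
      ENNReal.toReal_ofReal (integral_nonneg fun _ => norm_nonneg _)]
    exact norm_integral_le_integral_norm (fun z => ∏ j ∈ B, F i.1 (i.2 j - z) - ∏ j ∈ B, f (i.2 j - z))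

/-- The boundedness part of the previous result ignores the filter, so it is used along `⊥`, where
convergence is vacuous. -/
theorem exists_abs_integral_prod_sub_le {f : Plane → ℝ} (hf : ∀ q : ℕ, 2 ≤ q → MemLp f q)
    (hB : 2 ≤ B.card) : ∃ C : ℝ, ∀ c : κ → Plane, |∫ z, ∏ j ∈ B, f (c j - z)| ≤ C := by
  have : TendstoInLp volume (⊥ : Filter Unit) (fun _ => f) fun _ => f := fun q hq =>
    ⟨fun _ => hf q hq, fun _ => hf q hq, ⟨_, (hf q hq).2.ne, fun _ => le_rfl⟩, tendsto_bot⟩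
  exact (this.prod_sub_left hB).1 ()

end ProductIntegral

section Substitution

/-- Substituting `y ↦ a y - y l` in the integral over positions in `Λ`, where `a` does not depend
on the `l`-th position. -/
theorem map_sub_apply_restrict_pi_le {n : ℕ} {Λ : Set Plane} (hΛ : volume Λ ≠ ⊤) (l : Fin n)
    {a : (Fin n → Plane) → Plane} (ha : Measurable a)
    (hal : ∀ y t, a (Function.update y l t) = a y) :
    ∃ K : ℝ≥0∞, K ≠ ⊤ ∧
      (volume.restrict (Set.univ.pi fun _ : Fin n => Λ)).map (fun y => a y - y l) ≤ K • volume := by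
  obtain ⟨k, rfl⟩ : ∃ k, n = k + 1 := ⟨n - 1, by have := l.pos; omega⟩
  have hfin : IsFiniteMeasure (volume.restrict Λ) := isFiniteMeasure_restrict.2 hΛ
  set ρ : Measure Plane := volume.restrict Λ with hρ
  set R : Measure (Fin k → Plane) := Measure.pi fun _ => ρ with hR
  refine ⟨R Set.univ, measure_ne_top _ _, Measure.le_iff.2 fun A hA => ?_⟩
  have hc : Measurable fun y : Fin (k + 1) → Plane => a y - y l := ha.sub (measurable_pi_apply l)
  have hp := (measurePreserving_piFinSuccAbove (fun _ : Fin (k + 1) => ρ) l).symm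
  rw [Measure.map_apply hc hA, volume_pi, Measure.restrict_pi_pi, ← hp.map_eq,
    Measure.map_apply (MeasurableEquiv.measurable _) (hc hA),
    Measure.prod_apply_symm ((MeasurableEquiv.measurable _) (hc hA)), Measure.smul_apply,
    smul_eq_mul, mul_comm, ← lintegral_const]
  -- With all other positions frozen, `a y` is constant and `t ↦ a - t` preserves Lebesgue measure.
  -- Integrating over the frozen positions gives the factor `K`.
  refine lintegral_mono fun z => ?_
  have e : ∀ t : Plane, a (l.insertNth t z) - (l.insertNth t z : Fin (k + 1) → Plane) l
      = a (l.insertNth 0 z) - t := by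
    intro t
    rw [Fin.insertNth_apply_same, ← hal (l.insertNth (0 : Plane) z) t, Fin.update_insertNth]
  calc ρ ((fun t => (t, z)) ⁻¹' ((MeasurableEquiv.piFinSuccAbove (fun _ => Plane) l).symm ⁻¹'
        ((fun y => a y - y l) ⁻¹' A)))
      = ρ ((fun t => a (l.insertNth 0 z) - t) ⁻¹' A) := by
        congr 1
        ext t
        simp only [Set.mem_preimage]
        rw [← e t]
        rfl
    _ ≤ volume ((fun t => a (l.insertNth 0 z) - t) ⁻¹' A) := Measure.restrict_apply_le _ _
    _ = volume A :=
        (Measure.measurePreserving_sub_left (volume : Measure Plane) _).measure_preimage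
          hA.nullMeasurableSet

theorem TendstoInLp.comp_map_le {β γ : Type*} [MeasurableSpace β] [MeasurableSpace γ]
    {μ : Measure β} {ρ : Measure γ} {F : α → γ → ℝ} {f : α → γ → ℝ} (h : TendstoInLp ρ l F f)
    {c : β → γ} (hc : Measurable c) {K : ℝ≥0∞} (hK : K ≠ ⊤) (hle : μ.map c ≤ K • ρ) :
    TendstoInLp μ l (fun i y => F i (c y)) fun i y => f i (c y) := by
  intro q hq
  obtain ⟨hF, hf, ⟨C, hC, hfC⟩, ht⟩ := h q hq
  have hmem : ∀ u : γ → ℝ, MemLp u q ρ → MemLp u q (μ.map c) := fun u hu =>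
    hu.of_measure_le_smul hK hle
  have hle' : ∀ u : γ → ℝ, MemLp u q ρ → eLpNorm (fun y => u (c y)) q μ
      ≤ K ^ (1 / (q : ℝ≥0∞)).toReal * eLpNorm u q ρ := by
    intro u hu
    have e := eLpNorm_map_measure (p := q) (hmem u hu).1 hc.aemeasurable
    refine (e.symm.trans_le (eLpNorm_mono_measure _ hle)).trans ?_
    rw [eLpNorm_smul_measure_of_ne_top (ENNReal.natCast_ne_top q), smul_eq_mul]
  have hK' : K ^ (1 / (q : ℝ≥0∞)).toReal ≠ ⊤ := ENNReal.rpow_ne_top_of_nonneg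
    ENNReal.toReal_nonneg hK
  refine ⟨fun i => (hmem (F i) (hF i)).comp_of_map hc.aemeasurable,
    fun i => (hmem (f i) (hf i)).comp_of_map hc.aemeasurable,
    ⟨_, ENNReal.mul_ne_top hK' hC, fun i => (hle' (f i) (hf i)).trans ?_⟩, ?_⟩
  · gcongr
    exact hfC i
  · have hlim := ENNReal.Tendsto.const_mul ht (Or.inr hK')
    rw [mul_zero] at hlim
    exact tendsto_of_tendsto_of_tendsto_of_le_of_le tendsto_const_nhds hlim (fun _ => zero_le)
      fun i => hle' (F i - f i) ((hF i).sub (hf i))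

end Substitution

end GreenApproximation

/-! ### Truncated moments of the regularized field -/

section RegularizedField

variable {Ω : Type*} [MeasurableSpace Ω] {P : Measure Ω} {ψ : ℝ → ℂ} {m₀ : ℝ}
  {η ηg φ : Ω → RealDistribution}

theorem measurable_eval_field (x : Plane) : Measurable fun f : C(Plane, ℝ) => f x :=
  (measurable_pi_apply x).comp (comap_measurable (fun f : C(Plane, ℝ) => (f : Plane → ℝ)))

theorem measurable_convolve (χ : 𝓢(Plane, ℝ)) : Measurable (convolve χ) := by
  rw [measurable_comap_iff, measurable_pi_iff]
  exact fun x => measurable_eval_distribution (reflectTranslate χ x)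

theorem moment_empty {ι : Type*} (ν : Measure C(Plane, ℝ)) [IsProbabilityMeasure ν]
    (c : ι → Plane) : moment ν c ∅ = 1 := by
  simp [_root_.moment]

theorem moment_map {ι κ : Type*} (ν : Measure C(Plane, ℝ)) (c : ι → Plane) (e : κ ↪ ι)
    (J : Finset κ) : moment ν c (J.map e) = moment ν (fun k => c (e k)) J := by
  simp [_root_.moment]

/-- The regularized two-point function of the gradient noise, up to its strength. -/
def smearedCovariance (m : ℝ) (χ : Plane → ℝ) : Plane → ℝ :=
  smear χ fun x => smear χ (massiveGreen m) (-x)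

theorem integral_smear_mul (m : ℝ) (χ : Plane → ℝ) (x y : Plane) :
    ∫ z, smear χ (massiveGreen m) (x - z) * χ (y - z) = smearedCovariance m χ (y - x) := by
  rw [smearedCovariance, smear, ← integral_sub_left_eq_self _ volume y]
  refine integral_congr_ae (ae_of_all _ fun z => ?_)
  dsimp only
  rw [mul_comm, sub_sub_cancel]
  congr 2
  abel

namespace IsMassiveLevyField

variable (h : IsMassiveLevyField P ψ m₀ η ηg φ) (χ : 𝓢(Plane, ℝ))
include h

theorem measurable_convolve_field : Measurable fun w => convolve χ (φ w) :=
  (measurable_convolve χ).comp h.measurable_field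

theorem uvRegularize_eq :
    uvRegularize (P.map φ) χ = P.map fun w => convolve χ (φ w) :=
  Measure.map_map (measurable_convolve χ) h.measurable_field

/-- The regularized field at `x` is `φ` tested with `χ(x - ·)`; this identifies the associated
potential, using that the Green's function is even. -/
theorem exists_solution_reflectTranslate (x : Plane) :
    ∃ u : 𝓢(Plane, ℝ), -(Δ u) + m₀ ^ 2 • u = reflectTranslate χ x ∧
      ∀ z, u z = smear χ (massiveGreen m₀) (x - z) := by
  obtain ⟨u, hu, hu'⟩ := exists_massive_solution h.pos (reflectTranslate χ x)
  refine ⟨u, hu, fun z => ?_⟩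
  rw [hu', smear, ← integral_sub_left_eq_self _ volume x]
  refine integral_congr_ae (ae_of_all _ fun v => ?_)
  dsimp only
  rw [reflectTranslate_apply, sub_sub_cancel, mul_comm, ← massiveGreen_neg]
  congr 2
  abel

variable [IsProbabilityMeasure P]

theorem isProbabilityMeasure_uvRegularize :
    IsProbabilityMeasure (uvRegularize (P.map φ) χ) := by
  rw [h.uvRegularize_eq]
  exact Measure.isProbabilityMeasure_map (h.measurable_convolve_field χ).aemeasurable

theorem memLp_eval_field (x : Plane) (k : ℕ) :
    MemLp (fun f : C(Plane, ℝ) => f x) k (uvRegularize (P.map φ) χ) := by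
  obtain ⟨u, hu, -⟩ := h.exists_solution_reflectTranslate χ x
  rw [h.uvRegularize_eq, memLp_map_measure_iff (measurable_eval_field x).aestronglyMeasurable
    (h.measurable_convolve_field χ).aemeasurable]
  exact h.memLp hu k

variable {ι : Type*}

omit [IsProbabilityMeasure P] in
theorem moment_eq (c : ι → Plane) (J : Finset ι) :
    moment (uvRegularize (P.map φ) χ) c J = ∫ w, ∏ j ∈ J, φ w (reflectTranslate χ (c j)) ∂P := by
  rw [_root_.moment, h.uvRegularize_eq, integral_map (h.measurable_convolve_field χ).aemeasurable]
  · rfl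
  · exact (Finset.measurable_fun_prod _ fun j _ => measurable_eval_field (c j)).aestronglyMeasurable

variable [Fintype ι] [DecidableEq ι]

theorem truncated_moment (c : ι → Plane) {B : Finset ι} (hB : B.Nonempty) (hB2 : B.card ≠ 2) :
    truncated (moment (uvRegularize (P.map φ) χ) c) B
      = levyCumulant ψ B.card * ∫ z, ∏ j ∈ B, smear χ (massiveGreen m₀) (c j - z) := by
  choose u hu hu' using fun j => h.exists_solution_reflectTranslate χ (c j)
  rw [show moment (uvRegularize (P.map φ) χ) c = _ from funext fun J => h.moment_eq χ c J,
    h.truncated_eq hu hB hB2]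
  simp only [hu']

theorem truncated_moment_pair (c : ι → Plane) {a b : ι} (hab : a ≠ b) :
    truncated (moment (uvRegularize (P.map φ) χ) c) {a, b}
      = levyCumulant ψ 2 / m₀ ^ 2 * smearedCovariance m₀ χ (c b - c a) := by
  choose u hu hu' using fun j => h.exists_solution_reflectTranslate χ (c j)
  rw [show moment (uvRegularize (P.map φ) χ) c = _ from funext fun J => h.moment_eq χ c J,
    h.truncated_pair_eq hu hab, ← integral_smear_mul]
  simp only [hu', reflectTranslate_apply]

theorem truncated_moment_singleton (c : ι → Plane) (a : ι) :
    truncated (moment (uvRegularize (P.map φ) χ) c) {a}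
      = levyCumulant ψ 1 * ((∫ z, χ z) * ∫ z, massiveGreen m₀ z) := by
  rw [h.truncated_moment χ c ⟨a, by simp⟩ (by simp)]
  simp only [Finset.card_singleton, Finset.prod_singleton]
  rw [integral_sub_left_eq_self (fun z => smear χ (massiveGreen m₀) z) volume,
    integral_smear χ.integrable (integrable_massiveGreen h.pos)]

end IsMassiveLevyField

end RegularizedField

/-! ### Convergence of Feynman graphs -/

section GraphConvergence

theorem tendstoInLp_of_tendsto {α β : Type*} [MeasurableSpace β] {μ : Measure β} [IsFiniteMeasure μ]
    {l : Filter α} {r : α → ℝ} {r₀ : ℝ} (h : Tendsto r l (𝓝 r₀)) :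
    TendstoInLp μ l (fun i _ => r i) fun _ _ => r₀ := by
  refine TendstoInLp.of_tendstoUniformly (fun i => measurable_const) (fun i => ⟨_, fun _ => le_rfl⟩)
    measurable_const ⟨_, fun _ => le_rfl⟩ ?_
  rw [Metric.tendstoUniformly_iff]
  intro ε hε
  filter_upwards [Metric.tendsto_nhds.1 h ε hε] with i hi y
  rwa [dist_comm]

variable {n m : ℕ} {p : Fin m → ℕ}

theorem measurable_legPoint (x : Fin n → Plane) (e : Leg n p) :
    Measurable fun y : Fin m → Plane => legPoint x y e := by
  rcases e with i | ⟨l, k⟩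
  · exact measurable_const
  · exact measurable_pi_apply l

theorem legPoint_update (x : Fin n → Plane) (y : Fin m → Plane) {l : Fin m} {e : Leg n p}
    (he : ¬ ∃ k : Fin (p l), e = Sum.inr ⟨l, k⟩) (t : Plane) :
    legPoint x (Function.update y l t) e = legPoint x y e := by
  rcases e with i | ⟨l', k⟩
  · rfl
  · have hl : l' ≠ l := by
      rintro rfl
      exact he ⟨k, rfl⟩
    simp [legPoint, Function.update_of_ne hl]

variable {Ω : Type*} [MeasurableSpace Ω] {P : Measure Ω} {ψ : ℝ → ℂ}
  {m₀ : ℝ} {η ηg φ : Ω → RealDistribution} {χ : ℝ → 𝓢(Plane, ℝ)} {Λ : Set Plane}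

theorem isFiniteMeasure_restrict_pi (hΛ : volume Λ ≠ ⊤) :
    IsFiniteMeasure (volume.restrict (Set.univ.pi fun _ : Fin m => Λ)) := by
  refine isFiniteMeasure_restrict.2 ?_
  rw [volume_pi_pi]
  exact ENNReal.prod_ne_top fun _ _ => hΛ

namespace IsMassiveLevyField

/-- The class `ApproximatesGreen` is stable under smearing and reflection, so the twice smeared
covariance needs no separate estimate. -/
theorem approximatesGreen_smearedCovariance (h : IsMassiveLevyField P ψ m₀ η ηg φ)
    (hχ : IsDiracApproximation χ) :
    ApproximatesGreen m₀ (𝓝[>] (0 : ℝ)) fun ε => smearedCovariance m₀ (χ ε) :=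
  ((approximatesGreen_const h.pos).smear h.pos hχ.isApproximateIdentity).comp_neg.smear h.pos
    hχ.isApproximateIdentity

variable [IsProbabilityMeasure P]

/-- The point of `e` does not depend on `y l`, so the difference of the two points has bounded
density under Lebesgue measure on `Λ^m`. This carries `L^q` convergence from the plane to `Λ^m`. -/
theorem tendstoInLp_truncated_pair (h : IsMassiveLevyField P ψ m₀ η ηg φ)
    (hχ : IsDiracApproximation χ) (hΛ : volume Λ ≠ ⊤) (x : Fin n → Plane) {l : Fin m}
    (k : Fin (p l)) {e : Leg n p} (he : ¬ ∃ k : Fin (p l), e = Sum.inr ⟨l, k⟩) :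
    ∃ f, TendstoInLp (volume.restrict (Set.univ.pi fun _ : Fin m => Λ)) (𝓝[>] (0 : ℝ))
      (fun ε y => truncated (moment (uvRegularize (P.map φ) (χ ε)) (legPoint x y))
        {(Sum.inr ⟨l, k⟩ : Leg n p), e}) fun _ => f := by
  have hfin := isFiniteMeasure_restrict_pi (m := m) hΛ
  have hne : (Sum.inr ⟨l, k⟩ : Leg n p) ≠ e := fun h => he ⟨k, h.symm⟩
  obtain ⟨K, hK, hle⟩ := map_sub_apply_restrict_pi_le hΛ l (measurable_legPoint (p := p) x e)
    fun y t => legPoint_update x y he t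
  have h1 := ((h.approximatesGreen_smearedCovariance hχ).tendstoInLp h.pos).comp_map_le
    ((measurable_legPoint (p := p) x e).sub (measurable_pi_apply l)) hK hle
  have h2 := (tendstoInLp_of_tendsto (μ := volume.restrict (Set.univ.pi fun _ : Fin m => Λ))
    (tendsto_const_nhds (x := levyCumulant ψ 2 / m₀ ^ 2) (f := 𝓝[>] (0 : ℝ)))).mul h1
  simp only [h.truncated_moment_pair _ _ hne]
  exact ⟨_, h2⟩

/-- One leg gives a convergent constant. For two outer legs, injectivity of `x` keeps the argument
of the kernel away from the singularity; for a pair with an inner leg, `hself` puts the other leg at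
a different vertex. From three legs on, convergence is uniform. -/
theorem tendstoInLp_truncated (h : IsMassiveLevyField P ψ m₀ η ηg φ)
    (hχ : IsDiracApproximation χ) (hΛ : volume Λ ≠ ⊤) {x : Fin n → Plane}
    (hx : Function.Injective x) {B : Finset (Leg n p)} (hB : B.Nonempty)
    (hself : ∀ l : Fin m, ¬ ∀ e ∈ B, ∃ k : Fin (p l), e = Sum.inr ⟨l, k⟩) :
    ∃ f, TendstoInLp (volume.restrict (Set.univ.pi fun _ : Fin m => Λ)) (𝓝[>] (0 : ℝ))
      (fun ε y => truncated (moment (uvRegularize (P.map φ) (χ ε)) (legPoint x y)) B)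
      fun _ => f := by
  have hfin := isFiniteMeasure_restrict_pi (m := m) hΛ
  have hA := hχ.isApproximateIdentity
  have hB0 := hB.card_pos
  rcases (by omega : B.card = 1 ∨ B.card = 2 ∨ 3 ≤ B.card) with h1 | h2 | h3
  · obtain ⟨a, rfl⟩ := Finset.card_eq_one.1 h1
    simp only [h.truncated_moment_singleton]
    exact ⟨_, tendstoInLp_of_tendsto ((hA.tendsto_one.mul_const _).const_mul _)⟩
  · obtain ⟨a, b, hab, rfl⟩ := Finset.card_eq_two.1 h2
    rcases a with i | ⟨l, k⟩
    · rcases b with j | ⟨l, k⟩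
      · simp only [h.truncated_moment_pair _ _ hab]
        have hij : x j - x i ≠ 0 := sub_ne_zero.2 fun e => hab (by rw [hx e])
        exact ⟨_, tendstoInLp_of_tendsto
          ((((h.approximatesGreen_smearedCovariance hχ).tendstoUniformlyOn _
            (norm_pos_iff.2 hij)).tendsto_at (x := x j - x i)
              (show ‖x j - x i‖ ≤ ‖x j - x i‖ from le_rfl)).const_mul _)⟩
      · rw [Finset.pair_comm]
        exact h.tendstoInLp_truncated_pair hχ hΛ x k (by simp)
    · refine h.tendstoInLp_truncated_pair hχ hΛ x k fun hb => hself l ?_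
      simpa using hb
  · have hk := (((approximatesGreen_const h.pos).smear h.pos hA).tendstoInLp h.pos)
    obtain ⟨hb, hu⟩ := hk.prod_sub_left (B := B) (by omega)
    have hpt : Measurable fun y : Fin m → Plane => (legPoint x y : Leg n p → Plane) :=
      measurable_pi_iff.2 fun e => measurable_legPoint x e
    have h4 : TendstoInLp (volume.restrict (Set.univ.pi fun _ : Fin m => Λ)) (𝓝[>] (0 : ℝ))
        (fun ε y => ∫ z, ∏ e ∈ B, smear (χ ε) (massiveGreen m₀) (legPoint x y e - z))
        fun _ y => ∫ z, ∏ e ∈ B, massiveGreen m₀ (legPoint x y e - z) := by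
      refine TendstoInLp.of_tendstoUniformly (fun ε => ?_) (fun ε => ?_) ?_ ?_
        (hu.comp fun y : Fin m → Plane => legPoint x y)
      · exact (measurable_integral_prod_sub
          (measurable_smear (measurable_schwartz _) (measurable_massiveGreen m₀)) B).comp hpt
      · obtain ⟨C, hC⟩ := exists_abs_integral_prod_sub_le (fun q hq => (hk q hq).1 ε) (B := B)
          (by omega)
        exact ⟨C, fun y => hC _⟩
      · exact (measurable_integral_prod_sub (measurable_massiveGreen m₀) B).comp hpt
      -- The bound concerns the limit kernel; the index `1` is arbitrary.
      · obtain ⟨C, hC⟩ := hb 1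
        exact ⟨C, fun y => hC _⟩
    simp only [h.truncated_moment _ _ hB (by omega : B.card ≠ 2)]
    exact ⟨_, (tendstoInLp_of_tendsto (tendsto_const_nhds (x := levyCumulant ψ B.card))).mul h4⟩

theorem graphValue_converges (h : IsMassiveLevyField P ψ m₀ η ηg φ)
    (hχ : IsDiracApproximation χ) (hΛ : volume Λ ≠ ⊤) (lam : ℕ → ℝ) {x : Fin n → Plane}
    (hx : Function.Injective x) {G : FeynmanGraph n p} (hG : G.NoSelfContraction) :
    (∀ ε, IntegrableOn (graphIntegrand (uvRegularize (P.map φ) (χ ε)) x G)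
      (Set.univ.pi fun _ : Fin m => Λ)) ∧
    ∃ a : ℝ, Tendsto (fun ε => graphValue (uvRegularize (P.map φ) (χ ε)) lam Λ x G)
      (𝓝[>] 0) (𝓝 a) := by
  have hfin := isFiniteMeasure_restrict_pi (m := m) hΛ
  choose f hf using fun B : {B // B ∈ G.parts} =>
    h.tendstoInLp_truncated hχ hΛ hx (G.nonempty_of_mem_parts B.2) (hG B.1 B.2)
  have key : TendstoInLp (volume.restrict (Set.univ.pi fun _ : Fin m => Λ)) (𝓝[>] (0 : ℝ))
      (fun ε => graphIntegrand (uvRegularize (P.map φ) (χ ε)) x G)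
      fun _ => ∏ B ∈ G.parts.attach, f B := by
    have e : (fun ε => graphIntegrand (uvRegularize (P.map φ) (χ ε)) x G)
        = fun ε => ∏ B ∈ G.parts.attach, fun y =>
          truncated (moment (uvRegularize (P.map φ) (χ ε)) (legPoint x y)) B.1 := by
      ext ε y
      rw [graphIntegrand, Finset.prod_apply, Finset.prod_attach G.parts fun B =>
        truncated (moment (uvRegularize (P.map φ) (χ ε)) (legPoint x y)) B]
    rw [e]
    -- A graph without legs has no blocks; its integrand is the constant `1`.
    rcases G.parts.attach.eq_empty_or_nonempty with h0 | h0
    · rw [h0]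
      exact tendstoInLp_of_tendsto (tendsto_const_nhds (x := (1 : ℝ)))
    · exact TendstoInLp.prod h0 fun B _ => hf B
  obtain ⟨hi, ht⟩ := key.tendsto_integral
  exact ⟨hi, _, ht.const_mul _⟩

end IsMassiveLevyField

end GraphConvergence

/-! ### Expansion of the perturbation terms into graphs -/

section WickExpansion

/-- The Wick power as a function of the value of the field. -/
def wickPolynomial (ν : Measure C(Plane, ℝ)) (p : ℕ) (t : ℝ) : ℝ :=
  wickProduct (_root_.moment ν fun _ : Fin p => (0 : Plane)) (fun _ => t) Finset.univ

/-- Probability laws of continuous fields with moments of all orders which at a single point do not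
depend on the point. -/
structure IsStationaryLaw (ν : Measure C(Plane, ℝ)) : Prop where
  isProbabilityMeasure : IsProbabilityMeasure ν
  memLp : ∀ (x : Plane) (k : ℕ), MemLp (fun f : C(Plane, ℝ) => f x) k ν
  integral_pow : ∀ (k : ℕ) (y : Plane), ∫ f, f y ^ k ∂ν = ∫ f, f (0 : Plane) ^ k ∂ν

theorem measurable_eval_prod {β : Type*} [MeasurableSpace β] {c : β → Plane} (hc : Measurable c) :
    Measurable fun z : C(Plane, ℝ) × β => z.1 (c z.2) := by
  have h : Measurable (Function.uncurry fun (y : Plane) (f : C(Plane, ℝ)) => f y) :=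
    measurable_uncurry_of_continuous_of_measurable (fun f => f.continuous) measurable_eval_field
  exact h.comp ((hc.comp measurable_snd).prodMk measurable_fst)

namespace IsStationaryLaw

variable {ν : Measure C(Plane, ℝ)} (h : IsStationaryLaw ν)
include h

theorem moment_const {ι : Type*} (y : Plane) :
    _root_.moment ν (fun _ : ι => y) = _root_.moment ν fun _ : ι => (0 : Plane) := by
  ext J
  simp only [_root_.moment, Finset.prod_const, h.integral_pow _ y]

theorem wickPower_eq (p : ℕ) (f : C(Plane, ℝ)) (y : Plane) :
    wickPower ν p f y = wickPolynomial ν p (f y) := by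
  rw [wickPower, wickPolynomial, h.moment_const]

/-- Separating the singletons from the cumulants in the exponential formula leaves powers of `t`
with deterministic coefficients, so integrability of Wick powers follows from that of field powers.
-/
theorem exists_wickPolynomial_eq (p : ℕ) :
    ∃ a : Finset (Fin p) → ℝ, ∀ t, wickPolynomial ν p t = ∑ B, a B * t ^ B.card := by
  have := h.isProbabilityMeasure
  refine ⟨fun B => partitionSum (-truncated (_root_.moment ν fun _ : Fin p => (0 : Plane)))
    (Finset.univ \ B), fun t => ?_⟩
  rw [wickPolynomial, wickProduct_eq_partitionSum (moment_empty ν _), sub_eq_add_neg,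
    partitionSum_add, subsetConv, Finset.powerset_univ]
  refine Finset.sum_congr rfl fun B _ => ?_
  rw [partitionSum_singletonValue, Finset.prod_const, mul_comm]

theorem memLp_wickPolynomial {β : Type*} [MeasurableSpace β] {μ : Measure β} [IsFiniteMeasure μ]
    {X : β → ℝ} (hX : ∀ k : ℕ, MemLp X k μ) (p k : ℕ) :
    MemLp (fun z => wickPolynomial ν p (X z)) k μ := by
  obtain ⟨a, ha⟩ := h.exists_wickPolynomial_eq p
  simp only [ha]
  refine memLp_finsetSum _ fun B _ => MemLp.const_mul ?_ _
  simpa using memLp_finset_prod (X := fun _ : Fin p => X) (J := B) (fun _ _ => hX) k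

/-- For an even power the integrand is nonnegative, and its integral over the field does not depend
on the position by stationarity; the finite measure `μ` makes the iterated integral finite. General
exponents follow by monotonicity. -/
theorem memLp_eval_prod {β : Type*} [MeasurableSpace β] (μ : Measure β) [IsFiniteMeasure μ]
    {c : β → Plane} (hc : Measurable c) (k : ℕ) :
    MemLp (fun z : C(Plane, ℝ) × β => z.1 (c z.2)) k (ν.prod μ) := by
  have := h.isProbabilityMeasure
  have hm := measurable_eval_prod hc
  rcases Nat.eq_zero_or_pos k with rfl | hk
  · simpa using hm.aestronglyMeasurable
  have h2 : MemLp (fun z : C(Plane, ℝ) × β => z.1 (c z.2)) (2 * k : ℕ) (ν.prod μ) := by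
    have hk0 : ((2 * k : ℕ) : ENNReal) ≠ 0 := by norm_cast; omega
    rw [← integrable_norm_rpow_iff hm.aestronglyMeasurable hk0 (ENNReal.natCast_ne_top _)]
    have e : ∀ t : ℝ, ‖t‖ ^ ((2 * k : ℕ) : ENNReal).toReal = t ^ (2 * k) := by
      intro t
      rw [ENNReal.toReal_natCast, Real.rpow_natCast, pow_mul, pow_mul, Real.norm_eq_abs, sq_abs]
    simp only [e]
    rw [integrable_prod_iff' (hm.pow_const _).aestronglyMeasurable]
    refine ⟨ae_of_all _ fun y => ?_, ?_⟩
    · have := (h.memLp (c y) (2 * k)).integrable_norm_rpow hk0 (ENNReal.natCast_ne_top _)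
      simpa only [e] using this
    · refine (integrable_const (∫ f, f (0 : Plane) ^ (2 * k) ∂ν)).congr (ae_of_all _ fun y => ?_)
      dsimp only
      rw [← h.integral_pow _ (c y)]
      refine integral_congr_ae (ae_of_all _ fun f => ?_)
      simp only [Real.norm_eq_abs]
      rw [abs_of_nonneg]
      exact Even.pow_nonneg (even_two_mul k) _
  exact h2.mono_exponent (by norm_cast; omega)

variable {n m : ℕ}

open Classical in
/-- Wick's theorem: the expectation of a product of field values and Wick powers is the sum over
the generalized Feynman graphs without self-contraction. -/
theorem integral_prod_mul_prod_wickPower (x : Fin n → Plane) (p : Fin m → ℕ) (y : Fin m → Plane) :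
    ∫ f, (∏ i, f (x i)) * ∏ l, wickPower ν (p l) f (y l) ∂ν
      = ∑ G : FeynmanGraph n p with G.NoSelfContraction, graphIntegrand ν x G y := by
  have := h.isProbabilityMeasure
  set M : Finset (Leg n p) → ℝ := _root_.moment ν (legPoint x y) with hM
  have hM0 : M ∅ = 1 := moment_empty ν _
  have e : ∀ f : C(Plane, ℝ), (∏ i, f (x i)) * ∏ l, wickPower ν (p l) f (y l)
      = ∑ B : Finset (Leg n p), (∏ j ∈ B, f (legPoint x y j)) *
        partitionSum (-selfContracted (truncated M)) Bᶜ := by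
    intro f
    rw [← prod_mul_prod_wickProduct hM0]
    congr 1
    refine Finset.prod_congr rfl fun l _ => ?_
    rw [wickPower]
    congr 1
    ext J
    rw [hM, moment_map]
    rfl
  simp only [e]
  rw [integral_finsetSum]
  · simp only [integral_mul_const]
    exact sum_mul_partitionSum_selfContracted hM0
  · exact fun B _ => (integrable_finset_prod_of_memLp (fun j => h.memLp (legPoint x y j)) B).mul_const _

theorem integrable_prod_mul_prod_wickPower (x : Fin n → Plane) (p : Fin m → ℕ)
    (y : Fin m → Plane) :
    Integrable (fun f : C(Plane, ℝ) => (∏ i, f (x i)) * ∏ l, wickPower ν (p l) f (y l)) ν := by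
  have := h.isProbabilityMeasure
  simp only [h.wickPower_eq]
  have h1 := integrable_finset_prod_of_memLp (P := ν)
    (X := Sum.elim (fun i (f : C(Plane, ℝ)) => f (x i)) fun (l : Fin m) f => wickPolynomial ν (p l) (f (y l)))
    (by
      rintro (i | l)
      · exact h.memLp (x i)
      · exact fun k => h.memLp_wickPolynomial (h.memLp (y l)) _ k) Finset.univ
  simpa only [Fintype.prod_sum_type, Sum.elim_inl, Sum.elim_inr] using h1

variable {Λ : Set Plane} (hΛ : volume Λ ≠ ⊤) (pbar : ℕ) (lam : ℕ → ℝ) (x : Fin n → Plane)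

/-- The `m`-th power of an integral over `Λ` is an integral over `Λ^m`, whose coordinates become the
positions of the inner vertices. -/
theorem perturbationIntegrand_eq (m : ℕ) (f : C(Plane, ℝ)) :
    perturbationIntegrand ν pbar lam Λ x m f
      = ∫ y in Set.univ.pi fun _ : Fin m => Λ, (∏ i, f (x i)) * ∏ l, ∑ p ∈ Finset.range (pbar + 1),
        lam p * wickPolynomial ν p (f (y l)) := by
  rw [perturbationIntegrand, wickInteraction, integral_const_mul, volume_pi, Measure.restrict_pi_pi,
    integral_fintype_prod_eq_pow (fun t : Plane => ∑ p ∈ Finset.range (pbar + 1),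
      lam p * wickPolynomial ν p (f t)), Fintype.card_fin]
  simp only [h.wickPower_eq]

include hΛ

theorem integrable_prod_perturbationIntegrand (m : ℕ) :
    Integrable (fun z : C(Plane, ℝ) × (Fin m → Plane) => (∏ i, z.1 (x i)) *
      ∏ l, ∑ p ∈ Finset.range (pbar + 1), lam p * wickPolynomial ν p (z.1 (z.2 l)))
      (ν.prod (volume.restrict (Set.univ.pi fun _ : Fin m => Λ))) := by
  have := h.isProbabilityMeasure
  have hfin := isFiniteMeasure_restrict_pi (m := m) hΛ
  have h1 := integrable_finset_prod_of_memLp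
    (P := ν.prod (volume.restrict (Set.univ.pi fun _ : Fin m => Λ)))
    (X := Sum.elim (fun i (z : C(Plane, ℝ) × (Fin m → Plane)) => z.1 (x i)) fun (l : Fin m) z =>
      ∑ p ∈ Finset.range (pbar + 1), lam p * wickPolynomial ν p (z.1 (z.2 l)))
    (by
      rintro (i | l)
      · exact h.memLp_eval_prod _ measurable_const
      · exact fun k => memLp_finsetSum _ fun p _ => (h.memLp_wickPolynomial
          (h.memLp_eval_prod _ (c := fun y : Fin m → Plane => y l)
            (measurable_pi_apply l)) _ k).const_mul _) Finset.univ
  simpa only [Fintype.prod_sum_type, Sum.elim_inl, Sum.elim_inr] using h1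

theorem integrable_perturbationIntegrand (m : ℕ) :
    Integrable (perturbationIntegrand ν pbar lam Λ x m) ν := by
  have := h.isProbabilityMeasure
  have hfin := isFiniteMeasure_restrict_pi (m := m) hΛ
  exact (h.integrable_prod_perturbationIntegrand hΛ pbar lam x m).integral_prod_left.congr
    (ae_of_all _ fun f => (h.perturbationIntegrand_eq pbar lam x m f).symm)

open Classical in
theorem perturbationTerm_eq (m : ℕ)
    (hG : ∀ (p : Fin m → ℕ) (G : FeynmanGraph n p), G.NoSelfContraction →
      IntegrableOn (graphIntegrand ν x G) (Set.univ.pi fun _ : Fin m => Λ)) :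
    perturbationTerm ν pbar lam Λ x m = (-1) ^ m / (m.factorial : ℝ) *
      ∑ p ∈ Fintype.piFinset fun _ : Fin m => Finset.range (pbar + 1),
        ∑ G : FeynmanGraph n p with G.NoSelfContraction, graphValue ν lam Λ x G := by
  have := h.isProbabilityMeasure
  have hfin := isFiniteMeasure_restrict_pi (m := m) hΛ
  rw [perturbationTerm]
  congr 1
  simp only [h.perturbationIntegrand_eq pbar lam x m]
  rw [integral_integral_swap (h.integrable_prod_perturbationIntegrand hΛ pbar lam x m)]
  have e : ∀ y : Fin m → Plane, ∫ f, (∏ i, f (x i)) * ∏ l, ∑ p ∈ Finset.range (pbar + 1),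
      lam p * wickPolynomial ν p (f (y l)) ∂ν
      = ∑ p ∈ Fintype.piFinset fun _ : Fin m => Finset.range (pbar + 1),
        ∑ G : FeynmanGraph n p with G.NoSelfContraction, (∏ l, lam (p l)) * graphIntegrand ν x G y := by
    intro y
    simp only [Finset.prod_univ_sum, Finset.mul_sum]
    rw [integral_finsetSum]
    · refine Finset.sum_congr rfl fun p _ => ?_
      rw [← Finset.mul_sum, ← h.integral_prod_mul_prod_wickPower, ← integral_const_mul]
      refine integral_congr_ae (ae_of_all _ fun f => ?_)
      simp only [h.wickPower_eq, Finset.prod_mul_distrib]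
      ring
    · intro p _
      refine ((h.integrable_prod_mul_prod_wickPower x p y).const_mul (∏ l, lam (p l))).congr
        (ae_of_all _ fun f => ?_)
      simp only [h.wickPower_eq, Finset.prod_mul_distrib]
      ring
  simp only [e]
  rw [integral_finsetSum]
  · refine Finset.sum_congr rfl fun p _ => ?_
    rw [integral_finsetSum]
    · exact Finset.sum_congr rfl fun G _ => integral_const_mul _ _
    · exact fun G hGm => (hG p G (Finset.mem_filter.1 hGm).2).const_mul _
  · exact fun p _ => integrable_finsetSum _ fun G hGm =>
      (hG p G (Finset.mem_filter.1 hGm).2).const_mul _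

end IsStationaryLaw

/-- Moments are determined by truncated moments, and at coinciding points these are translation
invariant: pairs see only the difference `0`, other blocks an integral over the whole plane. -/
theorem IsMassiveLevyField.isStationaryLaw {Ω : Type*} [MeasurableSpace Ω] {P : Measure Ω}
    [IsProbabilityMeasure P] {ψ : ℝ → ℂ} {m₀ : ℝ} {η ηg φ : Ω → RealDistribution}
    (h : IsMassiveLevyField P ψ m₀ η ηg φ) (χ : 𝓢(Plane, ℝ)) :
    IsStationaryLaw (uvRegularize (P.map φ) χ) := by
  have := h.isProbabilityMeasure_uvRegularize χ
  refine ⟨this, h.memLp_eval_field χ, fun k y => ?_⟩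
  set ν := uvRegularize (P.map φ) χ with hν
  have ht : ∀ B : Finset (Fin k), B.Nonempty →
      truncated (_root_.moment ν fun _ : Fin k => y) B
        = truncated (_root_.moment ν fun _ : Fin k => (0 : Plane)) B := by
    intro B hB
    by_cases hB2 : B.card = 2
    · obtain ⟨a, b, hab, rfl⟩ := Finset.card_eq_two.1 hB2
      rw [h.truncated_moment_pair _ _ hab, h.truncated_moment_pair _ _ hab, sub_self, sub_self]
    · rw [h.truncated_moment _ _ hB hB2, h.truncated_moment _ _ hB hB2]
      congr 1
      rw [integral_sub_left_eq_self (fun z => ∏ _j ∈ B, smear χ (massiveGreen m₀) z) volume y,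
        integral_sub_left_eq_self (fun z => ∏ _j ∈ B, smear χ (massiveGreen m₀) z) volume 0]
  have e : ∀ z : Plane, ∫ f, f z ^ k ∂ν = _root_.moment ν (fun _ : Fin k => z) Finset.univ := by
    intro z
    simp [_root_.moment]
  rw [e, e, ← partitionSum_truncated (moment_empty ν fun _ : Fin k => y),
    ← partitionSum_truncated (moment_empty ν fun _ : Fin k => (0 : Plane))]
  exact partitionSum_congr fun B _ hB => ht B hB

end WickExpansion

end

theorem theorem5p2 {Ω : Type*} [MeasurableSpace Ω] (P : Measure Ω) [IsProbabilityMeasure P]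
    (ψ : ℝ → ℂ) (hψ : IsLevyCharacteristic ψ) (hψ_smooth : ContDiffAt ℝ ∞ ψ 0)
    (m₀ : ℝ) (hm₀ : 0 < m₀)
    (η ηg φ : Ω → RealDistribution)
    (hη_meas : Measurable η) (hηg_meas : Measurable ηg) (hφ_meas : Measurable φ)
    (hη : IsLevyNoise P ψ η)
    (hηg : IsGradientGaussianNoise P (levyCumulant ψ 2 / (2 * m₀ ^ 2)) ηg)
    (hindep : IndepFun η ηg P)
    (hφ : ∀ᵐ w ∂P, SolvesMassiveEquation m₀ (φ w) (η w + ηg w))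
    (χ : ℝ → 𝓢(Plane, ℝ)) (hχ : IsDiracApproximation χ)
    (pbar : ℕ) (lam : ℕ → ℝ)
    (Λ : Set Plane) (hΛ_meas : MeasurableSet Λ) (hΛ_bdd : Bornology.IsBounded Λ)
    (n : ℕ) (x : Fin n → Plane) (hx : Function.Injective x) (m : ℕ) :
    ((∀ ε > 0, Integrable
        (perturbationIntegrand (uvRegularize (P.map φ) (χ ε)) pbar lam Λ x m)
        (uvRegularize (P.map φ) (χ ε))) ∧
      ∃ a : ℝ, Tendsto
        (fun ε => perturbationTerm (uvRegularize (P.map φ) (χ ε)) pbar lam Λ x m)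
        (𝓝[>] 0) (𝓝 a)) ∧
    ∀ p : Fin m → ℕ, (∀ l, p l ≤ pbar) → ∀ G : FeynmanGraph n p, G.NoSelfContraction →
      (∀ ε > 0, IntegrableOn (graphIntegrand (uvRegularize (P.map φ) (χ ε)) x G)
        (Set.univ.pi fun _ : Fin m => Λ)) ∧
      ∃ a : ℝ, Tendsto
        (fun ε => graphValue (uvRegularize (P.map φ) (χ ε)) lam Λ x G)
        (𝓝[>] 0) (𝓝 a) := by
  classical
  have h : IsMassiveLevyField P ψ m₀ η ηg φ :=
    ⟨hψ, hψ_smooth, hm₀, hη_meas, hηg_meas, hφ_meas, hη, hηg, hindep, hφ⟩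
  have hΛ : volume Λ ≠ ⊤ := hΛ_bdd.measure_lt_top.ne
  refine ⟨⟨fun ε _ => (h.isStationaryLaw (χ ε)).integrable_perturbationIntegrand hΛ pbar lam x m,
    ?_⟩, fun p _ G hG => ⟨fun ε _ => (h.graphValue_converges hχ hΛ lam hx hG).1 ε,
      (h.graphValue_converges hχ hΛ lam hx hG).2⟩⟩
  -- The term is a finite sum over vertex types and admissible graphs, so the limits of the graph
  -- values may be added.
  choose! a ha using fun (p : Fin m → ℕ) (G : FeynmanGraph n p) (hG : G.NoSelfContraction) =>
    (h.graphValue_converges hχ hΛ lam hx hG).2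
  simp only [fun ε => (h.isStationaryLaw (χ ε)).perturbationTerm_eq hΛ pbar lam x m
    fun p G hG => (h.graphValue_converges hχ hΛ lam hx hG).1 ε]
  exact ⟨_, (tendsto_finsetSum _ fun p _ => tendsto_finsetSum _ fun G hG =>
    ha p G (Finset.mem_filter.1 hG).2).const_mul _⟩
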